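/- **Notation.** Let $n,m\ge 1$ be integers, $\beta\in\mathbb C$, $\mathbb H=\{x+iy:y>0\}$, $\mathbb C'=\mathbb C\setminus(-\infty,0]$, and $T=\begin{pmatrix}1&1\\0&1\end{pmatrix}$, $T'=\begin{pmatrix}1&0\\1&1\end{pmatrix}$, $B_m=\begin{pmatrix}m&0\\0&1\end{pmatrix}$. *Maass cusp forms.* $S(n,\beta)$ is the space of real-analytic $u:\mathbb H\to\mathbb C$ with $u(gz)=u(z)$ for $g\in\Gamma_0(n)$, $-y^2(\partial_x^2+\partial_y^2)u=\beta(1-\beta)u$, and $u(gz)=O((\operatorname{Im}z)^C)$ as $\operatorname{Im}z\to\infty$ for all $g\in SL(2,\mathbb Z)$ and all $C\in\mathbb R$. For an integer matrix $h$ with $\det h>0$ put $(u|_0h)(z)=u(hz)$. *Index set.* On $\mathbb Z^2$ let $(x,y)\sim_n(x',y')$ iff $x'\equiv kx$, $y'\equiv ky \pmod n$ for some $k$ coprime to $n$, and denote the class by $[x:y]_n$. Let $I_n$ be the set of classes $[c:d]_n$ of bottom rows of elements of $GL(2,\mathbb Z)$. For $d\mid N$ there is the natural projection $I_N\to I_d$,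 $[x:y]_N\mapsto[x:y]_d$; let $\sigma:I_{nm}\to I_m$ be the one for $N=nm$, $d=m$. Let $P_n$ be the set of integer pairs $(c,b)$ with $c\ge1$, $c\mid n$, $0\le b\le n/c-1$, $\gcd(c,b,n/c)=1$. The map $P_n\to I_n$, $(c,b)\mapsto[c:d_n(c,b)]_n$, where $d_n(c,b)=\min\{c+b+k\frac nc: 0\le k\le c-1,\ \gcd(c,b+k\frac nc)=1\}$, is a bijection; for $i\in I_n$ corresponding to $(c,b)$ put $A_i=\begin{pmatrix}c&b\\0&n/c\end{pmatrix}$. *The lift.* For a nonnegative integer matrix $h=\begin{pmatrix}a&b\\c&d\end{pmatrix}$ with $\det h>0$ and $f:\mathbb C'\to\mathbb C$ put $(f|_\beta h)(z)=(\det h)^\beta(cz+d)^{-2\beta}f\big(\frac{az+b}{cz+d}\big)$. Let $S_m$ be the set of integer matrices of determinant $m$ with $a>c\ge0$, $d>b\ge0$, and $Y_m=\{A\in S_m: b=0\}$. For $A\in S_m\setminus Y_m$ put $K(A)=\begin{pmatrix}-c+\lceil d/b\rceil a&-d+\lceil d/b\rceil b\\a&b\end{pmatrix}$, and let $k_A\ge0$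 be the first $k$ with $K^kA\in Y_m$. For $j\in I_{nm}$ and $0\le s\le k_{A_{\sigma(j)}}$ let $l_{j,s}\in I_n$ be the unique index with $A_{l_{j,s}}\,K^s(A_{\sigma(j)})\,A_j^{-1}\in SL(2,\mathbb Z)$. The lift of a vector $\vec\phi=(\phi_i)_{i\in I_n}$ of functions on $\mathbb C'$ is $\vec\Phi=(\Phi_j)_{j\in I_{nm}}$, $$\Phi_j=\sum_{s=0}^{k_{A_{\sigma(j)}}}\phi_{l_{j,s}}\big|_\beta K^s(A_{\sigma(j)}).$$ *Lewis equation.* For $g\in SL(2,\mathbb Z)$ let $\tilde\rho_n(g)$ be the $I_n\times I_n$ permutation matrix whose $(i,j)$ entry is $1$ if $A_igA_j^{-1}\in SL(2,\mathbb Z)$ and $0$ otherwise; $\tilde\rho_n$ is equivalent to the representation induced from the trivial representation of $\Gamma_0(n)$. The Lewis equation for $\Gamma_0(n)$ with parameter $\beta$ is $$\vec\phi(z)-\tilde\rho_n(T^{-1})\vec\phi(z+1)-(z+1)^{-2\beta}\tilde\rho_n(T'^{-1})\vec\phi\Big(\frac z{z+1}\Big)=0\qquad(z\in\mathbb C').$$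 *Period functions.* Let $(R_j)_{j\in I_n}$ be any system of representatives of $\Gamma_0(n)\backslash SL(2,\mathbb Z)$ indexed by $I_n$, and put $\Pi_nu=(u|_0R_j)_{j\in I_n}$. Let $R_\zeta(z)=\frac{y}{(x-\zeta)^2+y^2}$ and $\eta(u,w)=(w\,\partial_yu-u\,\partial_yw)\,dx+(u\,\partial_xw-w\,\partial_xu)\,dy$. For a vector $\vec u=(u_i)_{i\in I_n}$ put $(\mathrm P_n\vec u)_i(\zeta)=\int_0^{i\infty}\eta(u_i,R_\zeta^\beta)$ for $\zeta\in\mathbb C'$. The path is the imaginary axis if $\operatorname{Re}\zeta>0$, and otherwise the ray from $0$ of angle $\frac12(\pi+|\arg\zeta|)$. Here $R_\zeta^\beta=y^\beta(\zeta-z)^{-\beta}(\zeta-\bar z)^{-\beta}$ with principal powers. Let $h_n:I_n\to I_n$ be the bijection for which $h_n(i)=l$ iff $\begin{pmatrix}0&1\\-n&0\end{pmatrix}R_i\in SL(2,\mathbb Z)A_l$, and let $\mathcal H_n$ be the permutation matrix with $(\mathcal H_n)_{i,j}=1$ if $h_n(j)=i$ and $0$ otherwise. Define $\mathcal H_{nm},\mathrm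 P_{nm},\Pi_{nm}$ in the same way from any system of representatives of $\Gamma_0(nm)\backslash SL(2,\mathbb Z)$ indexed by $I_{nm}$. **Lemma.** Let $u\in S(n,\beta)$, let $\vec\phi=\mathcal H_n\mathrm P_n\Pi_nu$ be its vector valued period function, and let $\vec\Phi$ be the lift of $\vec\phi$. Put $v=u|_0B_m$. Then $v\in S(nm,\beta)$, $\vec\phi$ and $\vec\Phi$ solve the Lewis equations with parameter $\beta$ for $\Gamma_0(n)$ and $\Gamma_0(nm)$ respectively, and $$\vec\Phi=\mathcal H_{nm}\,\mathrm P_{nm}\,\Pi_{nm}v\qquad\text{on }\mathbb C'.$$ -/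

import Mathlib

open scoped MatrixGroups UpperHalfPlane

noncomputable section

namespace MaassPeriod

/-! ### The index set and the matrices attached to it -/

/-- `(x, y) ∼ₙ (x', y')` iff there is `k` coprime to `n` with `x' ≡ k x`, `y' ≡ k y` mod `n`. -/
def projSetoid (n : ℕ) : Setoid (ℤ × ℤ) where
  r p q := ∃ k : ℤ, IsCoprime k (n : ℤ) ∧ q.1 ≡ k * p.1 [ZMOD n] ∧ q.2 ≡ k * p.2 [ZMOD n]
  iseqv := by
    refine ⟨fun p => ⟨1, isCoprime_one_left, by simp [Int.ModEq.refl], by simp [Int.ModEq.refl]⟩,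
      ?_, ?_⟩
    · rintro p q ⟨k, ⟨a, b, hab⟩, h1, h2⟩
      have key : ∀ x y : ℤ, y ≡ k * x [ZMOD n] → x ≡ a * y [ZMOD n] := by
        intro x y h
        have e : a * (k * x) = x - n * (b * x) := by linear_combination x * hab
        have h' := (h.mul_left a).symm
        rw [e] at h'
        exact (Int.modEq_iff_dvd.2 ⟨-(b * x), by ring⟩ : x ≡ x - n * (b * x) [ZMOD n]).trans h'
      exact ⟨a, ⟨k, b, by linear_combination hab⟩, key _ _ h1, key _ _ h2⟩
    · rintro p q r ⟨k, hk, h1, h2⟩ ⟨l, hl, h3, h4⟩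
      refine ⟨l * k, hl.mul_left hk, ?_, ?_⟩
      · rw [mul_assoc]; exact h3.trans (h1.mul_left l)
      · rw [mul_assoc]; exact h4.trans (h2.mul_left l)

/-- The class `[x : y]ₙ`. -/
def cls (n : ℕ) (x y : ℤ) : Quotient (projSetoid n) := Quotient.mk (projSetoid n) (x, y)

/-- `Iₙ`: the orbit of `[0 : 1]ₙ` under `GL(2, ℤ)`, i.e. the classes `[c : d]ₙ` of the bottom rows
of the elements of `GL(2, ℤ)`. -/
def Idx (n : ℕ) : Type :=
  {q : Quotient (projSetoid n) // ∃ g : GL (Fin 2) ℤ,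
    q = cls n ((g : Matrix (Fin 2) (Fin 2) ℤ) 1 0) ((g : Matrix (Fin 2) (Fin 2) ℤ) 1 1)}

instance (n : ℕ) : Nonempty (Idx n) := ⟨⟨_, 1, rfl⟩⟩

instance (n : ℕ) [NeZero n] : Finite (Idx n) := by
  have hn : (n : ℤ) ≠ 0 := by exact_mod_cast NeZero.ne n
  have : Finite (Quotient (projSetoid n)) := by
    refine Finite.of_surjective
      (fun p : ZMod n × ZMod n => cls n (p.1.val : ℤ) (p.2.val : ℤ)) ?_
    intro q
    induction q using Quotient.inductionOn with
    | h p =>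
      refine ⟨((p.1 : ZMod n), (p.2 : ZMod n)), Quotient.sound ?_⟩
      refine ⟨1, isCoprime_one_left, ?_, ?_⟩
      · rw [one_mul, ← ZMod.intCast_eq_intCast_iff]; simp
      · rw [one_mul, ← ZMod.intCast_eq_intCast_iff]; simp
  exact Subtype.finite

instance (n : ℕ) [NeZero n] : Fintype (Idx n) := Fintype.ofFinite _

/-- The natural projection `I_N → I_d`, `[x : y]_N ↦ [x : y]_d`, for `d ∣ N`. -/
def proj {d N : ℕ} (h : d ∣ N) (i : Idx N) : Idx d :=
  ⟨Quotient.map' (s₁ := projSetoid N) (s₂ := projSetoid d) id (by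
      rintro p q ⟨k, hk, h1, h2⟩
      have h' : (d : ℤ) ∣ (N : ℤ) := Int.natCast_dvd_natCast.2 h
      exact ⟨k, hk.of_isCoprime_of_dvd_right h', h1.of_dvd h', h2.of_dvd h'⟩) i.1, by
    obtain ⟨q, g, rfl⟩ := i
    exact ⟨g, rfl⟩⟩

/-- `Pₙ`: the pairs `(c, b)` with `c ≥ 1`, `c ∣ n`, `0 ≤ b ≤ n / c - 1`,
`gcd (c, b, n / c) = 1`. -/
def pairs (n : ℕ) : Set (ℕ × ℕ) :=
  {p | 1 ≤ p.1 ∧ p.1 ∣ n ∧ p.2 < n / p.1 ∧ Nat.gcd p.1 (Nat.gcd p.2 (n / p.1)) = 1}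

/-- `dₙ(c, b) = min {c + b + k n / c : 0 ≤ k ≤ c - 1, gcd (c, b + k n / c) = 1}`. -/
def dmin (n : ℕ) (p : ℕ × ℕ) : ℕ :=
  sInf {d | ∃ k < p.1, Nat.gcd p.1 (p.2 + k * (n / p.1)) = 1 ∧ d = p.1 + p.2 + k * (n / p.1)}

/-- The inverse of the bijection `Pₙ → Iₙ`, `(c, b) ↦ [c : dₙ(c, b)]ₙ`. -/
def pairOf (n : ℕ) (i : Idx n) : ℕ × ℕ :=
  Classical.epsilon fun p => p ∈ pairs n ∧ cls n p.1 (dmin n p) = i.1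

/-- The matrix `Aᵢ = (c, b; 0, n / c)` of the index `i` corresponding to `(c, b) ∈ Pₙ`. -/
def matA (n : ℕ) (i : Idx n) : Matrix (Fin 2) (Fin 2) ℤ :=
  !![((pairOf n i).1 : ℤ), ((pairOf n i).2 : ℤ); 0, ((n / (pairOf n i).1 : ℕ) : ℤ)]

/-! ### The map `K` and the lifting of vectors of functions from level `n` to level `n m` -/

/-- `Sₙ`: integer matrices `(a, b; c, d)` of determinant `n` with `a > c ≥ 0`, `d > b ≥ 0`. -/
def setS (n : ℕ) : Set (Matrix (Fin 2) (Fin 2) ℤ) :=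
  {A | A.det = n ∧ 0 ≤ A 1 0 ∧ A 1 0 < A 0 0 ∧ 0 ≤ A 0 1 ∧ A 0 1 < A 1 1}

/-- `Yₙ`: the lower triangular elements of `Sₙ`. -/
def setY (n : ℕ) : Set (Matrix (Fin 2) (Fin 2) ℤ) := {A | A ∈ setS n ∧ A 0 1 = 0}

/-- `K (a, b; c, d) = (-c + ⌈d / b⌉ a, -d + ⌈d / b⌉ b; a, b)`; it is only applied to elements of
`Sₙ` outside `Yₙ`, where `b > 0`. -/
def mapK (A : Matrix (Fin 2) (Fin 2) ℤ) : Matrix (Fin 2) (Fin 2) ℤ :=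
  !![-(A 1 0) + ⌈(A 1 1 : ℚ) / (A 0 1 : ℚ)⌉ * A 0 0, -(A 1 1) + ⌈(A 1 1 : ℚ) / (A 0 1 : ℚ)⌉ * A 0 1;
     A 0 0, A 0 1]

/-- `k_A`: the first `k` with `K^k A ∈ Yₙ`. -/
def steps (n : ℕ) (A : Matrix (Fin 2) (Fin 2) ℤ) : ℕ := sInf {k | mapK^[k] A ∈ setY n}

/-- `X Y⁻¹ ∈ SL(2, ℤ)`, written as `X ∈ SL(2, ℤ) Y`. -/
def SLEquiv (X Y : Matrix (Fin 2) (Fin 2) ℤ) : Prop :=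
  ∃ γ : SL(2, ℤ), X = (γ : Matrix (Fin 2) (Fin 2) ℤ) * Y

/-- For `i ∈ I_{nm}`, the unique index `l = l_{i,s} ∈ Iₙ` with
`A_l K^s(A_{σ(i)}) Aᵢ⁻¹ ∈ SL(2, ℤ)`, where `σ : I_{nm} → I_m` is the projection. -/
def idxL (n m : ℕ) (i : Idx (n * m)) (s : ℕ) : Idx n :=
  Classical.epsilon fun l =>
    SLEquiv (matA n l * mapK^[s] (matA m (proj (Dvd.intro_left n rfl) i))) (matA (n * m) i)

/-- The weight `2β` slash action
`(f |_β h)(z) = |det h|^β (c z + d)^(-2β) f ((a z + b) / (c z + d))`. -/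
def slash (β : ℂ) (h : Matrix (Fin 2) (Fin 2) ℤ) (f : ℂ → ℂ) (z : ℂ) : ℂ :=
  ((|h.det| : ℤ) : ℂ) ^ β * ((h 1 0 : ℂ) * z + (h 1 1 : ℂ)) ^ (-2 * β) *
    f (((h 0 0 : ℂ) * z + (h 0 1 : ℂ)) / ((h 1 0 : ℂ) * z + (h 1 1 : ℂ)))

/-- The lift `Φ_j = ∑_{s=0}^{k_{σ(j)}} φ_{l_{j,s}} |_β K^s (A_{σ(j)})`, `j ∈ I_{nm}`, of a vector
`φ = (φ_i)`, `i ∈ Iₙ`. -/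
def lift (n m : ℕ) (β : ℂ) (φ : Idx n → ℂ → ℂ) (j : Idx (n * m)) (z : ℂ) : ℂ :=
  ∑ s ∈ Finset.range (steps m (matA m (proj (Dvd.intro_left n rfl) j)) + 1),
    slash β (mapK^[s] (matA m (proj (Dvd.intro_left n rfl) j))) (φ (idxL n m j s)) z

/-! ### The Lewis equation -/

open Classical in
/-- The permutation representation `ρ̃ₙ` of `SL(2, ℤ)`: the `(i, j)` entry of `ρ̃ₙ(g)` is `1` if
`Aᵢ g A_j⁻¹ ∈ SL(2, ℤ)` and `0` otherwise. It is the representation induced from the trivial one of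
`Γ₀(n)`, the cosets being labelled by the matrices `Aᵢ`. -/
def rhoTilde (n : ℕ) (g : SL(2, ℤ)) : Matrix (Idx n) (Idx n) ℂ :=
  fun i j => if SLEquiv (matA n i * (g : Matrix (Fin 2) (Fin 2) ℤ)) (matA n j) then 1 else 0

/-- `T' = (1, 0; 1, 1)`. -/
def T' : SL(2, ℤ) := ⟨!![1, 0; 1, 1], by simp [Matrix.det_fin_two]⟩

/-- The generalized Lewis equation on the cut plane for a vector indexed by `Iₙ`:
`φ(z) - ρ̃(T⁻¹) φ(z + 1) - (z + 1)^(-2β) ρ̃(T'⁻¹) φ(z / (z + 1)) = 0`. -/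
def IsLewisSolution (n : ℕ) [NeZero n] (β : ℂ) (φ : Idx n → ℂ → ℂ) : Prop :=
  ∀ z ∈ Complex.slitPlane,
    (fun i => φ i z) - (rhoTilde n ModularGroup.T⁻¹).mulVec (fun i => φ i (z + 1))
      - (z + 1) ^ (-2 * β) • (rhoTilde n T'⁻¹).mulVec (fun i => φ i (z / (z + 1))) = 0

/-! ### Maass cusp forms and their period functions -/

/-- `u ∈ S(n, β)`. -/
structure IsMaassCuspForm (n : ℕ) (β : ℂ) (u : ℍ → ℂ) : Prop where
  analytic : AnalyticOnNhd ℝ (fun z : ℂ => u (UpperHalfPlane.ofComplex z)) {z | 0 < z.im}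
  invariant : ∀ g ∈ CongruenceSubgroup.Gamma0 n, ∀ z : ℍ, u (g • z) = u z
  eigen : ∀ z : ℍ, -((z.im : ℂ) ^ 2 *
      Laplacian.laplacian (fun w : ℂ => u (UpperHalfPlane.ofComplex w)) (z : ℂ)) =
    β * (1 - β) * u z
  /-- Rapid decay at every cusp `g ∞`. -/
  decay : ∀ (g : SL(2, ℤ)) (C : ℝ),
    (fun z : ℍ => u (g • z)) =O[UpperHalfPlane.atImInfty] fun z : ℍ => z.im ^ C

/-- `(u |₀ h)(z) = u (h z)` for an integer matrix `h` of positive determinant. -/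
def slashZero (u : ℍ → ℂ) (h : Matrix (Fin 2) (Fin 2) ℤ) (z : ℍ) : ℂ :=
  u (UpperHalfPlane.ofComplex
    (((h 0 0 : ℂ) * z + (h 0 1 : ℂ)) / ((h 1 0 : ℂ) * z + (h 1 1 : ℂ))))

/-- `B_m = (m, 0; 0, 1)`. -/
def matB (m : ℕ) : Matrix (Fin 2) (Fin 2) ℤ := !![(m : ℤ), 0; 0, 1]

/-- `R` is a system of representatives, labelled by `Iₙ`, of the right cosets `Γ₀(n) \ SL(2, ℤ)`:
`SL(2, ℤ)` is the disjoint union of the `Γ₀(n) R_j`. -/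
def IsRepSystem (n : ℕ) (R : Idx n → SL(2, ℤ)) : Prop :=
  ∀ g : SL(2, ℤ), ∃! j, ∃ γ ∈ CongruenceSubgroup.Gamma0 n, g = γ * R j

/-- `Πₙ u = (u |₀ R_j)`, `j ∈ Iₙ`. -/
def vecForm {n : ℕ} (R : Idx n → SL(2, ℤ)) (u : ℍ → ℂ) (j : Idx n) : ℍ → ℂ :=
  slashZero u (R j : Matrix (Fin 2) (Fin 2) ℤ)

/-- The value on the tangent vector `w` at `z` of the 1-form
`η(u, v) = (v ∂_y u - u ∂_y v) dx + (u ∂_x v - v ∂_x u) dy`. -/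
def eta (u v : ℂ → ℂ) (z w : ℂ) : ℂ :=
  (v z * lineDeriv ℝ u z Complex.I - u z * lineDeriv ℝ v z Complex.I) * (w.re : ℂ) +
    (u z * lineDeriv ℝ v z 1 - v z * lineDeriv ℝ u z 1) * (w.im : ℂ)

/-- The power `R_ζ(z)^β` of the Poisson kernel
`R_ζ(z) = y / ((x - ζ)² + y²) = y / ((ζ - z) (ζ - z̄))`, written as
`y^β (ζ - z)^(-β) (ζ - z̄)^(-β)`. For `ζ > 0` this is the positive power of a positive number; with
principal powers it is holomorphic in `ζ` in every sector `|arg ζ| < arg z`. -/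
def poissonPow (β ζ z : ℂ) : ℂ :=
  (z.im : ℂ) ^ β * (ζ - z) ^ (-β) * (ζ - (starRingEnd ℂ) z) ^ (-β)

/-- The angle of the ray from `0` to `∞` along which the period integral at `ζ` is taken: the
imaginary axis if `Re ζ > 0`, and otherwise a ray in the upper half plane with `ζ` and `ζ̄` on its
right. -/
def rayAngle (ζ : ℂ) : ℝ := if 0 < ζ.re then Real.pi / 2 else (Real.pi + |ζ.arg|) / 2

/-- The period integral `∫₀^{i∞} η(u, R_ζ^β)`, as a function of `ζ` in the cut plane. -/
def periodInt (β : ℂ) (u : ℍ → ℂ) (ζ : ℂ) : ℂ :=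
  ∫ t in Set.Ioi (0 : ℝ),
    eta (fun z => u (UpperHalfPlane.ofComplex z)) (poissonPow β ζ)
      ((t : ℂ) * Complex.exp ((rayAngle ζ : ℂ) * Complex.I))
      (Complex.exp ((rayAngle ζ : ℂ) * Complex.I))

/-- `(Pₙ u)_i(ζ) = ∫₀^{i∞} η(u_i, R_ζ^β)` for a vector `u = (u_i)`, `i ∈ Iₙ`. -/
def vecPeriod {n : ℕ} (β : ℂ) (u : Idx n → ℍ → ℂ) (i : Idx n) (ζ : ℂ) : ℂ :=
  periodInt β (u i) ζ

/-- The map `hₙ : Iₙ → Iₙ`: `hₙ(i)` is the index `l` with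
`(0, 1; -n, 0) Rᵢ ∈ SL(2, ℤ) A_l`. -/
def mapH {n : ℕ} (R : Idx n → SL(2, ℤ)) (i : Idx n) : Idx n :=
  Classical.epsilon fun l =>
    SLEquiv (!![0, 1; -(n : ℤ), 0] * (R i : Matrix (Fin 2) (Fin 2) ℤ)) (matA n l)

open Classical in
/-- The permutation matrix `ℋₙ`: its `(i, j)` entry is `1` if `hₙ(j) = i` and `0` otherwise. -/
def matH {n : ℕ} (R : Idx n → SL(2, ℤ)) : Matrix (Idx n) (Idx n) ℂ :=
  fun i j => if mapH R j = i then 1 else 0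

/-- `ℋₙ ψ` for a vector `ψ` of functions. -/
def actH {n : ℕ} [NeZero n] (R : Idx n → SL(2, ℤ)) (ψ : Idx n → ℂ → ℂ) (i : Idx n) (ζ : ℂ) : ℂ :=
  (matH R).mulVec (fun j => ψ j ζ) i

end MaassPeriod

end

noncomputable section

namespace MaassPeriod

section

open Complex Set Filter Topology MeasureTheory Laplacian

/-! ### An interior gradient estimate -/

/-! Fix a real `x > 0`. A cusp form `v` and the power of the Poisson kernel at `x` are
eigenfunctions of the hyperbolic Laplacian with the same eigenvalue, so the period form is closed
and has a primitive `F` on the upper half plane. Rapid decay of `v` and of its gradient gives `F` a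
limit at every cusp `g(∞) ≠ x` (`cuspLim`), and the period integral of `v` at `x` is `F(∞) - F(0)`
(`rayInt_eq_cuspLim`).

Let `h` be a nonnegative matrix and `f ∘ h = v`. The kernel transforms with the same factor as the
slash action, so slashing the period integral of `f` by `h` gives `F(h⁻¹∞) - F(h⁻¹0)`
(`slash_rayInt_eq_cuspLim`). If `h_{s+1} = (k, -1; 1, 0) h_s`, then `h_{s+1}⁻¹∞ = h_s⁻¹0`, so the
sum over such a chain telescopes. When `h_0` is upper triangular and the last matrix is lower
triangular, the outer cusps are `∞` and `0`, and the sum is the period integral of `v`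
(`sum_slash_rayInt`). Both sides are holomorphic on the cut plane, so the identity passes from the
positive reals to all of it (`sum_slash_periodInt`).

Each assertion about period functions is an instance of this. The matrices `K^s(A)` form such a
chain from the upper triangular `A` to a lower triangular matrix; the result is the formula for the
lift. The pair `T`, `T' = (1, -1; 1, 0) T` is another chain, and it gives the Lewis equation.

What remains is bookkeeping with cosets. The `A_i` represent the primitive integer matrices of
determinant `n` modulo left multiplication by `SL(2, ℤ)` (`exists_slEquiv_matA`,
`eq_of_slEquiv_matA`). The matrix `(0, 1; -n, 0)` translates cosets of `Γ₀(n)` into these classes.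
Hence a relation `A_l h ∈ SL(2, ℤ) A_j` becomes `R h = γ B_m R'` with `γ ∈ Γ₀(n)`, which says that
`u ∘ R ∘ h` is the component `v ∘ R'` (`IsMaassCuspForm.ext_vecForm_comp_mob`). -/

lemma circleMap_mem_closedBall_of_abs_le {z : ℂ} {r R : ℝ} (hr : |r| ≤ R) (θ : ℝ) :
    circleMap z r θ ∈ Metric.closedBall z R := by
  simpa [circleMap, Metric.mem_closedBall, dist_eq_norm] using hr

/-- The derivative in `r` of a weighted integral over the circle of radius `r`. -/
lemma hasDerivAt_integral_circleMap {p : ℂ → ℂ} {s : Set ℂ} {z : ℂ} (hs : IsOpen s)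
    (hz : Metric.closedBall z 2 ⊆ s) (hp : ContDiffOn ℝ 1 p s) {φ : ℝ → ℂ} (hφ : Continuous φ)
    {r : ℝ} (hr : r ∈ Ioo (-2 : ℝ) 2) :
    HasDerivAt (fun r : ℝ => ∫ θ in 0..2 * Real.pi, p (circleMap z r θ) * φ θ)
      (∫ θ in 0..2 * Real.pi, fderiv ℝ p (circleMap z r θ) (exp (θ * I)) * φ θ) r := by
  have hmem : ∀ r ∈ Ioo (-2 : ℝ) 2, ∀ θ, circleMap z r θ ∈ s := fun r hr θ =>
    hz (circleMap_mem_closedBall_of_abs_le (abs_le.2 ⟨hr.1.le, hr.2.le⟩) θ)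
  have hd : ContinuousOn (fderiv ℝ p) s := hp.continuousOn_fderiv_of_isOpen hs le_rfl
  obtain ⟨C, hC⟩ := (isCompact_closedBall z 2).exists_bound_of_continuousOn (hd.mono hz)
  have hcont : ∀ r ∈ Ioo (-2 : ℝ) 2, Continuous fun θ => p (circleMap z r θ) := fun r hr =>
    hp.continuousOn.comp_continuous (continuous_circleMap z r) (hmem r hr)
  refine (intervalIntegral.hasDerivAt_integral_of_dominated_loc_of_deriv_le
    (F' := fun r θ => fderiv ℝ p (circleMap z r θ) (exp (θ * I)) * φ θ)
    (bound := fun θ => C * ‖φ θ‖)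
    (isOpen_Ioo.mem_nhds hr) ?_ ?_ ?_ ?_ ?_ ?_).2
  · filter_upwards [isOpen_Ioo.mem_nhds hr] with x hx
    exact ((hcont x hx).mul hφ).aestronglyMeasurable
  · exact ((hcont r hr).mul hφ).intervalIntegrable _ _
  · refine Continuous.aestronglyMeasurable (Continuous.mul (Continuous.clm_apply ?_ ?_) hφ)
    · exact hd.comp_continuous (continuous_circleMap z r) (hmem r hr)
    · fun_prop
  · refine Eventually.of_forall fun θ _ x hx => ?_
    rw [norm_mul]
    gcongr
    refine (ContinuousLinearMap.le_opNorm _ _).trans ?_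
    rw [norm_exp_ofReal_mul_I, mul_one]
    exact hC _ (circleMap_mem_closedBall_of_abs_le (abs_le.2 ⟨hx.1.le, hx.2.le⟩) θ)
  · exact (continuous_const.mul hφ.norm).intervalIntegrable _ _
  · refine Eventually.of_forall fun θ _ x hx => ?_
    refine HasDerivAt.mul_const ?_ _
    have h1 : HasDerivAt (fun r : ℝ => circleMap z r θ) (exp (θ * I)) x := by
      simpa [circleMap] using ((ofRealCLM.hasDerivAt (x := x)).mul_const (exp (θ * I))).const_add z
    exact ((hp.differentiableOn one_ne_zero).differentiableAt
      (hs.mem_nhds (hmem x hx θ))).hasFDerivAt.comp_hasDerivAt x h1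

/-- Integration by parts over a circle against `exp (-i k θ)`. -/
lemma integral_fderiv_circleMap_tangent {p : ℂ → ℂ} {s : Set ℂ} {z : ℂ} (hs : IsOpen s)
    (hz : Metric.closedBall z 2 ⊆ s) (hp : ContDiffOn ℝ 1 p s) {φ φ' : ℝ → ℂ}
    (hφ : ∀ θ, HasDerivAt φ (φ' θ) θ) (hφ' : Continuous φ') (hper : φ (2 * Real.pi) = φ 0)
    {r : ℝ} (hr : r ∈ Ioo (-2 : ℝ) 2) :
    r * ∫ θ in 0..2 * Real.pi, fderiv ℝ p (circleMap z r θ) (I * exp (θ * I)) * φ θ =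
      - ∫ θ in 0..2 * Real.pi, p (circleMap z r θ) * φ' θ := by
  have hmem : ∀ θ, circleMap z r θ ∈ s := fun θ =>
    hz (circleMap_mem_closedBall_of_abs_le (abs_le.2 ⟨hr.1.le, hr.2.le⟩) θ)
  have hd : ContinuousOn (fderiv ℝ p) s := hp.continuousOn_fderiv_of_isOpen hs le_rfl
  have hφc : Continuous φ := continuous_iff_continuousAt.2 fun θ => (hφ θ).continuousAt
  have c1 : Continuous fun θ => p (circleMap z r θ) * φ' θ :=
    (hp.continuousOn.comp_continuous (continuous_circleMap z r) hmem).mul hφ'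
  have c2 : Continuous fun θ : ℝ => fderiv ℝ p (circleMap z r θ) (I * exp (θ * I)) * φ θ :=
    Continuous.mul (Continuous.clm_apply
      (hd.comp_continuous (continuous_circleMap z r) hmem) (by fun_prop)) hφc
  have hderiv : ∀ θ : ℝ, HasDerivAt (fun θ => p (circleMap z r θ) * φ θ)
      (r * (fderiv ℝ p (circleMap z r θ) (I * exp (θ * I)) * φ θ) +
        p (circleMap z r θ) * φ' θ) θ := by
    intro θ
    have h := (((hp.differentiableOn one_ne_zero).differentiableAt
      (hs.mem_nhds (hmem θ))).hasFDerivAt.comp_hasDerivAt θ (hasDerivAt_circleMap z r θ)).mul (hφ θ)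
    refine h.congr_deriv ?_
    have : circleMap 0 r θ * I = r • (I * exp (θ * I)) := by
      simp [circleMap, mul_comm, mul_left_comm]
    rw [this, map_smul, real_smul]
    simp only [Function.comp]
    ring
  have key := intervalIntegral.integral_eq_sub_of_hasDerivAt (a := 0) (b := 2 * Real.pi)
    (fun θ _ => hderiv θ) (((continuous_const (y := (r : ℂ)).mul c2).add c1).intervalIntegrable _ _)
  rw [intervalIntegral.integral_add (Continuous.intervalIntegrable (by fun_prop) _ _)
    (c1.intervalIntegrable _ _), intervalIntegral.integral_const_mul, hper] at key
  have h2 : circleMap z r (2 * Real.pi) = circleMap z r 0 := by simp [circleMap]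
  rw [h2, sub_self] at key
  exact eq_neg_of_add_eq_zero_left key

/-- Twice the Wirtinger derivative `∂f`. -/
def dz (f : ℂ → ℂ) (w : ℂ) : ℂ := fderiv ℝ f w 1 - I * fderiv ℝ f w I

lemma clm_apply_eq (L : ℂ →L[ℝ] ℂ) (w : ℂ) : L w = w.re * L 1 + w.im * L I := by
  conv_lhs => rw [← re_add_im w]
  have e : (w.re : ℂ) + w.im * I = w.re • (1 : ℂ) + w.im • I := by simp
  rw [e, map_add, map_smul, map_smul]
  simp

/-- For `w = exp (θ I)` this is the polar form of the Wirtinger derivative: the radial derivative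
minus `I` times the tangential one carries the factor `w`. The next lemma is the conjugate version.
-/
lemma clm_apply_sub_mul_I (L : ℂ →L[ℝ] ℂ) (w : ℂ) :
    L w - I * L (I * w) = w * (L 1 - I * L I) := by
  rw [clm_apply_eq L w, clm_apply_eq L (I * w)]
  have : w = w.re + w.im * I := (re_add_im w).symm
  simp only [mul_re, mul_im, I_re, I_im, zero_mul, one_mul, zero_sub, zero_add, ofReal_neg]
  linear_combination (-(L 1) + I * L I) * this + (w.im * L I) * I_sq

lemma clm_apply_add_mul_I (L : ℂ →L[ℝ] ℂ) (w : ℂ) :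
    L w + I * L (I * w) = (starRingEnd ℂ) w * (L 1 + I * L I) := by
  rw [clm_apply_eq L w, clm_apply_eq L (I * w)]
  have : (starRingEnd ℂ) w = w.re - w.im * I := by
    apply Complex.ext <;> simp
  rw [this]
  simp only [mul_re, mul_im, I_re, I_im, zero_mul, one_mul, zero_sub, zero_add, ofReal_neg]
  linear_combination (w.im * L I) * I_sq

lemma contDiffOn_dz {f : ℂ → ℂ} {s : Set ℂ} (hs : IsOpen s) (hf : ContDiffOn ℝ 2 f s) :
    ContDiffOn ℝ 1 (dz f) s := by
  have := hf.fderiv_of_isOpen hs (m := 1) (by norm_num)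
  exact (this.clm_apply contDiffOn_const).sub
    (contDiffOn_const.mul (this.clm_apply contDiffOn_const))

lemma laplacian_eq_fderiv_fderiv (f : ℂ → ℂ) (z : ℂ) :
    Δ f z = fderiv ℝ (fderiv ℝ f) z 1 1 + fderiv ℝ (fderiv ℝ f) z I I := by
  rw [InnerProductSpace.laplacian_eq_iteratedFDeriv_complexPlane]
  simp [iteratedFDeriv_two_apply]

lemma fderiv_fderiv_symm {f : ℂ → ℂ} {z : ℂ} (hf : ContDiffAt ℝ 2 f z) (v w : ℂ) :
    fderiv ℝ (fderiv ℝ f) z v w = fderiv ℝ (fderiv ℝ f) z w v :=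
  (hf.isSymmSndFDerivAt (by simp)).eq v w

lemma differentiableAt_fderiv {f : ℂ → ℂ} {z : ℂ} (hf : ContDiffAt ℝ 2 f z) :
    DifferentiableAt ℝ (fderiv ℝ f) z :=
  (hf.fderiv_right (m := 1) (by norm_num)).differentiableAt one_ne_zero

lemma fderiv_fderiv_apply {f : ℂ → ℂ} {z : ℂ} (hf : ContDiffAt ℝ 2 f z) (v w : ℂ) :
    fderiv ℝ (fun z => fderiv ℝ f z w) z v = fderiv ℝ (fderiv ℝ f) z v w := by
  have := ((differentiableAt_fderiv hf).hasFDerivAt.clm_apply (hasFDerivAt_const w z)).fderiv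
  rw [this]; simp

lemma fderiv_dz {f : ℂ → ℂ} {z : ℂ} (hf : ContDiffAt ℝ 2 f z) :
    fderiv ℝ (dz f) z 1 + I * fderiv ℝ (dz f) z I = Δ f z := by
  have h : ∀ v, fderiv ℝ (dz f) z v =
      fderiv ℝ (fderiv ℝ f) z v 1 - I * fderiv ℝ (fderiv ℝ f) z v I := by
    intro v
    have d := differentiableAt_fderiv hf
    have h1 : DifferentiableAt ℝ (fun z => fderiv ℝ f z 1) z :=
      d.clm_apply (differentiableAt_const _)
    have h2 : DifferentiableAt ℝ (fun z => fderiv ℝ f z I) z :=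
      d.clm_apply (differentiableAt_const _)
    have e : dz f = fun z => fderiv ℝ f z 1 - I * fderiv ℝ f z I := rfl
    rw [e, fderiv_fun_sub h1 (h2.const_mul _), fderiv_const_mul h2]
    simp only [sub_apply, smul_apply, smul_eq_mul]
    rw [fderiv_fderiv_apply hf, fderiv_fderiv_apply hf]
  rw [h, h, laplacian_eq_fderiv_fderiv, fderiv_fderiv_symm hf I 1]
  linear_combination (-(fderiv ℝ (fderiv ℝ f) z I I)) * I_sq

/-- Let `a(r)` be the circle integral of `f exp (-θ I)` and `b(r)` that of `dz f`. Then `(r a)' = r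
b`, and `b'` is the circle integral of `Δ f exp (-θ I)`, so `b` stays close to `b 0 = 2 π dz f z`.
Integrating over `0 ≤ r ≤ 1` bounds `dz f z` by `a 1` and the Laplacian. -/
lemma norm_dz_le {f : ℂ → ℂ} {s : Set ℂ} {z : ℂ} (hs : IsOpen s) (hz : Metric.closedBall z 2 ⊆ s)
    (hf : ContDiffOn ℝ 2 f s) {M M' : ℝ} (hM : ∀ w ∈ Metric.closedBall z 1, ‖f w‖ ≤ M)
    (hM' : ∀ w ∈ Metric.closedBall z 1, ‖Δ f w‖ ≤ M') : ‖dz f z‖ ≤ 2 * M + 2 * M' := by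
  have hM'0 : 0 ≤ M' := (norm_nonneg _).trans (hM' z (by simp))
  set φ : ℝ → ℂ := fun θ => exp (-(θ * I)) with hφ
  have hφc : Continuous φ := by fun_prop
  have hφd : ∀ θ, HasDerivAt φ (-I * φ θ) θ := by
    intro θ
    have h1 : HasDerivAt (fun θ : ℝ => -((θ : ℂ) * I)) (-I) θ := by
      exact (((ofRealCLM.hasDerivAt (x := θ)).mul_const I).fun_neg).congr_deriv (by simp)
    simpa [hφ, mul_comm] using h1.cexp
  have hφper : φ (2 * Real.pi) = φ 0 := by
    simp [hφ, exp_neg, exp_two_pi_mul_I]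
  have hφe : ∀ θ : ℝ, exp (θ * I) * φ θ = 1 := fun θ => by simp [hφ, ← exp_add]
  have hφconj : ∀ θ : ℝ, (starRingEnd ℂ) (exp (θ * I)) = φ θ := fun θ => by
    simp [hφ, ← exp_conj]
  have hφn : ∀ θ : ℝ, ‖φ θ‖ = 1 := fun θ => by
    rw [← hφconj, RCLike.norm_conj, norm_exp_ofReal_mul_I]
  have hP := contDiffOn_dz hs hf
  have hf1 : ContDiffOn ℝ 1 f s := hf.of_le (by norm_num)
  have hmem : ∀ r ∈ Ioo (-2 : ℝ) 2, ∀ θ, circleMap z r θ ∈ s := fun r hr θ =>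
    hz (circleMap_mem_closedBall_of_abs_le (abs_le.2 ⟨hr.1.le, hr.2.le⟩) θ)
  set a : ℝ → ℂ := fun r => ∫ θ in 0..2 * Real.pi, f (circleMap z r θ) * φ θ with ha
  set b : ℝ → ℂ := fun r => ∫ θ in 0..2 * Real.pi, dz f (circleMap z r θ) * (1 : ℂ) with hb
  have cf : ∀ r ∈ Ioo (-2 : ℝ) 2, ∀ (p : ℂ → ℂ), ContDiffOn ℝ 1 p s → ∀ ψ χ : ℝ → ℂ,
      Continuous ψ → Continuous χ →
      Continuous fun θ : ℝ => fderiv ℝ p (circleMap z r θ) (ψ θ) * χ θ := by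
    intro r hr p hp ψ χ hψ hχ
    exact Continuous.mul (Continuous.clm_apply ((hp.continuousOn_fderiv_of_isOpen hs
      le_rfl).comp_continuous (continuous_circleMap z r) (hmem r hr)) hψ) hχ
  have hda : ∀ r ∈ Ioo (-2 : ℝ) 2, HasDerivAt (fun r : ℝ => r * a r) (r * b r) r := by
    intro r hr
    have h1 := (ofRealCLM.hasDerivAt (x := r)).mul (hasDerivAt_integral_circleMap hs hz hf1 hφc hr)
    refine h1.congr_deriv ?_
    have h2 := integral_fderiv_circleMap_tangent hs hz hf1 hφd (by fun_prop) hφper hr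
    have h3 : (∫ θ in 0..2 * Real.pi, f (circleMap z r θ) * (-I * φ θ)) = -I * a r := by
      rw [ha, ← intervalIntegral.integral_const_mul]; congr 1; funext θ; ring
    have h4 : b r = (∫ θ in 0..2 * Real.pi, fderiv ℝ f (circleMap z r θ) (exp (θ * I)) * φ θ) -
        I * ∫ θ in 0..2 * Real.pi, fderiv ℝ f (circleMap z r θ) (I * exp (θ * I)) * φ θ := by
      rw [← intervalIntegral.integral_const_mul, ← intervalIntegral.integral_sub]
      · rw [hb]
        dsimp only
        congr 1; funext θ
        have := clm_apply_sub_mul_I (fderiv ℝ f (circleMap z r θ)) (exp (θ * I))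
        simp only [dz]
        linear_combination (-φ θ) * this - (fderiv ℝ f (circleMap z r θ) 1 -
          I * fderiv ℝ f (circleMap z r θ) I) * hφe θ
      · exact (cf r hr f hf1 _ _ (by fun_prop) hφc).intervalIntegrable _ _
      · exact (continuous_const.mul (cf r hr f hf1 _ _ (by fun_prop) hφc)).intervalIntegrable _ _
    rw [h4]
    rw [h3] at h2
    simp only [ofRealCLM_apply, ofReal_one, one_mul]
    linear_combination I * h2 + (a r) * I_sq
  have hb0 : b 0 = 2 * Real.pi * dz f z := by simp [hb]
  have hdb : ∀ r ∈ Ioo (0 : ℝ) 2, HasDerivAt b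
      (∫ θ in 0..2 * Real.pi, Δ f (circleMap z r θ) * φ θ) r := by
    intro r hr
    have hr' : r ∈ Ioo (-2 : ℝ) 2 := ⟨by linarith [hr.1], hr.2⟩
    refine (hasDerivAt_integral_circleMap hs hz hP continuous_const hr').congr_deriv ?_
    have h2 := integral_fderiv_circleMap_tangent hs hz hP
      (fun θ => hasDerivAt_const θ (1 : ℂ)) continuous_const rfl hr'
    have h3 : (∫ θ in 0..2 * Real.pi,
        fderiv ℝ (dz f) (circleMap z r θ) (I * exp (θ * I)) * (1 : ℂ)) = 0 := by
      have h4 : (r : ℂ) ≠ 0 := by exact_mod_cast hr.1.ne'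
      have : (r : ℂ) * ∫ θ in 0..2 * Real.pi,
        fderiv ℝ (dz f) (circleMap z r θ) (I * exp (θ * I)) * (1 : ℂ) = 0 := by rw [h2]; simp
      exact (mul_eq_zero.1 this).resolve_left h4
    rw [← add_zero (∫ θ in 0..2 * Real.pi, fderiv ℝ (dz f) (circleMap z r θ) (exp (θ * I)) * 1),
      ← mul_zero I, ← h3, ← intervalIntegral.integral_const_mul, ← intervalIntegral.integral_add]
    · congr 1; funext θ
      have := clm_apply_add_mul_I (fderiv ℝ (dz f) (circleMap z r θ)) (exp (θ * I))
      rw [fderiv_dz (hf.contDiffAt (hs.mem_nhds (hmem r hr' θ))), hφconj] at this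
      linear_combination this
    · exact (cf r hr' _ hP _ _ (by fun_prop) continuous_const).intervalIntegrable _ _
    · exact (continuous_const.mul
        (cf r hr' _ hP _ _ (by fun_prop) continuous_const)).intervalIntegrable _ _
  have hbc : ContinuousOn b (Icc 0 1) := fun r hr =>
    (hasDerivAt_integral_circleMap hs hz hP continuous_const
      ⟨by linarith [hr.1], by linarith [hr.2]⟩).continuousAt.continuousWithinAt
  have hbnd : ∀ r ∈ Ioo (0 : ℝ) 1,
      ‖∫ θ in 0..2 * Real.pi, Δ f (circleMap z r θ) * φ θ‖ ≤ 2 * Real.pi * M' := by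
    intro r hr
    have := intervalIntegral.norm_integral_le_of_norm_le_const (a := 0) (b := 2 * Real.pi)
      (f := fun θ => Δ f (circleMap z r θ) * φ θ) (C := M') (fun θ _ => by
        rw [norm_mul, hφn, mul_one]
        exact hM' _ (circleMap_mem_closedBall_of_abs_le
          (abs_le.2 ⟨by linarith [hr.1], hr.2.le⟩) θ))
    rwa [sub_zero, abs_of_pos Real.two_pi_pos, mul_comm M'] at this
  -- The formula for `b'` was obtained by dividing by `r`. At `r = 0` the derivative is computed
  -- separately: it vanishes, being the integral of a linear function of `exp (θ I)` over a full
  -- period.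
  have hb1 : ∀ r ∈ Icc (0 : ℝ) 1, ‖b r - b 0‖ ≤ 2 * Real.pi * M' * (r - 0) := by
    refine norm_image_sub_le_of_norm_deriv_right_le_segment hbc (f' := fun r =>
      if r = 0 then derivWithin b (Ici 0) 0 else
      ∫ θ in 0..2 * Real.pi, Δ f (circleMap z r θ) * φ θ) ?_ ?_
    · intro r hr
      split_ifs with h
      · subst h
        exact (hasDerivAt_integral_circleMap hs hz hP continuous_const
          (r := 0) (by norm_num)).hasDerivWithinAt.differentiableWithinAt.hasDerivWithinAt
      · exact (hdb r ⟨lt_of_le_of_ne hr.1 (Ne.symm h), by linarith [hr.2]⟩).hasDerivWithinAt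
    · intro r hr
      split_ifs with h
      · have h0 := hasDerivAt_integral_circleMap hs hz hP (φ := fun _ => (1 : ℂ)) continuous_const
          (r := 0) (by norm_num)
        rw [h0.hasDerivWithinAt.derivWithin (uniqueDiffWithinAt_Ici 0)]
        have e : (∫ θ in 0..2 * Real.pi,
            fderiv ℝ (dz f) (circleMap z 0 θ) (exp (θ * I)) * (1 : ℂ)) = 0 := by
          have := intervalIntegral.integral_eq_sub_of_hasDerivAt (a := 0) (b := 2 * Real.pi)
            (f := fun θ : ℝ => fderiv ℝ (dz f) z (-I * exp (θ * I)))
            (f' := fun θ : ℝ => fderiv ℝ (dz f) (circleMap z 0 θ) (exp (θ * I)) * (1 : ℂ))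
            (fun θ _ => by
              have h1 : HasDerivAt (fun θ : ℝ => -I * exp (θ * I)) (exp (θ * I)) θ := by
                have := (((ofRealCLM.hasDerivAt (x := θ)).mul_const I).cexp).const_mul (-I)
                refine this.congr_deriv ?_
                simp only [ofRealCLM_apply, ofReal_one, one_mul]
                linear_combination (-exp (θ * I)) * I_sq
              refine ((fderiv ℝ (dz f) z).hasFDerivAt.comp_hasDerivAt θ h1).congr_deriv ?_
              simp)
            ((cf 0 (by norm_num) _ hP _ _ (by fun_prop) continuous_const).intervalIntegrable _ _)
          rw [this]; simp [exp_two_pi_mul_I]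
        rw [e, norm_zero]; positivity
      · exact hbnd r ⟨lt_of_le_of_ne hr.1 (Ne.symm h), hr.2⟩
  -- Subtracting `r² / 2 * b 0` from `r a` leaves the derivative `r (b r - b 0)`, which the
  -- preceding estimate controls.
  have hfin := norm_image_sub_le_of_norm_deriv_le_segment_01'
    (f := fun r : ℝ => r * a r - (r : ℂ) ^ 2 / 2 * b 0) (f' := fun r : ℝ => r * (b r - b 0))
    (C := 2 * Real.pi * M') ?_ ?_
  · have h1 : ‖a 1‖ ≤ 2 * Real.pi * M := by
      have := intervalIntegral.norm_integral_le_of_norm_le_const (a := 0) (b := 2 * Real.pi)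
        (f := fun θ => f (circleMap z 1 θ) * φ θ) (C := M) (fun θ _ => by
          rw [norm_mul, hφn, mul_one]
          exact hM _ (circleMap_mem_closedBall_of_abs_le (by simp) θ))
      rwa [sub_zero, abs_of_pos Real.two_pi_pos, mul_comm M] at this
    have e : (Real.pi : ℂ) * dz f z = a 1 - ((1 : ℝ) * a 1 - ((1 : ℝ) : ℂ) ^ 2 / 2 * b 0 -
        ((0 : ℝ) * a 0 - ((0 : ℝ) : ℂ) ^ 2 / 2 * b 0)) := by
      rw [hb0]; push_cast; ring
    have h2 : ‖(Real.pi : ℂ) * dz f z‖ ≤ 2 * Real.pi * M + 2 * Real.pi * M' := by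
      rw [e]; exact (norm_sub_le _ _).trans (add_le_add h1 hfin)
    rw [norm_mul, norm_real, Real.norm_of_nonneg Real.pi_pos.le] at h2
    nlinarith [Real.pi_pos]
  · intro r hr
    have h1 : HasDerivAt (fun r : ℝ => (r : ℂ) ^ 2 / 2 * b 0) (r * b 0) r := by
      have := (((ofRealCLM.hasDerivAt (x := r)).pow 2).div_const 2).mul_const (b 0)
      refine this.congr_deriv ?_
      simp
    refine ((hda r ⟨by linarith [hr.1], by linarith [hr.2]⟩).sub h1).hasDerivWithinAt.congr_deriv ?_
    ring
  · intro r hr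
    rw [norm_mul, norm_real, Real.norm_of_nonneg hr.1]
    have h1 := hb1 r ⟨hr.1, hr.2.le⟩
    have h2 : 0 ≤ 2 * Real.pi * M' := by positivity
    nlinarith [hr.1, hr.2, norm_nonneg (b r - b 0)]

/-- A bound for the gradient by bounds for the function and its Laplacian on a disc. -/
lemma norm_fderiv_le_of_laplacian {f : ℂ → ℂ} {s : Set ℂ} {z : ℂ} (hs : IsOpen s)
    (hz : Metric.closedBall z 2 ⊆ s) (hf : ContDiffOn ℝ 2 f s) {M M' : ℝ}
    (hM : ∀ w ∈ Metric.closedBall z 1, ‖f w‖ ≤ M)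
    (hM' : ∀ w ∈ Metric.closedBall z 1, ‖Δ f w‖ ≤ M') : ‖fderiv ℝ f z‖ ≤ 4 * M + 4 * M' := by
  have hb : Metric.closedBall z 1 ⊆ s :=
    (Metric.closedBall_subset_closedBall (by norm_num)).trans hz
  have hzs : z ∈ s := hb (by simp)
  have h1 := norm_dz_le hs hz hf hM hM'
  -- The conjugate function supplies the other Wirtinger derivative; the two together determine the
  -- gradient.
  have hf' : ContDiffOn ℝ 2 (conjCLE.toContinuousLinearMap ∘ f) s :=
    conjCLE.toContinuousLinearMap.contDiff.comp_contDiffOn hf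
  have h2 := norm_dz_le (M := M) (M' := M') hs hz hf'
    (fun w hw => by simpa using hM w hw) (fun w hw => by
      rw [ContDiffAt.laplacian_CLM_comp_left (hf.contDiffAt (hs.mem_nhds (hb hw)))]
      simpa using hM' w hw)
  have hd : DifferentiableAt ℝ f z := (hf.contDiffAt (hs.mem_nhds hzs)).differentiableAt two_ne_zero
  have e : dz (conjCLE.toContinuousLinearMap ∘ f) z =
      (starRingEnd ℂ) (fderiv ℝ f z 1 + I * fderiv ℝ f z I) := by
    rw [dz, fderiv_comp z conjCLE.toContinuousLinearMap.differentiableAt hd,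
      ContinuousLinearMap.fderiv]
    simp [sub_eq_add_neg]
  rw [e, RCLike.norm_conj] at h2
  set A := fderiv ℝ f z 1
  set B := fderiv ℝ f z I
  have h1' : ‖A - I * B‖ ≤ 2 * M + 2 * M' := h1
  have hA : ‖A‖ ≤ 2 * M + 2 * M' := by
    have : A = (1 / 2 : ℂ) * ((A - I * B) + (A + I * B)) := by ring
    rw [this, norm_mul]
    have := norm_add_le (A - I * B) (A + I * B)
    have : ‖(1 / 2 : ℂ)‖ = 1 / 2 := by simp
    rw [this]
    linarith
  have hB : ‖B‖ ≤ 2 * M + 2 * M' := by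
    have : B = (I / 2 : ℂ) * ((A - I * B) - (A + I * B)) := by linear_combination B * I_sq
    rw [this, norm_mul]
    have := norm_sub_le (A - I * B) (A + I * B)
    have : ‖(I / 2 : ℂ)‖ = 1 / 2 := by simp
    rw [this]
    linarith
  refine ContinuousLinearMap.opNorm_le_bound _ (by linarith [norm_nonneg A]) fun w => ?_
  rw [clm_apply_eq]
  refine (norm_add_le _ _).trans ?_
  rw [norm_mul, norm_mul, norm_real, norm_real]
  have := abs_re_le_norm w
  have := abs_im_le_norm w
  have : ‖w.re‖ * ‖A‖ ≤ ‖w‖ * (2 * M + 2 * M') :=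
    mul_le_mul (abs_re_le_norm w) hA (norm_nonneg _) (norm_nonneg _)
  have : ‖w.im‖ * ‖B‖ ≤ ‖w‖ * (2 * M + 2 * M') :=
    mul_le_mul (abs_im_le_norm w) hB (norm_nonneg _) (norm_nonneg _)
  linarith

/-! ### Closed forms and conformal maps -/

/-- The upper half plane as a set of complex numbers. -/
abbrev Hs : Set ℂ := {z | 0 < z.im}

lemma isOpen_Hs : IsOpen Hs := isOpen_lt continuous_const continuous_im

lemma convex_Hs : Convex ℝ Hs := convex_halfSpace_im_gt 0

/-- Multiplication by `I`. -/
def mulI : ℂ →L[ℝ] ℂ := ContinuousLinearMap.mul ℝ ℂ I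

@[simp] lemma mulI_apply (z : ℂ) : mulI z = I * z := rfl

/-- The form `v ⋆du - u ⋆dv`. -/
def form (u v : ℂ → ℂ) (z : ℂ) : ℂ →L[ℝ] ℂ :=
  v z • (fderiv ℝ u z).comp mulI - u z • (fderiv ℝ v z).comp mulI

lemma form_apply (u v : ℂ → ℂ) (z w : ℂ) :
    form u v z w = v z * fderiv ℝ u z (I * w) - u z * fderiv ℝ v z (I * w) := by
  simp [form]

lemma eta_eq_form {u v : ℂ → ℂ} {z : ℂ} (hu : DifferentiableAt ℝ u z) (hv : DifferentiableAt ℝ v z)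
    (w : ℂ) : eta u v z w = form u v z w := by
  rw [form_apply, eta, hu.lineDeriv_eq_fderiv, hu.lineDeriv_eq_fderiv, hv.lineDeriv_eq_fderiv,
    hv.lineDeriv_eq_fderiv, clm_apply_eq _ (I * w), clm_apply_eq (fderiv ℝ v z) (I * w)]
  simp only [mul_re, mul_im, I_re, I_im, zero_mul, one_mul, zero_sub, zero_add, ofReal_neg]
  ring

lemma form_congr {u v u' v' : ℂ → ℂ} {z : ℂ} (hu : u =ᶠ[𝓝 z] u') (hv : v =ᶠ[𝓝 z] v') :
    form u v z = form u' v' z := by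
  rw [form, form, hu.fderiv_eq, hv.fderiv_eq, hu.eq_of_nhds, hv.eq_of_nhds]

lemma fderiv_comp_hasDerivAt {u g : ℂ → ℂ} {g' z : ℂ} (hu : DifferentiableAt ℝ u (g z))
    (hg : HasDerivAt g g' z) (w : ℂ) : fderiv ℝ (u ∘ g) z w = fderiv ℝ u (g z) (g' * w) := by
  have h1 := hg.hasFDerivAt.restrictScalars ℝ
  rw [(hu.hasFDerivAt.comp z h1).fderiv]
  simp [mul_comm]

lemma form_comp {u v g : ℂ → ℂ} {g' z : ℂ} (hu : DifferentiableAt ℝ u (g z))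
    (hv : DifferentiableAt ℝ v (g z)) (hg : HasDerivAt g g' z) (w : ℂ) :
    form (u ∘ g) (v ∘ g) z w = form u v (g z) (g' * w) := by
  rw [form_apply, form_apply, fderiv_comp_hasDerivAt hu hg, fderiv_comp_hasDerivAt hv hg]
  simp [mul_left_comm]

lemma form_const_mul {u v : ℂ → ℂ} {z : ℂ} (hv : DifferentiableAt ℝ v z) (c w : ℂ) :
    form u (fun z => c * v z) z w = c * form u v z w := by
  rw [form_apply, form_apply, fderiv_const_mul hv]
  simp
  ring

lemma norm_form_le (u v : ℂ → ℂ) (z w : ℂ) :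
    ‖form u v z w‖ ≤ (‖v z‖ * ‖fderiv ℝ u z‖ + ‖u z‖ * ‖fderiv ℝ v z‖) * ‖w‖ := by
  rw [form_apply]
  have h (L : ℂ →L[ℝ] ℂ) : ‖L (I * w)‖ ≤ ‖L‖ * ‖w‖ := by
    simpa using L.le_opNorm (I * w)
  refine (norm_sub_le _ _).trans ?_
  rw [norm_mul, norm_mul, add_mul, mul_assoc, mul_assoc]
  gcongr <;> exact h _

lemma bilin_symm_of_one_I {B : ℂ →L[ℝ] ℂ →L[ℝ] ℂ} (h : B 1 I = B I 1) (v w : ℂ) :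
    B v w = B w v := by
  have e (v w : ℂ) : B v w = v.re * (w.re * B 1 1 + w.im * B 1 I) +
      v.im * (w.re * B I 1 + w.im * B I I) := by
    rw [clm_apply_eq (B v) w]
    have h1 := clm_apply_eq (B.flip 1) v
    have h2 := clm_apply_eq (B.flip I) v
    simp only [ContinuousLinearMap.flip_apply] at h1 h2
    rw [h1, h2]; ring
  rw [e v w, e w v, h]; ring

/-- Multiplication by `a` is `‖a‖` times a rotation, and rotations preserve the trace of a bilinear
form. -/
lemma bilin_diag_add (B : ℂ →L[ℝ] ℂ →L[ℝ] ℂ) (a : ℂ) :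
    B a a + B (a * I) (a * I) = (‖a‖ : ℂ) ^ 2 * (B 1 1 + B I I) := by
  have e (v w : ℂ) : B v w = v.re * (w.re * B 1 1 + w.im * B 1 I) +
      v.im * (w.re * B I 1 + w.im * B I I) := by
    rw [clm_apply_eq (B v) w]
    have h1 := clm_apply_eq (B.flip 1) v
    have h2 := clm_apply_eq (B.flip I) v
    simp only [ContinuousLinearMap.flip_apply] at h1 h2
    rw [h1, h2]; ring
  have hn : (‖a‖ : ℂ) ^ 2 = (a.re : ℂ) ^ 2 + (a.im : ℂ) ^ 2 := by
    rw [← ofReal_pow, Complex.sq_norm, normSq_apply]; push_cast; ring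
  rw [e a a, e (a * I) (a * I), hn]
  simp
  ring

/-- If `v Δu = u Δv` then the form `v ⋆du - u ⋆dv` has a primitive on the upper half plane. -/
lemma exists_primitive {u v : ℂ → ℂ} (hu : ContDiffOn ℝ 2 u Hs) (hv : ContDiffOn ℝ 2 v Hs)
    (h : ∀ z ∈ Hs, v z * Δ u z = u z * Δ v z) :
    ∃ F : ℂ → ℂ, ∀ z ∈ Hs, HasFDerivAt F (form u v z) z := by
  have hd : ∀ z ∈ Hs, ∀ w, HasFDerivAt (fun z => form u v z w)
      (v z • (fderiv ℝ (fderiv ℝ u) z).flip (I * w) + (fderiv ℝ u z (I * w)) • fderiv ℝ v z -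
        (u z • (fderiv ℝ (fderiv ℝ v) z).flip (I * w) + (fderiv ℝ v z (I * w)) • fderiv ℝ u z))
      z := by
    intro z hz w
    have cu := hu.contDiffAt (isOpen_Hs.mem_nhds hz)
    have cv := hv.contDiffAt (isOpen_Hs.mem_nhds hz)
    have du := (cu.differentiableAt two_ne_zero).hasFDerivAt
    have dv := (cv.differentiableAt two_ne_zero).hasFDerivAt
    have ddu := ((differentiableAt_fderiv cu).hasFDerivAt).clm_apply (hasFDerivAt_const (I * w) z)
    have ddv := ((differentiableAt_fderiv cv).hasFDerivAt).clm_apply (hasFDerivAt_const (I * w) z)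
    have := (dv.mul ddu).sub (du.mul ddv)
    simp only [form_apply]
    refine this.congr_fderiv ?_
    ext x; simp
  have hdiff : DifferentiableOn ℝ (form u v) Hs := by
    intro z hz
    have cu := hu.contDiffAt (isOpen_Hs.mem_nhds hz)
    have cv := hv.contDiffAt (isOpen_Hs.mem_nhds hz)
    have h1 : DifferentiableAt ℝ (fun z => (fderiv ℝ u z).comp mulI) z :=
      (differentiableAt_fderiv cu).clm_comp (differentiableAt_const _)
    have h2 : DifferentiableAt ℝ (fun z => (fderiv ℝ v z).comp mulI) z :=
      (differentiableAt_fderiv cv).clm_comp (differentiableAt_const _)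
    exact (((cv.differentiableAt two_ne_zero).smul h1).sub
      ((cu.differentiableAt two_ne_zero).smul h2)).differentiableWithinAt
  -- Poincaré lemma on a convex set. Symmetry need only be tested on the pair `1, I`; there the
  -- products of first derivatives cancel and `v Δu - u Δv` remains.
  refine convex_Hs.exists_forall_hasFDerivAt_of_fderiv_symmetric isOpen_Hs hdiff fun z hz => ?_
  refine bilin_symm_of_one_I ?_
  have e : ∀ x w, fderiv ℝ (form u v) z x w =
      v z * fderiv ℝ (fderiv ℝ u) z x (I * w) + fderiv ℝ u z (I * w) * fderiv ℝ v z x -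
        (u z * fderiv ℝ (fderiv ℝ v) z x (I * w) + fderiv ℝ v z (I * w) * fderiv ℝ u z x) := by
    intro x w
    have h1 := (((hdiff z hz).differentiableAt (isOpen_Hs.mem_nhds hz)).hasFDerivAt.clm_apply
      (hasFDerivAt_const w z)).unique (hd z hz w)
    have := DFunLike.congr_fun h1 x
    simpa using this
  have hz' := h z hz
  rw [laplacian_eq_fderiv_fderiv, laplacian_eq_fderiv_fderiv] at hz'
  rw [e, e]
  have hI : I * I = ((-1 : ℝ) • (1 : ℂ)) := by simp
  rw [hI, mul_one]
  simp only [map_smul]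
  simp only [real_smul, ofReal_neg, ofReal_one]
  linear_combination -hz'

/-! ### Conformal covariance of the Laplacian -/

lemma laplacian_comp_of_analyticAt {f g : ℂ → ℂ} {z : ℂ} (hf : ContDiffAt ℝ 2 f (g z))
    (hg : AnalyticAt ℂ g z) : Δ (f ∘ g) z = (‖deriv g z‖ : ℂ) ^ 2 * Δ f (g z) := by
  have hgR : ContDiffAt ℝ 2 g z := hg.contDiffAt.restrict_scalars ℝ
  have hfg : ContDiffAt ℝ 2 (f ∘ g) z := hf.comp z hgR
  have hg1 : HasDerivAt g (deriv g z) z := hg.differentiableAt.hasDerivAt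
  have hg2 : HasDerivAt (deriv g) (deriv (deriv g) z) z := hg.deriv.differentiableAt.hasDerivAt
  have key : ∀ e : ℂ, fderiv ℝ (fderiv ℝ (f ∘ g)) z e e =
      fderiv ℝ (fderiv ℝ f) (g z) (deriv g z * e) (deriv g z * e) +
        fderiv ℝ f (g z) (deriv (deriv g) z * e * e) := by
    intro e
    rw [← fderiv_fderiv_apply hfg]
    have hev : (fun w => fderiv ℝ (f ∘ g) w e) =ᶠ[𝓝 z]
        fun w => fderiv ℝ f (g w) (deriv g w * e) := by
      have h1 := hg.continuousAt.eventually (hf.eventually (by simp))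
      filter_upwards [h1, hg.eventually_analyticAt] with w hw hw'
      exact fderiv_comp_hasDerivAt (hw.differentiableAt two_ne_zero)
        hw'.differentiableAt.hasDerivAt e
    rw [hev.fderiv_eq]
    have h1 := (differentiableAt_fderiv hf).hasFDerivAt.comp z (hg1.hasFDerivAt.restrictScalars ℝ)
    have h2 := ((hg2.mul_const e).hasFDerivAt).restrictScalars ℝ
    have h3 := (h1.clm_apply h2).fderiv
    simp only [Function.comp_def] at h3
    rw [h3]
    simp [mul_comm]
    abel
  rw [laplacian_eq_fderiv_fderiv, laplacian_eq_fderiv_fderiv, key, key, ← bilin_diag_add]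
  -- The terms with `g''` in the directions `1` and `I` are opposite because `I² = -1`, so only the
  -- factor `‖g'‖²` survives.
  have hI : deriv (deriv g) z * I * I = -(deriv (deriv g) z) := by
    linear_combination deriv (deriv g) z * I_sq
  rw [hI, map_neg]
  simp only [mul_one]
  ring

/-! ### Möbius transformations -/

/-- The Möbius transformation of an integer matrix. -/
def mob (g : Matrix (Fin 2) (Fin 2) ℤ) (z : ℂ) : ℂ :=
  ((g 0 0 : ℂ) * z + (g 0 1 : ℂ)) / ((g 1 0 : ℂ) * z + (g 1 1 : ℂ))

lemma den_ne_zero {g : Matrix (Fin 2) (Fin 2) ℤ} (hg : 0 < g.det) {z : ℂ} (hz : 0 < z.im) :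
    (g 1 0 : ℂ) * z + (g 1 1 : ℂ) ≠ 0 := by
  intro h
  have h1 : (g 1 0 : ℝ) * z.im = 0 := by simpa using congrArg Complex.im h
  have h2 : (g 1 0 : ℝ) = 0 := (mul_eq_zero.1 h1).resolve_right hz.ne'
  have h3 : (g 1 1 : ℝ) = 0 := by simpa [h2] using congrArg Complex.re h
  have h4 : g 1 0 = 0 := by exact_mod_cast h2
  have h5 : g 1 1 = 0 := by exact_mod_cast h3
  rw [Matrix.det_fin_two, h4, h5] at hg
  simp at hg

lemma mob_im {g : Matrix (Fin 2) (Fin 2) ℤ} {z : ℂ}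
    (h : (g 1 0 : ℂ) * z + (g 1 1 : ℂ) ≠ 0) :
    (mob g z).im = (g.det : ℝ) * z.im / normSq ((g 1 0 : ℂ) * z + (g 1 1 : ℂ)) := by
  have h' := (normSq_pos.2 h).ne'
  rw [mob, div_im, Matrix.det_fin_two]
  field_simp
  simp [normSq_apply]
  ring

lemma mob_mem_Hs {g : Matrix (Fin 2) (Fin 2) ℤ} (hg : 0 < g.det) {z : ℂ} (hz : 0 < z.im) :
    0 < (mob g z).im := by
  have h := den_ne_zero hg hz
  rw [mob_im h]
  have := normSq_pos.2 h
  have : (0 : ℝ) < g.det := by exact_mod_cast hg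
  positivity

lemma mob_mob {g h : Matrix (Fin 2) (Fin 2) ℤ} {z : ℂ}
    (hh : (h 1 0 : ℂ) * z + (h 1 1 : ℂ) ≠ 0) : mob g (mob h z) = mob (g * h) z := by
  simp only [mob, Matrix.mul_apply, Fin.sum_univ_two]
  push_cast
  rw [← mul_div_assoc, ← mul_div_assoc, div_add' _ _ _ hh, div_add' _ _ _ hh,
    div_div_div_cancel_right₀ hh]
  congr 1 <;> ring

lemma mob_mob_of_pos {g h : Matrix (Fin 2) (Fin 2) ℤ} (hh : 0 < h.det) {z : ℂ} (hz : 0 < z.im) :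
    mob g (mob h z) = mob (g * h) z := mob_mob (den_ne_zero hh hz)

@[simp] lemma mob_one (z : ℂ) : mob 1 z = z := by simp [mob]

lemma hasDerivAt_mob {g : Matrix (Fin 2) (Fin 2) ℤ} {z : ℂ}
    (h : (g 1 0 : ℂ) * z + (g 1 1 : ℂ) ≠ 0) :
    HasDerivAt (mob g) ((g.det : ℂ) / ((g 1 0 : ℂ) * z + (g 1 1 : ℂ)) ^ 2) z := by
  have h1 : HasDerivAt (fun z : ℂ => (g 0 0 : ℂ) * z + g 0 1) (g 0 0) z := by
    simpa using ((hasDerivAt_id z).const_mul (g 0 0 : ℂ)).add_const (g 0 1 : ℂ)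
  have h2 : HasDerivAt (fun z : ℂ => (g 1 0 : ℂ) * z + g 1 1) (g 1 0) z := by
    simpa using ((hasDerivAt_id z).const_mul (g 1 0 : ℂ)).add_const (g 1 1 : ℂ)
  refine (h1.div h2 h).congr_deriv ?_
  rw [Matrix.det_fin_two]
  push_cast
  congr 1
  ring

lemma analyticAt_mob {g : Matrix (Fin 2) (Fin 2) ℤ} {z : ℂ}
    (h : (g 1 0 : ℂ) * z + (g 1 1 : ℂ) ≠ 0) : AnalyticAt ℂ (mob g) z := by
  unfold mob
  exact ((analyticAt_const.mul analyticAt_id).add analyticAt_const).div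
    ((analyticAt_const.mul analyticAt_id).add analyticAt_const) h

/-! ### The powers of the Poisson kernel -/

/-- The logarithmic derivative of the Poisson kernel in the variable `z`. -/
def poissonLogDeriv (ζ z : ℂ) : ℂ →L[ℝ] ℂ :=
  (1 / (z.im : ℂ)) • ofRealCLM.comp imCLM + (1 / (ζ - z)) • ContinuousLinearMap.id ℝ ℂ +
    (1 / (ζ - (starRingEnd ℂ) z)) • conjCLE.toContinuousLinearMap

lemma poissonLogDeriv_apply (ζ z w : ℂ) : poissonLogDeriv ζ z w =
    (w.im : ℂ) / z.im + w / (ζ - z) + (starRingEnd ℂ) w / (ζ - (starRingEnd ℂ) z) := by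
  simp [poissonLogDeriv, div_eq_mul_inv, mul_comm]

/-- The points at which the kernel `poissonPow β ζ` is smooth. -/
def PoissonAdm (ζ z : ℂ) : Prop :=
  0 < z.im ∧ ζ - z ∈ slitPlane ∧ ζ - (starRingEnd ℂ) z ∈ slitPlane

lemma isOpen_poissonAdm (ζ : ℂ) : IsOpen {z | PoissonAdm ζ z} := by
  refine IsOpen.inter (isOpen_lt continuous_const continuous_im) (IsOpen.inter ?_ ?_)
  · exact isOpen_slitPlane.preimage (by fun_prop)
  · exact isOpen_slitPlane.preimage (continuous_const.sub continuous_conj)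

lemma poissonAdm_ofReal (x : ℝ) {z : ℂ} (hz : 0 < z.im) : PoissonAdm x z := by
  refine ⟨hz, ?_, ?_⟩ <;> rw [mem_slitPlane_iff] <;> right <;> simp [hz.ne']

lemma hasFDerivAt_cpow_const {z : ℂ} (hz : z ∈ slitPlane) (c : ℂ) :
    HasFDerivAt (fun z : ℂ => z ^ c) ((z ^ c * (c / z)) • ContinuousLinearMap.id ℝ ℂ) z := by
  have h := (((hasStrictDerivAt_cpow_const (c := c) hz).hasDerivAt).hasFDerivAt).restrictScalars ℝ
  refine h.congr_fderiv ?_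
  ext
  simp [cpow_sub _ _ (slitPlane_ne_zero hz)]
  ring

lemma hasFDerivAt_poissonPow {β ζ z : ℂ} (h : PoissonAdm ζ z) :
    HasFDerivAt (poissonPow β ζ) ((poissonPow β ζ z * β) • poissonLogDeriv ζ z) z := by
  obtain ⟨h0, h1, h2⟩ := h
  have hy : (z.im : ℂ) ∈ slitPlane := by simp [mem_slitPlane_iff, h0]
  have d0 := (hasFDerivAt_cpow_const hy β).comp z (ofRealCLM.comp imCLM).hasFDerivAt
  have d1 := (hasFDerivAt_cpow_const h1 (-β)).comp z
    ((hasFDerivAt_id (𝕜 := ℝ) z).const_sub ζ)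
  have d2 := (hasFDerivAt_cpow_const h2 (-β)).comp z
    ((conjCLE.toContinuousLinearMap.hasFDerivAt (x := z)).const_sub ζ)
  refine ((d0.mul d1).mul d2).congr_fderiv ?_
  ext w
  simp [poissonLogDeriv_apply, poissonPow]
  ring

lemma analyticAt_poissonPow {β ζ z : ℂ} (h : PoissonAdm ζ z) :
    AnalyticAt ℝ (poissonPow β ζ) z := by
  obtain ⟨h0, h1, h2⟩ := h
  have hy : (z.im : ℂ) ∈ slitPlane := by simp [mem_slitPlane_iff, h0]
  have hp : ∀ w ∈ slitPlane, ∀ c : ℂ, AnalyticAt ℝ (fun w : ℂ => w ^ c) w := fun w hw c =>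
    (analyticAt_id.cpow analyticAt_const hw).restrictScalars
  have a0 : AnalyticAt ℝ (fun z : ℂ => (z.im : ℂ) ^ β) z :=
    AnalyticAt.comp (g := fun w : ℂ => w ^ β) (hp _ hy β)
      ((ofRealCLM.comp imCLM).analyticAt z)
  have a1 : AnalyticAt ℝ (fun z : ℂ => (ζ - z) ^ (-β)) z :=
    AnalyticAt.comp (g := fun w : ℂ => w ^ (-β)) (hp _ h1 (-β))
      (analyticAt_const.sub analyticAt_id)
  have a2 : AnalyticAt ℝ (fun z : ℂ => (ζ - (starRingEnd ℂ) z) ^ (-β)) z :=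
    AnalyticAt.comp (g := fun w : ℂ => w ^ (-β)) (hp _ h2 (-β))
      (analyticAt_const.sub (conjCLE.toContinuousLinearMap.analyticAt z))
  exact (a0.mul a1).mul a2

/-- Differentiating `P' = β P L`, with `L` the logarithmic derivative, gives second derivatives `P
(β² L² + β L')`. Summed over `1` and `I` they reduce to a rational identity in `1 / y`, `1 / (ζ -
z)` and `1 / (ζ - z̄)`. -/
lemma laplacian_poissonPow {β ζ z : ℂ} (h : PoissonAdm ζ z) :
    Δ (poissonPow β ζ) z = -(β * (1 - β)) / (z.im : ℂ) ^ 2 * poissonPow β ζ z := by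
  have hc : ContDiffAt ℝ 2 (poissonPow β ζ) z := (analyticAt_poissonPow h).contDiffAt
  have hy : (z.im : ℂ) ≠ 0 := by exact_mod_cast h.1.ne'
  have n1 : ζ - z ≠ 0 := slitPlane_ne_zero h.2.1
  have n2 : ζ - (starRingEnd ℂ) z ≠ 0 := slitPlane_ne_zero h.2.2
  have key : ∀ w, fderiv ℝ (fderiv ℝ (poissonPow β ζ)) z w w = poissonPow β ζ z *
      (β ^ 2 * (poissonLogDeriv ζ z w) ^ 2 + β * (-(w.im : ℂ) ^ 2 / (z.im : ℂ) ^ 2 +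
        w ^ 2 / (ζ - z) ^ 2 + ((starRingEnd ℂ) w) ^ 2 / (ζ - (starRingEnd ℂ) z) ^ 2)) := by
    intro w
    rw [← fderiv_fderiv_apply hc]
    have hev : (fun v => fderiv ℝ (poissonPow β ζ) v w) =ᶠ[𝓝 z] fun v => poissonPow β ζ v *
        (β * ((w.im : ℂ) * (v.im : ℂ)⁻¹ + w * (ζ - v)⁻¹ +
          (starRingEnd ℂ) w * (ζ - (starRingEnd ℂ) v)⁻¹)) := by
      filter_upwards [(isOpen_poissonAdm ζ).mem_nhds h] with v hv
      rw [(hasFDerivAt_poissonPow hv).fderiv]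
      simp only [smul_apply, poissonLogDeriv_apply, smul_eq_mul, div_eq_mul_inv]
      ring
    rw [hev.fderiv_eq]
    have hinv : ∀ x : ℂ, x ≠ 0 → HasFDerivAt (fun x : ℂ => x⁻¹)
        ((-(x ^ 2)⁻¹) • ContinuousLinearMap.id ℝ ℂ) x := by
      intro x hx
      refine ((hasDerivAt_inv hx).hasFDerivAt.restrictScalars ℝ).congr_fderiv ?_
      ext
      simp [mul_comm]
    have d0 := (hinv _ hy).comp z (ofRealCLM.comp imCLM).hasFDerivAt
    have d1 := (hinv _ n1).comp z ((hasFDerivAt_id (𝕜 := ℝ) z).const_sub ζ)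
    have d2 := (hinv _ n2).comp z ((conjCLE.toContinuousLinearMap.hasFDerivAt (x := z)).const_sub ζ)
    have d3 := (hasFDerivAt_poissonPow (β := β) h).mul ((((d0.const_mul (w.im : ℂ)).add
      (d1.const_mul w)).add (d2.const_mul ((starRingEnd ℂ) w))).const_mul β)
    refine (DFunLike.congr_fun (HasFDerivAt.fderiv d3) w).trans ?_
    simp [poissonLogDeriv_apply]
    field_simp
    ring
  rw [laplacian_eq_fderiv_fderiv, key, key, poissonLogDeriv_apply, poissonLogDeriv_apply]
  have hzz : (starRingEnd ℂ) z = z - 2 * z.im * I := by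
    apply Complex.ext <;> simp; ring
  -- The only relation between the two reciprocals: their difference is `2 i y` times their product.
  have hAB : (ζ - z)⁻¹ - (ζ - (starRingEnd ℂ) z)⁻¹ =
      2 * I * z.im * (ζ - z)⁻¹ * (ζ - (starRingEnd ℂ) z)⁻¹ := by
    have : 2 * I * z.im = (ζ - (starRingEnd ℂ) z) - (ζ - z) := by rw [hzz]; ring
    rw [this, sub_mul, sub_mul, mul_inv_cancel₀ n1, mul_right_comm, mul_inv_cancel₀ n2]
    ring
  have hY : (z.im : ℂ) * (z.im : ℂ)⁻¹ = 1 := mul_inv_cancel₀ hy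
  simp only [one_im, I_im, map_one, conj_I, ofReal_one, ofReal_zero, div_eq_mul_inv, ← inv_pow]
  generalize (ζ - z)⁻¹ = A at *
  generalize (ζ - (starRingEnd ℂ) z)⁻¹ = B at *
  generalize (z.im : ℂ)⁻¹ = Y at *
  generalize poissonPow β ζ z = P
  linear_combination P * β ^ 2 * (2 * I * Y * hAB - 4 * A * B * hY +
    (4 * A * B * Y * z.im + (A - B) ^ 2) * I_sq) + P * β * (A ^ 2 + B ^ 2) * I_sq

lemma norm_poissonLogDeriv_le {ζ z : ℂ} {d : ℝ} (hd : 0 < d) (h0 : d ≤ z.im) (h1 : d ≤ ‖ζ - z‖)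
    (h2 : d ≤ ‖ζ - (starRingEnd ℂ) z‖) (w : ℂ) : ‖poissonLogDeriv ζ z w‖ ≤ 3 / d * ‖w‖ := by
  rw [poissonLogDeriv_apply]
  have e0 : ‖(w.im : ℂ) / z.im‖ ≤ ‖w‖ / d := by
    rw [norm_div, norm_real, norm_real, Real.norm_of_nonneg (hd.trans_le h0).le]
    exact div_le_div₀ (norm_nonneg _) (abs_im_le_norm w) hd h0
  have e1 : ‖w / (ζ - z)‖ ≤ ‖w‖ / d := by
    rw [norm_div]; exact div_le_div₀ (norm_nonneg _) le_rfl hd h1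
  have e2 : ‖(starRingEnd ℂ) w / (ζ - (starRingEnd ℂ) z)‖ ≤ ‖w‖ / d := by
    rw [norm_div, RCLike.norm_conj]; exact div_le_div₀ (norm_nonneg _) le_rfl hd h2
  calc _ ≤ ‖w‖ / d + ‖w‖ / d + ‖w‖ / d :=
        (norm_add_le _ _).trans (add_le_add ((norm_add_le _ _).trans (add_le_add e0 e1)) e2)
    _ = 3 / d * ‖w‖ := by ring

/-- For real `x` the bases `x - z` and `x - z̄` are conjugate, so the imaginary parts of their
principal logarithms cancel and no branch problem arises. -/
lemma poissonPow_ofReal (β : ℂ) (x : ℝ) {z : ℂ} (hz : 0 < z.im) :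
    poissonPow β x z = ((z.im / normSq (x - z) : ℝ) : ℂ) ^ β := by
  have hadm := poissonAdm_ofReal x hz
  set w : ℂ := x - z with hw
  have hw0 : w ≠ 0 := slitPlane_ne_zero hadm.2.1
  have hcw : (x : ℂ) - (starRingEnd ℂ) z = (starRingEnd ℂ) w := by simp [hw]
  have hN : 0 < normSq w := normSq_pos.2 hw0
  have harg : w.arg ≠ Real.pi := (mem_slitPlane_iff_arg.1 hadm.2.1).1
  have hlog : log w + (starRingEnd ℂ) (log w) = ((Real.log (normSq w) : ℝ) : ℂ) := by
    rw [add_conj, log_re, normSq_eq_norm_sq, Real.log_pow]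
    push_cast; ring
  have hprod : w ^ (-β) * ((starRingEnd ℂ) w) ^ (-β) = ((normSq w : ℝ) : ℂ) ^ (-β) := by
    rw [cpow_def_of_ne_zero hw0, cpow_def_of_ne_zero ((map_ne_zero _).2 hw0),
      cpow_def_of_ne_zero (by exact_mod_cast hN.ne'), log_conj _ harg, ← exp_add, ← add_mul, hlog,
      ofReal_log hN.le]
  rw [poissonPow, hcw, mul_assoc, hprod, ofReal_div, div_cpow_ofReal_nonneg hz.le hN.le, cpow_neg]
  rfl

lemma norm_poissonPow_ofReal (β : ℂ) (x : ℝ) {z : ℂ} (hz : 0 < z.im) :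
    ‖poissonPow β x z‖ = (z.im / normSq (x - z)) ^ β.re := by
  have hN : 0 < normSq (x - z) := normSq_pos.2 (slitPlane_ne_zero (poissonAdm_ofReal x hz).2.1)
  rw [poissonPow_ofReal β x hz, norm_cpow_eq_rpow_re_of_pos (by positivity)]

/-- The transformation behaviour of the Poisson kernel. -/
lemma poissonPow_mob (β : ℂ) {g : Matrix (Fin 2) (Fin 2) ℤ} (hg : 0 < g.det) (x : ℝ)
    (hx : (g 0 0 : ℝ) - g 1 0 * x ≠ 0) {z : ℂ} (hz : 0 < z.im) :
    poissonPow β x (mob g z) = (((g.det : ℝ) / ((g 0 0 : ℝ) - g 1 0 * x) ^ 2 : ℝ) : ℂ) ^ β *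
      poissonPow β (((g 1 1 : ℝ) * x - g 0 1) / ((g 0 0 : ℝ) - g 1 0 * x) : ℝ) z := by
  have hd := den_ne_zero hg hz
  have hdet : (0 : ℝ) < g.det := by exact_mod_cast hg
  have hN : ∀ x : ℝ, ∀ {z : ℂ}, 0 < z.im → 0 < normSq (x - z) := fun x z hz =>
    normSq_pos.2 (slitPlane_ne_zero (poissonAdm_ofReal x hz).2.1)
  have hx' : ((g 0 0 : ℂ) - g 1 0 * x) ≠ 0 := by exact_mod_cast hx
  rw [poissonPow_ofReal β x (mob_mem_Hs hg hz), poissonPow_ofReal β _ hz,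
    ← mul_cpow_ofReal_nonneg (by positivity) (div_nonneg hz.le (normSq_nonneg _)), ← ofReal_mul]
  congr 2
  -- With `g = (a, b; c, d)` this reads `x - g z = (a - c x) (g⁻¹ x - z) / (c z + d)`.
  have e : (x : ℂ) - mob g z = ((g 0 0 : ℂ) - g 1 0 * x) *
      (((((g 1 1 : ℝ) * x - g 0 1) / ((g 0 0 : ℝ) - g 1 0 * x) : ℝ) : ℂ) - z) /
        ((g 1 0 : ℂ) * z + g 1 1) := by
    rw [mob, eq_div_iff hd, sub_mul, div_mul_cancel₀ _ hd]
    push_cast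
    rw [mul_sub, mul_div_cancel₀ _ hx']
    ring
  have h2 : normSq ((g 0 0 : ℂ) - g 1 0 * x) = ((g 0 0 : ℝ) - g 1 0 * x) ^ 2 := by
    have : ((g 0 0 : ℂ) - g 1 0 * x) = (((g 0 0 : ℝ) - g 1 0 * x : ℝ) : ℂ) := by push_cast; rfl
    rw [this, normSq_ofReal, sq]
  have h3 := (normSq_pos.2 hd).ne'
  have h4 := (hN (((g 1 1 : ℝ) * x - g 0 1) / ((g 0 0 : ℝ) - g 1 0 * x)) hz).ne'
  rw [mob_im hd, e, normSq_div, normSq_mul, h2]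
  generalize normSq ((g 1 0 : ℂ) * z + g 1 1) = A at *
  generalize normSq ((((((g 1 1 : ℝ) * x - g 0 1) / ((g 0 0 : ℝ) - g 1 0 * x) : ℝ)) : ℂ) - z) = B
    at *
  field_simp

/-! ### Rapidly decaying eigenfunctions -/

/-- Real analytic eigenfunctions of the hyperbolic Laplacian, given on the complex numbers of
positive imaginary part, with rapid decay at all cusps. -/
structure IsRapid (β : ℂ) (f : ℂ → ℂ) : Prop where
  analytic : AnalyticOnNhd ℝ f Hs
  eigen : ∀ z ∈ Hs, Δ f z = -(β * (1 - β)) / (z.im : ℂ) ^ 2 * f z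
  decay : ∀ g : Matrix (Fin 2) (Fin 2) ℤ, 0 < g.det → ∀ N : ℕ, ∃ C A : ℝ, ∀ z ∈ Hs,
    A ≤ z.im → ‖f (mob g z)‖ * z.im ^ N ≤ C

lemma IsRapid.contDiffOn {β : ℂ} {f : ℂ → ℂ} (h : IsRapid β f) : ContDiffOn ℝ 2 f Hs :=
  fun z hz => (h.analytic z hz).contDiffAt.contDiffWithinAt

lemma IsRapid.differentiableAt {β : ℂ} {f : ℂ → ℂ} (h : IsRapid β f) {z : ℂ} (hz : 0 < z.im) :
    DifferentiableAt ℝ f z := (h.analytic z hz).differentiableAt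

lemma IsRapid.congr {β : ℂ} {f f' : ℂ → ℂ} (h : IsRapid β f) (he : EqOn f f' Hs) :
    IsRapid β f' where
  analytic z hz := (h.analytic z hz).congr (he.eventuallyEq_of_mem (isOpen_Hs.mem_nhds hz))
  eigen z hz := by
    have := he.eventuallyEq_of_mem (isOpen_Hs.mem_nhds hz)
    rw [← (InnerProductSpace.laplacian_congr_nhds this).eq_of_nhds, h.eigen z hz, he hz]
  decay g hg N := by
    obtain ⟨C, A, hC⟩ := h.decay g hg N
    refine ⟨C, A, fun z hz hA => ?_⟩
    rw [← he (mob_mem_Hs hg hz)]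
    exact hC z hz hA

/-- Conformal covariance multiplies the Laplacian by `|g'|² = det² / |c z + d|⁴`, which is the
square of `im (g z) / im z`, so the eigenvalue is unchanged. -/
lemma laplacian_comp_mob {f : ℂ → ℂ} (hf : ContDiffOn ℝ 2 f Hs) {β : ℂ}
    (he : ∀ z ∈ Hs, Δ f z = -(β * (1 - β)) / (z.im : ℂ) ^ 2 * f z)
    {g : Matrix (Fin 2) (Fin 2) ℤ} (hg : 0 < g.det) {z : ℂ} (hz : 0 < z.im) :
    Δ (f ∘ mob g) z = -(β * (1 - β)) / (z.im : ℂ) ^ 2 * (f ∘ mob g) z := by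
  have hd := den_ne_zero hg hz
  have hm := mob_mem_Hs hg hz
  rw [laplacian_comp_of_analyticAt (hf.contDiffAt (isOpen_Hs.mem_nhds hm)) (analyticAt_mob hd),
    he _ hm, (hasDerivAt_mob hd).deriv, mob_im hd]
  have h2 : (‖(g.det : ℂ) / ((g 1 0 : ℂ) * z + (g 1 1 : ℂ)) ^ 2‖ : ℝ) =
      (g.det : ℝ) / normSq ((g 1 0 : ℂ) * z + (g 1 1 : ℂ)) := by
    rw [norm_div, norm_pow, Complex.sq_norm, norm_intCast, abs_of_pos (by exact_mod_cast hg)]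
  have h3 : (normSq ((g 1 0 : ℂ) * z + (g 1 1 : ℂ)) : ℂ) ≠ 0 := by
    exact_mod_cast (normSq_pos.2 hd).ne'
  have h4 : (z.im : ℂ) ≠ 0 := by exact_mod_cast hz.ne'
  have h5 : (g.det : ℂ) ≠ 0 := by exact_mod_cast hg.ne'
  rw [h2]
  simp only [Function.comp, ofReal_div, ofReal_mul, ofReal_intCast]
  field_simp

lemma IsRapid.comp_mob {β : ℂ} {f : ℂ → ℂ} (h : IsRapid β f) {g : Matrix (Fin 2) (Fin 2) ℤ}
    (hg : 0 < g.det) : IsRapid β (f ∘ mob g) where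
  analytic z hz := (h.analytic _ (mob_mem_Hs hg hz)).comp
    (analyticAt_mob (den_ne_zero hg hz)).restrictScalars
  eigen z hz := laplacian_comp_mob h.contDiffOn h.eigen hg hz
  decay k hk N := by
    obtain ⟨C, A, hC⟩ := h.decay (g * k) (by rw [Matrix.det_mul]; positivity) N
    refine ⟨C, A, fun z hz hA => ?_⟩
    rw [Function.comp, mob_mob_of_pos hk hz]
    exact hC z hz hA

/-- Rapid decay of the function and of its gradient at `i∞`. -/
lemma IsRapid.decay_fderiv {β : ℂ} {f : ℂ → ℂ} (h : IsRapid β f) (N : ℕ) : ∃ C A : ℝ, 1 ≤ A ∧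
    ∀ z : ℂ, A ≤ z.im → ‖f z‖ * z.im ^ N ≤ C ∧ ‖fderiv ℝ f z‖ * z.im ^ N ≤ C := by
  obtain ⟨C, A, hC⟩ := h.decay 1 (by simp) N
  simp only [mob_one] at hC
  set L := ‖β * (1 - β)‖ with hL
  set K := |C| * 2 ^ N with hK
  have hK0 : 0 ≤ K := by positivity
  have hL0 : 0 ≤ L := norm_nonneg _
  -- The threshold `A + 1` keeps the unit disc around `z` in the region of decay. The bound `3`
  -- keeps the disc of radius `2` in the half plane and makes heights on the unit disc at least half
  -- of `im z`, whence the factor `2 ^ N` in `K`.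
  refine ⟨4 * K + 4 * (L * K), max (A + 1) 3, (by norm_num : (1 : ℝ) ≤ 3).trans (le_max_right _ _),
    fun z hz => ?_⟩
  have hz1 : A + 1 ≤ z.im := (le_max_left _ _).trans hz
  have hz3 : 3 ≤ z.im := (le_max_right _ _).trans hz
  have hz0 : 0 < z.im := by linarith
  have hyN : 0 < z.im ^ N := by positivity
  have hball : ∀ r, ∀ w ∈ Metric.closedBall z r, z.im - r ≤ w.im := by
    intro r w hw
    have h1 := abs_im_le_norm (w - z)
    rw [Metric.mem_closedBall, dist_eq] at hw
    have := (abs_le.1 (h1.trans hw)).1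
    rw [sub_im] at this
    linarith
  have hf : ∀ w ∈ Metric.closedBall z 1, ‖f w‖ ≤ K / z.im ^ N := by
    intro w hw
    have h1 := hball 1 w hw
    have hw0 : 0 < w.im := by linarith
    have h2 := hC w hw0 (by linarith)
    have h3 : z.im ^ N ≤ 2 ^ N * w.im ^ N := by
      rw [← mul_pow]
      gcongr
      linarith
    rw [le_div_iff₀ hyN]
    calc ‖f w‖ * z.im ^ N ≤ ‖f w‖ * (2 ^ N * w.im ^ N) := by gcongr
      _ = (‖f w‖ * w.im ^ N) * 2 ^ N := by ring
      _ ≤ K := by rw [hK]; gcongr; exact h2.trans (le_abs_self C)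
  have hΔ : ∀ w ∈ Metric.closedBall z 1, ‖Δ f w‖ ≤ L * (K / z.im ^ N) := by
    intro w hw
    have h1 := hball 1 w hw
    have hw0 : 0 < w.im := by linarith
    rw [h.eigen w hw0, norm_mul, norm_div, norm_neg, ← hL, norm_pow, norm_real,
      Real.norm_of_nonneg hw0.le]
    gcongr
    · exact div_le_self hL0 (one_le_pow₀ (by linarith))
    · exact hf w hw
  have hg := norm_fderiv_le_of_laplacian isOpen_Hs
    (fun w hw => show 0 < w.im by linarith [hball 2 w hw]) h.contDiffOn hf hΔ
  constructor
  · have := hf z (by simp)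
    rw [le_div_iff₀ hyN] at this
    nlinarith [mul_nonneg hL0 hK0]
  · calc ‖fderiv ℝ f z‖ * z.im ^ N
        ≤ (4 * (K / z.im ^ N) + 4 * (L * (K / z.im ^ N))) * z.im ^ N := by gcongr
      _ = 4 * K + 4 * (L * K) := by field_simp

/-! ### Maass cusp forms and integer matrices -/

/-- An integer matrix of positive determinant is an element of `SL(2, ℤ)` times an upper
triangular matrix with positive diagonal. -/
lemma exists_SL_mul_upper {g : Matrix (Fin 2) (Fin 2) ℤ} (hg : 0 < g.det) :
    ∃ (γ : SL(2, ℤ)) (B : Matrix (Fin 2) (Fin 2) ℤ), g = (γ : Matrix (Fin 2) (Fin 2) ℤ) * B ∧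
      B 1 0 = 0 ∧ 0 < B 0 0 ∧ 0 < B 1 1 := by
  have hne : 0 < Int.gcd (g 0 0) (g 1 0) := by
    rw [Nat.pos_iff_ne_zero, Ne, Int.gcd_eq_zero_iff]
    rintro ⟨h1, h2⟩
    rw [Matrix.det_fin_two, h1, h2] at hg
    simp at hg
  obtain ⟨a, c, hac, ha, hc⟩ := Int.exists_gcd_one hne
  obtain ⟨γ, h1, h2⟩ := (Int.isCoprime_iff_gcd_eq_one.2 hac).exists_SL2_col 0
  have e : g = (γ : Matrix (Fin 2) (Fin 2) ℤ) * ((γ⁻¹ : SL(2, ℤ)) * g) := by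
    rw [← mul_assoc, ← Matrix.SpecialLinearGroup.coe_mul]
    simp
  set B : Matrix (Fin 2) (Fin 2) ℤ := (γ⁻¹ : SL(2, ℤ)) * g with hB
  have hdet : B.det = g.det := by rw [hB, Matrix.det_mul, (γ⁻¹).2, one_mul]
  have hγ : (γ : Matrix (Fin 2) (Fin 2) ℤ) 0 0 * (γ : Matrix (Fin 2) (Fin 2) ℤ) 1 1 -
      (γ : Matrix (Fin 2) (Fin 2) ℤ) 0 1 * (γ : Matrix (Fin 2) (Fin 2) ℤ) 1 0 = 1 := by
    rw [← Matrix.det_fin_two]; exact γ.2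
  have b10 : B 1 0 = 0 := by
    rw [hB, Matrix.SpecialLinearGroup.coe_inv, Matrix.adjugate_fin_two]
    simp [Matrix.mul_apply, Fin.sum_univ_two, h1, h2]
    linear_combination (-c) * ha + a * hc
  have b00 : B 0 0 = Int.gcd (g 0 0) (g 1 0) := by
    rw [hB, Matrix.SpecialLinearGroup.coe_inv, Matrix.adjugate_fin_two]
    simp [Matrix.mul_apply, Fin.sum_univ_two]
    rw [h1, h2] at hγ
    linear_combination γ.1 1 1 * ha - γ.1 0 1 * hc + (Int.gcd (g 0 0) (g 1 0)) * hγ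
  have p00 : 0 < B 0 0 := by rw [b00]; exact_mod_cast hne
  refine ⟨γ, B, e, b10, p00, ?_⟩
  rw [← hdet, Matrix.det_fin_two, b10, mul_zero, sub_zero] at hg
  exact pos_of_mul_pos_right hg p00.le

/-- The function on the complex numbers attached to a function on the upper half plane. -/
abbrev ext (u : ℍ → ℂ) : ℂ → ℂ := fun z => u (UpperHalfPlane.ofComplex z)

lemma coe_smul_eq_mob (g : SL(2, ℤ)) (z : ℍ) :
    ((g • z : ℍ) : ℂ) = mob (g : Matrix (Fin 2) (Fin 2) ℤ) z := by
  rw [UpperHalfPlane.coe_specialLinearGroup_apply, mob]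
  simp

lemma ext_mob (u : ℍ → ℂ) (g : SL(2, ℤ)) (z : ℍ) :
    ext u (mob (g : Matrix (Fin 2) (Fin 2) ℤ) z) = u (g • z) := by
  rw [← coe_smul_eq_mob, ext, UpperHalfPlane.ofComplex_apply]

lemma coe_ofComplex {z : ℂ} (hz : 0 < z.im) : ((UpperHalfPlane.ofComplex z : ℍ) : ℂ) = z := by
  rw [UpperHalfPlane.ofComplex_apply_of_im_pos hz]

lemma ext_slashZero (u : ℍ → ℂ) (h : Matrix (Fin 2) (Fin 2) ℤ) :
    EqOn (ext (slashZero u h)) (ext u ∘ mob h) Hs := by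
  intro z hz
  simp only [ext, slashZero, Function.comp, mob, coe_ofComplex hz]

/-- Decay is assumed only along `SL(2, ℤ)`. A general matrix of positive determinant is `γ B` with
`B` upper triangular, and `B` multiplies the imaginary part by the constant `B 0 0 / B 1 1`. -/
lemma IsMaassCuspForm.isRapid {n : ℕ} {β : ℂ} {u : ℍ → ℂ} (hu : IsMaassCuspForm n β u) :
    IsRapid β (ext u) where
  analytic := hu.analytic
  eigen z hz := by
    have h := hu.eigen ⟨z, hz⟩
    have e : ext u z = u ⟨z, hz⟩ := by
      rw [ext, UpperHalfPlane.ofComplex_apply_of_im_pos hz]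
    have hy : (z.im : ℂ) ≠ 0 := by exact_mod_cast (ne_of_gt hz)
    rw [← e] at h
    change -((z.im : ℂ) ^ 2 * Δ (ext u) z) = β * (1 - β) * ext u z at h
    field_simp
    linear_combination -h
  decay g hg N := by
    obtain ⟨γ, B, rfl, b10, b00, b11⟩ := exists_SL_mul_upper hg
    have hB : 0 < B.det := by rw [Matrix.det_fin_two, b10]; simp; positivity
    obtain ⟨C, hC⟩ := (hu.decay γ (-(N : ℝ))).bound
    rw [Filter.Eventually, UpperHalfPlane.atImInfty_mem] at hC
    obtain ⟨A, hA⟩ := hC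
    have r00 : (0 : ℝ) < B 0 0 := by exact_mod_cast b00
    have r11 : (0 : ℝ) < B 1 1 := by exact_mod_cast b11
    refine ⟨|C| * ((B 1 1 : ℝ) / B 0 0) ^ N, A * (B 1 1 / B 0 0), fun z hz hzA => ?_⟩
    have hm := mob_mem_Hs hB hz
    have him : (mob B z).im = z.im * (B 0 0 / B 1 1) := by
      rw [mob_im (den_ne_zero hB hz), Matrix.det_fin_two, b10]
      simp [normSq_apply]
      field_simp
    have hz' : z.im = (mob B z).im * (B 1 1 / B 0 0) := by rw [him]; field_simp
    have h1 := hA ⟨mob B z, hm⟩ (by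
      change A ≤ (mob B z).im
      rw [him, ← div_le_iff₀ (by positivity)]
      refine le_trans (le_of_eq ?_) hzA
      field_simp)
    simp only [mem_ofPred_eq] at h1
    rw [← ext_mob u γ] at h1
    change ‖ext u (mob γ (mob B z))‖ ≤ C * ‖(mob B z).im ^ (-(N : ℝ))‖ at h1
    rw [mob_mob_of_pos hB hz, Real.rpow_neg hm.le, Real.rpow_natCast, norm_inv, norm_pow,
      Real.norm_of_nonneg hm.le, ← div_eq_mul_inv, le_div_iff₀ (by positivity)] at h1
    rw [hz', mul_pow, ← mul_assoc]
    gcongr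
    exact h1.trans (le_abs_self C)

/-- The form `u(m z)` is a cusp form for `Γ₀(n m)`. -/
lemma IsMaassCuspForm.slashZero_matB {n m : ℕ} [NeZero m] {β : ℂ} {u : ℍ → ℂ}
    (hu : IsMaassCuspForm n β u) : IsMaassCuspForm (n * m) β (slashZero u (matB m)) := by
  have hm0 : m ≠ 0 := NeZero.ne m
  have hm : 0 < (matB m).det := by simp [matB, Matrix.det_fin_two]; omega
  have hr : IsRapid β (ext (slashZero u (matB m))) :=
    (hu.isRapid.comp_mob hm).congr (ext_slashZero u (matB m)).symm
  refine ⟨hr.analytic, fun g hg z => ?_, fun z => ?_, fun g C => ?_⟩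
  · have hc : ((n * m : ℕ) : ℤ) ∣ g 1 0 := by
      rw [CongruenceSubgroup.Gamma0_mem] at hg
      exact (ZMod.intCast_zmod_eq_zero_iff_dvd _ _).1 hg
    obtain ⟨c, hc⟩ := hc
    have hdet : g 0 0 * g 1 1 - g 0 1 * g 1 0 = 1 := by
      have := g.2; rwa [Matrix.det_fin_two] at this
    -- This is `B_m g B_m⁻¹`; it is integral, with lower left entry divisible by `n`, because `n m`
    -- divides the lower left entry of `g`.
    let γ : SL(2, ℤ) := ⟨!![g 0 0, m * g 0 1; n * c, g 1 1], by
      rw [Matrix.det_fin_two_of]; rw [hc] at hdet; push_cast at hdet; linear_combination hdet⟩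
    have hγ : γ ∈ CongruenceSubgroup.Gamma0 n := by
      rw [CongruenceSubgroup.Gamma0_mem]
      simp [γ]
    have e : matB m * (g : Matrix (Fin 2) (Fin 2) ℤ) =
        (γ : Matrix (Fin 2) (Fin 2) ℤ) * matB m := by
      ext i j
      fin_cases i <;> fin_cases j <;>
        simp [matB, γ, Matrix.mul_apply, Fin.sum_univ_two, hc] <;> ring
    have hz := z.im_pos
    have hgd : 0 < (g : Matrix (Fin 2) (Fin 2) ℤ).det := by simp
    have hB := mob_mem_Hs hm hz
    rw [← ext_mob (slashZero u (matB m)) g z, ext_slashZero u _ (mob_mem_Hs hgd hz), Function.comp,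
      mob_mob_of_pos hgd hz, e,
      ← mob_mob_of_pos hm hz]
    have h1 := ext_mob u γ ⟨mob (matB m) z, hB⟩
    have h2 := hu.invariant γ hγ ⟨mob (matB m) z, hB⟩
    change ext u (mob γ (mob (matB m) z)) = _ at h1
    rw [h1, h2, ← UpperHalfPlane.ofComplex_apply_of_im_pos hB]
    rfl
  · have h1 := hr.eigen z z.im_pos
    have hy : ((z : ℂ).im : ℂ) ≠ 0 := by exact_mod_cast z.im_pos.ne'
    have e : ext (slashZero u (matB m)) z = slashZero u (matB m) z := by
      rw [ext, UpperHalfPlane.ofComplex_apply]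
    rw [e] at h1
    change -(((z : ℂ).im : ℂ) ^ 2 * Δ (ext (slashZero u (matB m))) z) = _
    rw [h1]
    field_simp
  -- For `im z ≥ 1` and `N ≥ -C`, decay of order `N` implies decay like `(im z) ^ C`.
  · obtain ⟨N, hN⟩ := exists_nat_ge (-C)
    obtain ⟨K, A, hK⟩ := hr.decay g (by simp) N
    refine Asymptotics.IsBigO.of_bound K ?_
    rw [Filter.Eventually, UpperHalfPlane.atImInfty_mem]
    refine ⟨max A 1, fun z hz => ?_⟩
    have hz0 := z.im_pos
    have h1 : 1 ≤ z.im := (le_max_right _ _).trans hz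
    have h2 := hK z hz0 ((le_max_left _ _).trans hz)
    rw [ext_mob] at h2
    change _ * z.im ^ N ≤ K at h2
    simp only [mem_ofPred_eq]
    rw [← le_div_iff₀ (by positivity)] at h2
    have hK0 : 0 ≤ K := by
      have := (norm_nonneg _).trans h2
      rwa [le_div_iff₀ (by positivity), zero_mul] at this
    refine h2.trans ?_
    rw [div_eq_mul_inv, Real.norm_of_nonneg (by positivity), ← Real.rpow_natCast,
      ← Real.rpow_neg hz0.le]
    gcongr
    linarith

end

section

open Complex Set Filter Topology MeasureTheory

/-! ### Limits at cusps of primitives -/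

/-- `G` tends to `L` at `i∞` in every cone `|x| ≤ X y`. -/
def HasConeLimit (G : ℂ → ℂ) (L : ℂ) : Prop :=
  ∀ X : ℝ, ∀ ε > 0, ∃ A : ℝ, ∀ z : ℂ, A ≤ z.im → |z.re| ≤ X * z.im → ‖G z - L‖ ≤ ε

/-- Along the imaginary axis the derivative is `O(t⁻²)`, hence integrable, and a limit exists. A
horizontal segment in the cone at height `y` has length `O(y)`, so `G` varies along it only by `O(1
/ y)`. -/
lemma exists_hasConeLimit {G : ℂ → ℂ} {D : ℂ → ℂ →L[ℝ] ℂ} (hG : ∀ z ∈ Hs, HasFDerivAt G (D z) z)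
    (hD : ∀ X : ℝ, ∃ C A : ℝ, 1 ≤ A ∧ ∀ z : ℂ, A ≤ z.im → |z.re| ≤ X * z.im →
      ‖D z‖ * z.im ^ 2 ≤ C) : ∃ L, HasConeLimit G L := by
  obtain ⟨C₀, A₀, hA₀, h₀⟩ := hD 0
  have him : ∀ t : ℝ, ((t : ℂ) * I).im = t := by simp
  have hre : ∀ t : ℝ, ((t : ℂ) * I).re = 0 := by simp
  have hderiv : ∀ t ∈ Ioi A₀, HasDerivAt (fun t : ℝ => G (t * I)) (D (t * I) I) t := by
    intro t ht
    have ht0 : 0 < t := by linarith [mem_Ioi.1 ht]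
    have h1 : HasDerivAt (fun t : ℝ => (t : ℂ) * I) I t := by
      simpa using (ofRealCLM.hasDerivAt (x := t)).mul_const I
    exact (hG (t * I) (by simpa using ht0)).comp_hasDerivAt t h1
  have hint : IntegrableOn (fun t : ℝ => D (t * I) I) (Ioi A₀) := by
    have hb : IntegrableOn (fun t : ℝ => C₀ * t ^ (-2 : ℝ)) (Ioi A₀) :=
      (integrableOn_Ioi_rpow_of_lt (by norm_num) (by linarith)).const_mul C₀
    refine Integrable.mono' hb ?_ ?_
    · refine (aestronglyMeasurable_deriv (fun t : ℝ => G (t * I)) _).congr ?_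
      filter_upwards [ae_restrict_mem measurableSet_Ioi] with t ht using (hderiv t ht).deriv
    · filter_upwards [ae_restrict_mem measurableSet_Ioi] with t ht
      have ht' : A₀ < t := ht
      have ht0 : 0 < t := by linarith
      have := h₀ (t * I) (by rw [him]; exact ht'.le) (by rw [hre]; simp)
      rw [him] at this
      rw [Real.rpow_neg ht0.le, ← div_eq_mul_inv, le_div_iff₀ (by positivity)]
      refine le_trans ?_ this
      rw [Real.rpow_two]
      gcongr
      simpa using (D (t * I)).le_opNorm I
  have hlim := tendsto_limUnder_of_hasDerivAt_of_integrableOn_Ioi hderiv hint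
  set L := limUnder atTop fun t : ℝ => G (t * I)
  refine ⟨L, fun X ε hε => ?_⟩
  obtain ⟨C, A, hA, hC⟩ := hD X
  obtain ⟨A', hA'⟩ := (Metric.tendsto_atTop.1 hlim) (ε / 2) (half_pos hε)
  refine ⟨max (max A A') (2 * |C| * |X| / ε), fun z hz hzX => ?_⟩
  have z1 : A ≤ z.im := ((le_max_left _ _).trans (le_max_left _ _)).trans hz
  have z2 : A' ≤ z.im := ((le_max_right _ _).trans (le_max_left _ _)).trans hz
  have z3 : 2 * |C| * |X| / ε ≤ z.im := (le_max_right _ _).trans hz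
  have z0 : 0 < z.im := by linarith
  have h1 : ‖G (z.im * I) - L‖ < ε / 2 := by
    have := hA' z.im z2
    rwa [dist_eq] at this
  have h2 : ‖G z - G (z.im * I)‖ ≤ |C| / z.im ^ 2 * ‖z - z.im * I‖ := by
    have hconv : Convex ℝ {w : ℂ | w.im = z.im ∧ |w.re| ≤ X * z.im} := by
      intro a ha b hb s t hs ht hst
      refine ⟨?_, ?_⟩
      · simp only [add_im, real_smul, mul_im, ofReal_re, ofReal_im, zero_mul, add_zero, ha.1, hb.1]
        rw [← add_mul, hst, one_mul]
      · have ha := abs_le.1 ha.2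
        have hb := abs_le.1 hb.2
        simp only [add_re, real_smul, mul_re, ofReal_re, ofReal_im, zero_mul, sub_zero]
        have e : X * z.im = s * (X * z.im) + t * (X * z.im) := by rw [← add_mul, hst, one_mul]
        rw [abs_le]
        constructor <;> rw [e] <;> nlinarith
    refine hconv.norm_image_sub_le_of_norm_hasFDerivWithin_le (f' := D)
      (fun w hw => (hG w (by simpa [hw.1] using z0)).hasFDerivWithinAt) (fun w hw => ?_) ?_
      ⟨rfl, hzX⟩
    · rw [le_div_iff₀ (by positivity), ← hw.1]
      exact (hC w (by rw [hw.1]; exact z1) (by rw [hw.1]; exact hw.2)).trans (le_abs_self C)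
    · exact ⟨by simp, by simpa using (abs_nonneg _).trans hzX⟩
  have h3 : ‖z - z.im * I‖ ≤ |X| * z.im := by
    have : z - z.im * I = z.re := by
      apply Complex.ext <;> simp
    rw [this, norm_real]
    exact hzX.trans (by gcongr; exact le_abs_self X)
  have h4 : |C| / z.im ^ 2 * ‖z - z.im * I‖ ≤ ε / 2 := by
    calc _ ≤ |C| / z.im ^ 2 * (|X| * z.im) := by gcongr
      _ = |C| * |X| / z.im := by field_simp
      _ ≤ ε / 2 := by
        rw [div_le_iff₀ hε] at z3
        rw [div_le_iff₀ z0]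
        linarith
  calc ‖G z - L‖ = ‖(G z - G (z.im * I)) + (G (z.im * I) - L)‖ := by congr 1; ring
    _ ≤ ε / 2 + ε / 2 := (norm_add_le _ _).trans (add_le_add (h2.trans h4) h1.le)
    _ = ε := by ring

lemma HasConeLimit.tendsto_ray {G : ℂ → ℂ} {L : ℂ} (h : HasConeLimit G L) (x : ℝ) {w : ℂ}
    (hw : 0 < w.im) : Tendsto (fun t : ℝ => G (x + t * w)) atTop (𝓝 L) := by
  rw [Metric.tendsto_atTop]
  intro ε hε
  obtain ⟨A, hA⟩ := h ((|x| + |w.re|) / w.im) (ε / 2) (half_pos hε)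
  refine ⟨max 1 (A / w.im), fun t ht => ?_⟩
  have t1 : 1 ≤ t := (le_max_left _ _).trans ht
  have t2 : A / w.im ≤ t := (le_max_right _ _).trans ht
  rw [dist_eq]
  refine (hA _ ?_ ?_).trans_lt (by linarith)
  · rw [div_le_iff₀ hw] at t2
    simpa using t2
  · simp only [add_re, ofReal_re, mul_re, ofReal_im, zero_mul, sub_zero, add_im, mul_im, add_zero,
      zero_add]
    have : (|x| + |w.re|) / w.im * (t * w.im) = |x| * t + t * |w.re| := by field_simp
    rw [this]
    refine (abs_add_le _ _).trans ?_
    rw [abs_mul, abs_of_pos (by linarith : 0 < t)]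
    gcongr
    exact le_mul_of_one_le_right (abs_nonneg _) t1

/-! ### Bounds for the kernel; primitives and their values at cusps -/

lemma rpow_le_pow_of_le {x Q s : ℝ} {M : ℕ} (hQ : 1 ≤ Q) (hM : |s| ≤ M) (h1 : Q⁻¹ ≤ x)
    (h2 : x ≤ Q) : x ^ s ≤ Q ^ M := by
  have hQ0 : 0 < Q := by linarith
  have hx : 0 < x := (inv_pos.2 hQ0).trans_le h1
  rw [← Real.rpow_natCast]
  rcases le_total 0 s with hs | hs
  · calc x ^ s ≤ Q ^ s := Real.rpow_le_rpow hx.le h2 hs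
      _ ≤ Q ^ (M : ℝ) := Real.rpow_le_rpow_of_exponent_le hQ ((le_abs_self s).trans hM)
  · calc x ^ s = (x⁻¹) ^ (-s) := by rw [Real.inv_rpow hx.le, Real.rpow_neg hx.le, inv_inv]
      _ ≤ Q ^ (-s) := Real.rpow_le_rpow (by positivity) (inv_le_of_inv_le₀ hQ0 h1) (by linarith)
      _ ≤ Q ^ (M : ℝ) := Real.rpow_le_rpow_of_exponent_le hQ ((neg_le_abs s).trans hM)

lemma norm_fderiv_poissonPow_le {β ζ z : ℂ} (h : PoissonAdm ζ z) {d : ℝ} (hd : 0 < d)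
    (h0 : d ≤ z.im) (h1 : d ≤ ‖ζ - z‖) (h2 : d ≤ ‖ζ - (starRingEnd ℂ) z‖) :
    ‖fderiv ℝ (poissonPow β ζ) z‖ ≤ ‖poissonPow β ζ z‖ * ‖β‖ * (3 / d) := by
  rw [(hasFDerivAt_poissonPow h).fderiv, norm_smul, norm_mul]
  gcongr
  exact ContinuousLinearMap.opNorm_le_bound _ (by positivity) (norm_poissonLogDeriv_le hd h0 h1 h2)

lemma norm_form_opNorm_le (u v : ℂ → ℂ) (z : ℂ) :
    ‖form u v z‖ ≤ ‖v z‖ * ‖fderiv ℝ u z‖ + ‖u z‖ * ‖fderiv ℝ v z‖ :=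
  ContinuousLinearMap.opNorm_le_bound _ (by positivity) (norm_form_le u v z)

/-- Decay in cones of the form attached to a rapidly decaying function and a kernel at a real
point. -/
lemma IsRapid.norm_form_le {β : ℂ} {f : ℂ → ℂ} (hf : IsRapid β f) (x X : ℝ) :
    ∃ C A : ℝ, 1 ≤ A ∧ ∀ z : ℂ, A ≤ z.im → |z.re| ≤ X * z.im →
      ‖form f (poissonPow β x) z‖ * z.im ^ 2 ≤ C := by
  obtain ⟨M, hM⟩ := exists_nat_ge |β.re|
  -- In the cone the kernel is at most `(K y) ^ M`; two further powers of `y` provide the required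
  -- decay.
  obtain ⟨C, A, hA, hC⟩ := hf.decay_fderiv (M + 2)
  set K : ℝ := (|x| + |X| + 1) ^ 2 with hK
  have hK1 : 1 ≤ K := one_le_pow₀ (by linarith [abs_nonneg x, abs_nonneg X])
  refine ⟨K ^ M * (1 + 3 * ‖β‖) * C, A, hA, fun z hz hzX => ?_⟩
  have hy1 : 1 ≤ z.im := hA.trans hz
  have hy0 : 0 < z.im := by linarith
  have hadm := poissonAdm_ofReal x hy0
  have hn : normSq (x - z) = (x - z.re) ^ 2 + z.im ^ 2 := by
    rw [normSq_apply]; simp; ring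
  have hn1 : z.im ^ 2 ≤ normSq (x - z) := by rw [hn]; nlinarith [sq_nonneg (x - z.re)]
  have hn2 : normSq (x - z) ≤ K * z.im ^ 2 := by
    have h1 : |x - z.re| ≤ (|x| + |X|) * z.im := by
      refine (abs_sub _ _).trans ?_
      have : X * z.im ≤ |X| * z.im := by gcongr; exact le_abs_self X
      nlinarith [abs_nonneg x]
    have h2 : (x - z.re) ^ 2 ≤ ((|x| + |X|) * z.im) ^ 2 := sq_le_sq' (by
      linarith [(abs_le.1 h1).1]) (abs_le.1 h1).2
    rw [hn, hK]
    nlinarith [mul_nonneg (add_nonneg (abs_nonneg x) (abs_nonneg X)) (sq_nonneg z.im)]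
  have hn0 : 0 < normSq (x - z) := by nlinarith
  have hp : ‖poissonPow β x z‖ ≤ (K * z.im) ^ M := by
    rw [norm_poissonPow_ofReal β x hy0]
    refine rpow_le_pow_of_le (by nlinarith) hM ?_ ?_
    · rw [le_div_iff₀ hn0, inv_mul_le_iff₀ (by positivity)]
      nlinarith
    · rw [div_le_iff₀ hn0]
      nlinarith [mul_le_mul hK1 hn1 (by positivity) (by linarith)]
  have hnorm : 1 ≤ ‖(x : ℂ) - z‖ := by
    have := abs_im_le_norm ((x : ℂ) - z)
    simp [abs_of_pos hy0] at this
    linarith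
  have hnorm' : 1 ≤ ‖(x : ℂ) - (starRingEnd ℂ) z‖ := by
    rw [← RCLike.norm_conj]; simpa using hnorm
  have hdp := norm_fderiv_poissonPow_le (β := β) hadm one_pos hy1 hnorm hnorm'
  have hC' := hC z hz
  calc ‖form f (poissonPow β x) z‖ * z.im ^ 2
      ≤ (‖poissonPow β x z‖ * ‖fderiv ℝ f z‖ +
          ‖f z‖ * (‖poissonPow β x z‖ * ‖β‖ * (3 / 1))) * z.im ^ 2 := by
        gcongr
        exact (norm_form_opNorm_le _ _ _).trans (by gcongr)
    _ = ‖poissonPow β x z‖ * (‖fderiv ℝ f z‖ + 3 * ‖β‖ * ‖f z‖) * z.im ^ 2 := by ring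
    _ ≤ (K * z.im) ^ M * (‖fderiv ℝ f z‖ + 3 * ‖β‖ * ‖f z‖) * z.im ^ 2 := by gcongr
    _ = K ^ M * ((‖fderiv ℝ f z‖ * z.im ^ (M + 2)) + 3 * ‖β‖ * (‖f z‖ * z.im ^ (M + 2))) := by
        rw [mul_pow]; ring
    _ ≤ K ^ M * (C + 3 * ‖β‖ * C) := by
        gcongr
        exacts [hC'.2, hC'.1]
    _ = K ^ M * (1 + 3 * ‖β‖) * C := by ring

/-- `F` is a primitive of the form attached to `f` and to the kernel at `x`. -/
def IsPrimitive (β : ℂ) (f : ℂ → ℂ) (x : ℝ) (F : ℂ → ℂ) : Prop :=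
  ∀ z ∈ Hs, HasFDerivAt F (form f (poissonPow β x) z) z

/-- Equality of the two eigenvalues makes the form closed. -/
lemma IsRapid.exists_isPrimitive {β : ℂ} {f : ℂ → ℂ} (hf : IsRapid β f) (x : ℝ) :
    ∃ F, IsPrimitive β f x F := by
  refine exists_primitive hf.contDiffOn (fun z hz =>
    (analyticAt_poissonPow (poissonAdm_ofReal x hz)).contDiffAt.contDiffWithinAt) fun z hz => ?_
  rw [hf.eigen z hz, laplacian_poissonPow (poissonAdm_ofReal x hz)]
  ring

lemma IsPrimitive.hasFDerivAt_comp_mob {β : ℂ} {f : ℂ → ℂ} (hf : IsRapid β f) {x : ℝ} {F : ℂ → ℂ}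
    (hF : IsPrimitive β f x F) {g : Matrix (Fin 2) (Fin 2) ℤ} (hg : 0 < g.det)
    (hx : (g 0 0 : ℝ) - g 1 0 * x ≠ 0) {z : ℂ} (hz : 0 < z.im) :
    HasFDerivAt (F ∘ mob g)
      (((((g.det : ℝ) / ((g 0 0 : ℝ) - g 1 0 * x) ^ 2 : ℝ) : ℂ) ^ β) •
        form (f ∘ mob g)
          (poissonPow β (((g 1 1 : ℝ) * x - g 0 1) / ((g 0 0 : ℝ) - g 1 0 * x) : ℝ)) z) z := by
  have hm := mob_mem_Hs hg hz
  have hd := hasDerivAt_mob (den_ne_zero hg hz)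
  refine ((hF _ hm).comp z (hd.hasFDerivAt.restrictScalars ℝ)).congr_fderiv ?_
  have hev : poissonPow β x ∘ mob g =ᶠ[𝓝 z] fun z =>
      (((g.det : ℝ) / ((g 0 0 : ℝ) - g 1 0 * x) ^ 2 : ℝ) : ℂ) ^ β *
        poissonPow β (((g 1 1 : ℝ) * x - g 0 1) / ((g 0 0 : ℝ) - g 1 0 * x) : ℝ) z := by
    filter_upwards [isOpen_Hs.mem_nhds hz] with w hw using poissonPow_mob β hg x hx hw
  have h1 := form_comp (hf.differentiableAt hm)
    (analyticAt_poissonPow (β := β) (poissonAdm_ofReal x hm)).differentiableAt hd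
  have key : ∀ w, form f (poissonPow β x) (mob g z)
      ((g.det : ℂ) / ((g 1 0 : ℂ) * z + (g 1 1 : ℂ)) ^ 2 * w) =
      (((g.det : ℝ) / ((g 0 0 : ℝ) - g 1 0 * x) ^ 2 : ℝ) : ℂ) ^ β * form (f ∘ mob g)
          (poissonPow β (((g 1 1 : ℝ) * x - g 0 1) / ((g 0 0 : ℝ) - g 1 0 * x) : ℝ)) z w := by
    intro w
    rw [← h1, form_congr EventuallyEq.rfl hev, form_const_mul
      (analyticAt_poissonPow (poissonAdm_ofReal _ hz)).differentiableAt]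
  refine ContinuousLinearMap.ext fun w => ?_
  simpa [mul_comm] using key w

/-- The value of `F` at the cusp `g(∞)`. -/
def cuspLim (F : ℂ → ℂ) (g : Matrix (Fin 2) (Fin 2) ℤ) : ℂ :=
  limUnder atTop fun t : ℝ => F (mob g (t * I))

/-- The hypothesis `hx` says that the cusp `g(∞)` is not `x`. Then the form pulled back by `g` is a
constant multiple of a form with kernel at the finite real point `g⁻¹ x`, and it decays in cones.
The limit is therefore the same along every ray. -/
lemma IsPrimitive.tendsto_cuspLim {β : ℂ} {f : ℂ → ℂ} (hf : IsRapid β f) {x : ℝ} {F : ℂ → ℂ}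
    (hF : IsPrimitive β f x F) {g : Matrix (Fin 2) (Fin 2) ℤ} (hg : 0 < g.det)
    (hx : (g 0 0 : ℝ) - g 1 0 * x ≠ 0) (r : ℝ) {w : ℂ} (hw : 0 < w.im) :
    Tendsto (fun t : ℝ => F (mob g (r + t * w))) atTop (𝓝 (cuspLim F g)) := by
  obtain ⟨L, hL⟩ := exists_hasConeLimit (fun z hz => hF.hasFDerivAt_comp_mob hf hg hx hz)
    (fun X => by
      obtain ⟨C, A, hA, hC⟩ := (hf.comp_mob hg).norm_form_le
        (((g 1 1 : ℝ) * x - g 0 1) / ((g 0 0 : ℝ) - g 1 0 * x)) X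
      refine ⟨‖(((g.det : ℝ) / ((g 0 0 : ℝ) - g 1 0 * x) ^ 2 : ℝ) : ℂ) ^ β‖ * C, A, hA,
        fun z hz hzX => ?_⟩
      rw [norm_smul, mul_assoc]
      gcongr
      exact hC z hz hzX)
  have h1 : Tendsto (fun t : ℝ => F (mob g (t * I))) atTop (𝓝 L) := by
    simpa using hL.tendsto_ray 0 (w := I) (by simp)
  rw [cuspLim, h1.limUnder_eq]
  exact hL.tendsto_ray r hw

/-- `B` fixes `∞` and sends the imaginary axis to another vertical half-line, so `g B` and `g` name
the same cusp. -/
lemma IsPrimitive.cuspLim_mul_upper {β : ℂ} {f : ℂ → ℂ} (hf : IsRapid β f) {x : ℝ} {F : ℂ → ℂ}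
    (hF : IsPrimitive β f x F) {g B : Matrix (Fin 2) (Fin 2) ℤ} (hg : 0 < g.det)
    (hx : (g 0 0 : ℝ) - g 1 0 * x ≠ 0) (hB : 0 < B.det) (hB0 : B 1 0 = 0) :
    cuspLim F (g * B) = cuspLim F g := by
  have hdet : 0 < (B 0 0 : ℝ) * B 1 1 := by
    have : 0 < B 0 0 * B 1 1 := by rwa [Matrix.det_fin_two, hB0, mul_zero, sub_zero] at hB
    exact_mod_cast this
  have h11 : (B 1 1 : ℝ) ≠ 0 := right_ne_zero_of_mul hdet.ne'
  have hpos : 0 < (B 0 0 : ℝ) / B 1 1 := by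
    have : (B 0 0 : ℝ) / B 1 1 = B 0 0 * B 1 1 / (B 1 1) ^ 2 := by field_simp
    rw [this]; positivity
  have h := hF.tendsto_cuspLim hf hg hx ((B 0 1 : ℝ) / B 1 1)
    (w := ((B 0 0 : ℝ) / B 1 1 : ℝ) * I) (by simpa using hpos)
  rw [cuspLim]
  refine Tendsto.limUnder_eq (h.congr' ?_)
  filter_upwards [eventually_gt_atTop 0] with t ht
  rw [← mob_mob_of_pos hB (by simpa using ht)]
  congr 2
  have h11' : (B 1 1 : ℂ) ≠ 0 := by exact_mod_cast h11
  rw [mob, hB0]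
  push_cast
  rw [zero_mul, zero_add]
  field_simp
  ring

/-! ### Integrals over rays -/

/-- The point of the ray of angle `θ` at distance `t` from the origin. -/
def ray (θ t : ℝ) : ℂ := t * exp (θ * I)

lemma ray_re (θ t : ℝ) : (ray θ t).re = t * Real.cos θ := by simp [ray, exp_ofReal_mul_I_re]

lemma ray_im (θ t : ℝ) : (ray θ t).im = t * Real.sin θ := by simp [ray, exp_ofReal_mul_I_im]

lemma ray_im_pos {θ t : ℝ} (hθ : 0 < Real.sin θ) (ht : 0 < t) : 0 < (ray θ t).im := by
  rw [ray_im]; positivity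

lemma continuous_ray (θ : ℝ) : Continuous (ray θ) := by unfold ray; fun_prop

/-- The matrix of the inversion `z ↦ -1 / z`. -/
def matS : Matrix (Fin 2) (Fin 2) ℤ := !![0, -1; 1, 0]

lemma det_matS : matS.det = 1 := by simp [matS, Matrix.det_fin_two]

lemma mob_matS (z : ℂ) : mob matS z = -1 / z := by simp [mob, matS]

lemma mob_matS_mob_matS (z : ℂ) : mob matS (mob matS z) = z := by
  rw [mob_matS, mob_matS, div_div_eq_mul_div]; simp

lemma mob_matS_ray (θ t : ℝ) : mob matS (ray θ t) = ray (Real.pi - θ) t⁻¹ := by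
  rw [mob_matS, ray, ray, neg_div, one_div, mul_inv, ← exp_neg]
  push_cast
  rw [sub_mul, exp_sub, exp_pi_mul_I, exp_neg]
  ring

lemma exists_bound_Ioi {h : ℝ → ℝ} (hc : ContinuousOn h (Ioi 0)) {C A C' A' : ℝ}
    (h1 : ∀ t, 0 < t → A ≤ t → h t ≤ C) (h2 : ∀ t, 0 < t → A' ≤ t⁻¹ → h t ≤ C') :
    ∃ K, ∀ t, 0 < t → h t ≤ K := by
  set a := max A 1
  set b := (max A' 1)⁻¹
  have hb : 0 < b := by positivity
  obtain ⟨K, hK⟩ := (isCompact_Icc (a := b) (b := a)).exists_bound_of_continuousOn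
    (hc.mono fun t ht => hb.trans_le ht.1)
  refine ⟨max K (max C C'), fun t ht => ?_⟩
  rcases le_total a t with h | h
  · exact (h1 t ht ((le_max_left _ _).trans h)).trans ((le_max_left _ _).trans (le_max_right _ _))
  rcases le_total t b with h' | h'
  · refine (h2 t ht ?_).trans ((le_max_right _ _).trans (le_max_right _ _))
    exact (le_max_left _ _).trans ((le_inv_comm₀ ht (by positivity)).1 h')
  · exact (le_abs_self _).trans ((hK t ⟨h', h⟩).trans (le_max_left _ _))

lemma IsRapid.continuousOn_fderiv {β : ℂ} {f : ℂ → ℂ} (hf : IsRapid β f) :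
    ContinuousOn (fderiv ℝ f) Hs :=
  hf.contDiffOn.continuousOn_fderiv_of_isOpen isOpen_Hs (by norm_num)

lemma IsRapid.norm_fderiv_le_inv {β : ℂ} {f : ℂ → ℂ} (hf : IsRapid β f) {z : ℂ} (hz : 0 < z.im) :
    ‖fderiv ℝ f z‖ ≤ ‖fderiv ℝ (f ∘ mob matS) (mob matS z)‖ * ‖z‖⁻¹ ^ 2 := by
  have hS : 0 < matS.det := by rw [det_matS]; norm_num
  have hm := mob_mem_Hs hS hz
  have e : f =ᶠ[𝓝 z] (f ∘ mob matS) ∘ mob matS :=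
    Eventually.of_forall fun w => by simp only [Function.comp, mob_matS_mob_matS]
  refine ContinuousLinearMap.opNorm_le_bound _ (by positivity) fun w => ?_
  rw [e.fderiv_eq, fderiv_comp_hasDerivAt ((hf.comp_mob hS).differentiableAt hm)
    (hasDerivAt_mob (den_ne_zero hS hz))]
  refine (ContinuousLinearMap.le_opNorm _ _).trans (le_of_eq ?_)
  rw [det_matS]
  simp [matS]
  ring

/-- Decay at `i∞` handles large `t`. Near the origin it is applied to `f(-1 / z)` on the reflected
ray of angle `π - θ`. -/
lemma IsRapid.decay_ray {β : ℂ} {f : ℂ → ℂ} (hf : IsRapid β f) {θ : ℝ} (hθ : 0 < Real.sin θ)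
    (N : ℕ) : ∃ C, ∀ t : ℝ, 0 < t → ‖f (ray θ t)‖ * (t + t⁻¹) ^ N ≤ C ∧
      ‖fderiv ℝ f (ray θ t)‖ * (t + t⁻¹) ^ N ≤ C := by
  have hS : 0 < matS.det := by rw [det_matS]; norm_num
  set s := Real.sin θ with hs
  have hs' : Real.sin (Real.pi - θ) = s := Real.sin_pi_sub θ
  have hs0 : s ≠ 0 := hθ.ne'
  have hq : ∀ t : ℝ, 0 < t → 1 ≤ t → ∀ N : ℕ, (t + t⁻¹) ^ N ≤ (2 / s) ^ N * (t * s) ^ N := by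
    intro t ht h1 N
    rw [← mul_pow]
    have : 2 / s * (t * s) = 2 * t := by field_simp
    rw [this]
    have : t⁻¹ ≤ 1 := inv_le_one_of_one_le₀ h1
    gcongr
    linarith
  have key : ∀ {h : ℂ → ℂ}, IsRapid β h → ∀ θ', Real.sin θ' = s → ∀ N : ℕ, ∃ C A : ℝ, ∀ t : ℝ,
      0 < t → A ≤ t → 1 ≤ t ∧ ‖h (ray θ' t)‖ * (t + t⁻¹) ^ N ≤ C ∧
      ‖fderiv ℝ h (ray θ' t)‖ * (t + t⁻¹) ^ N ≤ C := by
    intro h hh θ' hθ' N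
    obtain ⟨C, A, hA, hC⟩ := hh.decay_fderiv N
    refine ⟨(2 / s) ^ N * C, max (A / s) 1, fun t ht htA => ?_⟩
    have h1 : 1 ≤ t := (le_max_right _ _).trans htA
    have h2 : A / s ≤ t := (le_max_left _ _).trans htA
    rw [div_le_iff₀ hθ] at h2
    have him : (ray θ' t).im = t * s := by rw [ray_im, hθ']
    have h3 := hC (ray θ' t) (by rw [him]; exact h2)
    rw [him] at h3
    refine ⟨h1, ?_, ?_⟩
    · calc _ ≤ ‖h (ray θ' t)‖ * ((2 / s) ^ N * (t * s) ^ N) := by gcongr; exact hq t ht h1 N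
        _ = (2 / s) ^ N * (‖h (ray θ' t)‖ * (t * s) ^ N) := by ring
        _ ≤ _ := by gcongr; exact h3.1
    · calc _ ≤ ‖fderiv ℝ h (ray θ' t)‖ * ((2 / s) ^ N * (t * s) ^ N) := by
            gcongr; exact hq t ht h1 N
        _ = (2 / s) ^ N * (‖fderiv ℝ h (ray θ' t)‖ * (t * s) ^ N) := by ring
        _ ≤ _ := by gcongr; exact h3.2
  have hmaps : MapsTo (ray θ) (Ioi 0) Hs := fun t ht => ray_im_pos hθ ht
  have hqc : ContinuousOn (fun t : ℝ => (t + t⁻¹) ^ N) (Ioi 0) :=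
    ContinuousOn.pow (continuousOn_id.add (continuousOn_inv₀.mono fun t ht => ne_of_gt ht)) N
  have c1 : ContinuousOn (fun t => ‖f (ray θ t)‖ * (t + t⁻¹) ^ N) (Ioi 0) :=
    ((hf.contDiffOn.continuousOn.comp (continuous_ray θ).continuousOn hmaps).norm).mul hqc
  have c2 : ContinuousOn (fun t => ‖fderiv ℝ f (ray θ t)‖ * (t + t⁻¹) ^ N) (Ioi 0) :=
    ((hf.continuousOn_fderiv.comp (continuous_ray θ).continuousOn hmaps).norm).mul hqc
  obtain ⟨C, A, h1⟩ := key hf θ rfl N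
  -- The chain rule for `z ↦ -1 / z` costs a factor `t⁻²` in the gradient; this is why the exponent
  -- is `N + 2`.
  obtain ⟨C', A', h2⟩ := key (hf.comp_mob hS) (Real.pi - θ) hs' (N + 2)
  have hback : ∀ t, f (ray θ t) = (f ∘ mob matS) (ray (Real.pi - θ) t⁻¹) := by
    intro t
    rw [← mob_matS_ray, Function.comp, mob_matS_mob_matS]
  have hC0 : ∀ t : ℝ, 0 < t → A' ≤ t⁻¹ → ‖f (ray θ t)‖ * (t + t⁻¹) ^ N ≤ C' := by
    intro t ht hA
    have h3 := (h2 t⁻¹ (inv_pos.2 ht) hA).2.1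
    have h4 := (h2 t⁻¹ (inv_pos.2 ht) hA).1
    rw [← hback, inv_inv, add_comm] at h3
    refine le_trans ?_ h3
    gcongr
    · linarith
    · omega
  have hD0 : ∀ t : ℝ, 0 < t → A' ≤ t⁻¹ → ‖fderiv ℝ f (ray θ t)‖ * (t + t⁻¹) ^ N ≤ C' := by
    intro t ht hA
    have h3 := (h2 t⁻¹ (inv_pos.2 ht) hA).2.2
    have h4 := hf.norm_fderiv_le_inv (ray_im_pos hθ ht)
    rw [mob_matS_ray] at h4
    have h5 : ‖ray θ t‖ = t := by
      rw [ray, norm_mul, norm_exp_ofReal_mul_I, norm_real, Real.norm_of_nonneg ht.le, mul_one]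
    rw [h5] at h4
    rw [inv_inv, add_comm] at h3
    calc _ ≤ ‖fderiv ℝ (f ∘ mob matS) (ray (Real.pi - θ) t⁻¹)‖ * t⁻¹ ^ 2 * (t + t⁻¹) ^ N := by
          gcongr
      _ ≤ ‖fderiv ℝ (f ∘ mob matS) (ray (Real.pi - θ) t⁻¹)‖ * (t + t⁻¹) ^ 2 * (t + t⁻¹) ^ N := by
          gcongr
          linarith
      _ = ‖fderiv ℝ (f ∘ mob matS) (ray (Real.pi - θ) t⁻¹)‖ * (t + t⁻¹) ^ (N + 2) := by ring
      _ ≤ C' := h3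
  obtain ⟨K, hK⟩ := exists_bound_Ioi c1 (fun t ht hA => (h1 t ht hA).2.1) hC0
  obtain ⟨K', hK'⟩ := exists_bound_Ioi c2 (fun t ht hA => (h1 t ht hA).2.2) hD0
  exact ⟨max K K', fun t ht => ⟨(hK t ht).trans (le_max_left _ _),
    (hK' t ht).trans (le_max_right _ _)⟩⟩

/-! ### Sectors and the period integral along a ray -/

/-- The sector `|arg ζ| < θ`. -/
def sector (θ : ℝ) : Set ℂ := {ζ | Real.cos θ * |ζ.im| < ζ.re * Real.sin θ}

lemma isOpen_sector (θ : ℝ) : IsOpen (sector θ) :=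
  isOpen_lt (continuous_const.mul continuous_im.abs) (continuous_re.mul continuous_const)

lemma ofReal_mem_sector {θ x : ℝ} (hθ : 0 < Real.sin θ) (hx : 0 < x) : (x : ℂ) ∈ sector θ := by
  simp [sector]; positivity

lemma starConvex_sector {θ : ℝ} (hθ : 0 < Real.sin θ) : StarConvex ℝ 1 (sector θ) := by
  intro ζ hζ a b ha hb hab
  simp only [sector, mem_ofPred_eq] at hζ ⊢
  simp only [add_re, add_im, real_smul, mul_re, mul_im, ofReal_re, ofReal_im,
    zero_mul, sub_zero, add_zero, zero_add, mul_one]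
  rw [abs_mul, abs_of_nonneg hb]
  rcases hb.eq_or_lt with rfl | hb
  · have : a = 1 := by linarith
    subst this
    simpa using hθ
  · nlinarith [mul_lt_mul_of_pos_left hζ hb, mul_nonneg ha hθ.le]

lemma ray_notMem_sector {θ t : ℝ} (hθ : 0 < Real.sin θ) (ht : 0 < t) : ray θ t ∉ sector θ := by
  simp only [sector, mem_ofPred_eq, ray_re, ray_im, abs_of_pos (mul_pos ht hθ)]
  rw [not_lt]
  exact le_of_eq (by ring)

lemma conj_mem_sector {θ : ℝ} {ζ : ℂ} : (starRingEnd ℂ) ζ ∈ sector θ ↔ ζ ∈ sector θ := by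
  simp [sector]

/-- At the height of the ray point `z`, the sector lies strictly to the right of `z`, so `ζ - z`
cannot be a nonpositive real. The conjugate case follows by symmetry of the sector. -/
lemma poissonAdm_ray {θ t : ℝ} {ζ : ℂ} (hθ : 0 < Real.sin θ) (ht : 0 < t)
    (hζ : ζ ∈ sector θ) : PoissonAdm ζ (ray θ t) := by
  have him := ray_im_pos hθ ht
  have key : ∀ ζ : ℂ, ζ ∈ sector θ → ζ - ray θ t ∈ slitPlane := by
    intro ζ hζ
    rw [mem_slitPlane_iff]
    by_contra! h
    obtain ⟨h1, h2⟩ := h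
    simp only [sub_re, sub_im] at h1 h2
    have h2' : ζ.im = t * Real.sin θ := by rw [← ray_im]; linarith
    simp only [sector, mem_ofPred_eq] at hζ
    rw [h2', abs_of_pos (mul_pos ht hθ)] at hζ
    rw [ray_re] at h1
    nlinarith
  refine ⟨him, key ζ hζ, ?_⟩
  have := key _ (conj_mem_sector.2 hζ)
  rw [mem_slitPlane_iff] at this ⊢
  simp only [sub_re, sub_im, conj_re, conj_im] at this ⊢
  exact this.imp_right fun h1 h2 => h1 (by linarith)

/-- The integral of the period form over the ray of angle `θ`. -/
def rayInt (θ : ℝ) (β : ℂ) (f : ℂ → ℂ) (ζ : ℂ) : ℂ :=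
  ∫ t in Ioi (0 : ℝ), form f (poissonPow β ζ) (ray θ t) (exp (θ * I))

lemma periodInt_eq_rayInt {β : ℂ} {u : ℍ → ℂ} {f : ℂ → ℂ} (hf : IsRapid β f)
    (hu : EqOn (ext u) f Hs) {ζ : ℂ} (hθ : 0 < Real.sin (rayAngle ζ))
    (hζ : ζ ∈ sector (rayAngle ζ)) :
    periodInt β u ζ = rayInt (rayAngle ζ) β f ζ := by
  refine setIntegral_congr_fun measurableSet_Ioi fun t ht => ?_
  have hz := ray_im_pos hθ ht
  have hev := hu.eventuallyEq_of_mem (isOpen_Hs.mem_nhds hz)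
  have e := eta_eq_form (hev.differentiableAt_iff.2 (hf.differentiableAt hz))
    (analyticAt_poissonPow (β := β) (poissonAdm_ray hθ ht hζ)).differentiableAt
    (exp (rayAngle ζ * I))
  rw [form_congr hev EventuallyEq.rfl] at e
  exact e

/-- An integrable majorant of the period form on a ray, locally uniform in `ζ`. -/
lemma IsRapid.norm_form_ray_le {β : ℂ} {f : ℂ → ℂ} (hf : IsRapid β f) {θ : ℝ}
    (hθ : 0 < Real.sin θ) {ζ₀ : ℂ} {ε : ℝ} (hε : 0 < ε)
    (hb : Metric.ball ζ₀ (2 * ε) ⊆ sector θ) :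
    ∃ C, ∀ ζ ∈ Metric.ball ζ₀ ε, ∀ t, 0 < t →
      ‖form f (poissonPow β ζ) (ray θ t) (exp (θ * I))‖ ≤ C * (1 + t ^ 2)⁻¹ := by
  obtain ⟨M, hM⟩ := exists_nat_ge |β.re|
  -- With `q = t + t⁻¹`, the three powers in the kernel cost `q ^ (3 M)`, its logarithmic derivative
  -- costs one more `q`, and `q⁻²` is left over as an integrable majorant.
  obtain ⟨C, hC⟩ := hf.decay_ray hθ (3 * M + 3)
  -- `E` bounds the contribution of the argument to each complex power. `L` is chosen so that `im
  -- z`, `‖ζ - z‖` and `‖ζ - z̄‖` all lie between `(L q)⁻¹` and `L q`.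
  set E : ℝ := Real.exp (Real.pi * |β.im|) with hE
  set L : ℝ := max (max ε⁻¹ (‖ζ₀‖ + ε + 1)) (Real.sin θ)⁻¹ with hL
  have hL1 : ε⁻¹ ≤ L := (le_max_left _ _).trans (le_max_left _ _)
  have hL2 : ‖ζ₀‖ + ε + 1 ≤ L := (le_max_right _ _).trans (le_max_left _ _)
  have hL3 : (Real.sin θ)⁻¹ ≤ L := le_max_right _ _
  have hL4 : 1 ≤ L := by linarith [norm_nonneg ζ₀]
  have hL0 : 0 < L := by linarith
  refine ⟨E ^ 2 * L ^ (3 * M) * (C + 3 * ‖β‖ * L * C), fun ζ hζ t ht => ?_⟩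
  set q : ℝ := t + t⁻¹ with hq
  have hti : 0 < t⁻¹ := inv_pos.2 ht
  have hq0 : 0 < q := by positivity
  have hq2 : 2 ≤ q := by
    have : t * t⁻¹ = 1 := mul_inv_cancel₀ ht.ne'
    nlinarith [sq_nonneg (t - t⁻¹)]
  have hQ1 : 1 ≤ L * q := by nlinarith
  have hQ0 : 0 < L * q := by positivity
  have hQε : (L * q)⁻¹ ≤ ε := by
    rw [mul_inv]
    have h1 : L⁻¹ ≤ ε := inv_le_of_inv_le₀ hε hL1
    have h2 : q⁻¹ ≤ 1 := inv_le_one_of_one_le₀ (by linarith)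
    calc _ ≤ ε * 1 := by gcongr
      _ = ε := mul_one ε
  set z := ray θ t with hz
  have hzim := ray_im_pos hθ ht
  have hζs : ζ ∈ sector θ := hb (Metric.ball_subset_ball (by linarith) hζ)
  have hadm := poissonAdm_ray hθ ht hζs
  have hzn : ‖z‖ = t := by
    rw [hz, ray, norm_mul, norm_exp_ofReal_mul_I, norm_real, Real.norm_of_nonneg ht.le, mul_one]
  have hζn : ‖ζ‖ ≤ ‖ζ₀‖ + ε := by
    rw [Metric.mem_ball, dist_eq] at hζ
    have := norm_add_le ζ₀ (ζ - ζ₀)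
    rw [add_sub_cancel] at this
    linarith
  have hup : ∀ w : ℂ, ‖w‖ = t → ‖ζ - w‖ ≤ L * q := by
    intro w hw
    refine (norm_sub_le _ _).trans ?_
    rw [hw]
    nlinarith [norm_nonneg ζ]
  have hlow : ∀ w : ℂ, w ∉ sector θ → ε ≤ ‖ζ - w‖ := by
    intro w hw
    by_contra! h
    refine hw (hb ?_)
    rw [Metric.mem_ball, dist_eq] at hζ ⊢
    have := norm_sub_le (ζ - ζ₀) (ζ - w)
    rw [sub_sub_sub_cancel_left] at this
    linarith
  have hz1 := ray_notMem_sector hθ ht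
  have hz2 : (starRingEnd ℂ) z ∉ sector θ := fun h => hz1 (conj_mem_sector.1 h)
  have l1 := hlow z hz1
  have l2 := hlow _ hz2
  have u1 := hup z hzn
  have u2 := hup ((starRingEnd ℂ) z) (by rw [RCLike.norm_conj, hzn])
  have l0 : (L * q)⁻¹ ≤ z.im := by
    rw [hz, ray_im, mul_inv, mul_comm]
    have h1 : L⁻¹ ≤ Real.sin θ := inv_le_of_inv_le₀ hθ hL3
    have h2 : q⁻¹ ≤ t := inv_le_of_inv_le₀ ht (by linarith)
    gcongr
  have u0 : z.im ≤ L * q := by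
    have := abs_im_le_norm z
    rw [hzn, abs_of_pos hzim] at this
    nlinarith
  have hcpow : ∀ w : ℂ, ε ≤ ‖w‖ → ‖w‖ ≤ L * q → ‖w ^ (-β)‖ ≤ (L * q) ^ M * E := by
    intro w h1 h2
    refine (norm_cpow_le _ _).trans ?_
    rw [div_eq_mul_inv, ← Real.exp_neg]
    gcongr
    · refine rpow_le_pow_of_le hQ1 (by simpa using hM) (hQε.trans h1) h2
    · rw [neg_im, mul_neg, neg_neg]
      refine Real.exp_le_exp.2 ((le_abs_self _).trans ?_)
      rw [abs_mul]
      gcongr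
      exact abs_arg_le_pi w
  have hp : ‖poissonPow β ζ z‖ ≤ E ^ 2 * (L * q) ^ (3 * M) := by
    have h0 : ‖(z.im : ℂ) ^ β‖ ≤ (L * q) ^ M := by
      rw [norm_cpow_eq_rpow_re_of_pos hzim]
      exact rpow_le_pow_of_le hQ1 hM l0 u0
    rw [poissonPow, norm_mul, norm_mul]
    calc _ ≤ (L * q) ^ M * ((L * q) ^ M * E) * ((L * q) ^ M * E) := by
          gcongr
          exacts [hcpow _ l1 u1, hcpow _ l2 u2]
      _ = E ^ 2 * (L * q) ^ (3 * M) := by ring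
  have hdp := norm_fderiv_poissonPow_le (β := β) hadm (d := (L * q)⁻¹) (by positivity) l0
    (hQε.trans l1) (hQε.trans l2)
  rw [div_inv_eq_mul] at hdp
  have h2 := hC t ht
  have hqi : q⁻¹ ^ 2 ≤ (1 + t ^ 2)⁻¹ := by
    rw [inv_pow]
    have : t * t⁻¹ = 1 := mul_inv_cancel₀ ht.ne'
    gcongr
    nlinarith [sq_nonneg t⁻¹]
  have hfz : ‖f z‖ * q ^ (3 * M + 1) ≤ C * q⁻¹ ^ 2 := by
    rw [inv_pow, ← div_eq_mul_inv, le_div_iff₀ (by positivity), mul_assoc, ← pow_add]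
    exact h2.1
  have hC0 : 0 ≤ C := by
    refine le_trans ?_ h2.1
    positivity
  have hdz : ‖fderiv ℝ f z‖ * q ^ (3 * M) ≤ C * q⁻¹ ^ 2 := by
    rw [inv_pow, ← div_eq_mul_inv, le_div_iff₀ (by positivity), mul_assoc, ← pow_add]
    refine le_trans ?_ h2.2
    gcongr
    · linarith
    · omega
  calc ‖form f (poissonPow β ζ) z (exp (θ * I))‖
      ≤ (‖poissonPow β ζ z‖ * ‖fderiv ℝ f z‖ +
          ‖f z‖ * (‖poissonPow β ζ z‖ * ‖β‖ * (3 * (L * q)))) * 1 := by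
        rw [← norm_exp_ofReal_mul_I θ]
        refine (MaassPeriod.norm_form_le _ _ _ _).trans ?_
        gcongr
    _ = ‖poissonPow β ζ z‖ * (‖fderiv ℝ f z‖ + 3 * ‖β‖ * L * (‖f z‖ * q)) := by ring
    _ ≤ (E ^ 2 * (L * q) ^ (3 * M)) * (‖fderiv ℝ f z‖ + 3 * ‖β‖ * L * (‖f z‖ * q)) := by gcongr
    _ = E ^ 2 * L ^ (3 * M) *
        (‖fderiv ℝ f z‖ * q ^ (3 * M) + 3 * ‖β‖ * L * (‖f z‖ * q ^ (3 * M + 1))) := by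
        rw [mul_pow]; ring
    _ ≤ E ^ 2 * L ^ (3 * M) * (C * q⁻¹ ^ 2 + 3 * ‖β‖ * L * (C * q⁻¹ ^ 2)) := by gcongr
    _ = E ^ 2 * L ^ (3 * M) * (C + 3 * ‖β‖ * L * C) * q⁻¹ ^ 2 := by ring
    _ ≤ _ := by gcongr

lemma IsRapid.continuousOn_form_ray {β : ℂ} {f : ℂ → ℂ} (hf : IsRapid β f) {θ : ℝ}
    (hθ : 0 < Real.sin θ) {ζ : ℂ} (hζ : ζ ∈ sector θ) :
    ContinuousOn (fun t => form f (poissonPow β ζ) (ray θ t) (exp (θ * I))) (Ioi 0) := by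
  intro t ht
  have ha := analyticAt_poissonPow (β := β) (poissonAdm_ray hθ ht hζ)
  have hz := ray_im_pos hθ ht
  have r := (continuous_ray θ).continuousAt (x := t)
  have c1 : ContinuousAt (fun t => poissonPow β ζ (ray θ t)) t :=
    ContinuousAt.comp (g := poissonPow β ζ) ha.continuousAt r
  have c2 : ContinuousAt (fun t => fderiv ℝ (poissonPow β ζ) (ray θ t)) t :=
    ContinuousAt.comp (g := fderiv ℝ (poissonPow β ζ)) ha.fderiv.continuousAt r
  have c3 : ContinuousAt (fun t => f (ray θ t)) t :=
    ContinuousAt.comp (g := f) (hf.analytic _ hz).continuousAt r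
  have c4 : ContinuousAt (fun t => fderiv ℝ f (ray θ t)) t :=
    ContinuousAt.comp (g := fderiv ℝ f) (hf.analytic _ hz).fderiv.continuousAt r
  simp only [form_apply]
  exact ((c1.mul (c4.clm_apply continuousAt_const)).sub
    (c3.mul (c2.clm_apply continuousAt_const))).continuousWithinAt

lemma IsRapid.integrableOn_form_ray {β : ℂ} {f : ℂ → ℂ} (hf : IsRapid β f) {θ : ℝ}
    (hθ : 0 < Real.sin θ) {ζ : ℂ} (hζ : ζ ∈ sector θ) :
    IntegrableOn (fun t => form f (poissonPow β ζ) (ray θ t) (exp (θ * I))) (Ioi 0) := by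
  obtain ⟨ε, hε, hb⟩ := Metric.isOpen_iff.1 (isOpen_sector θ) ζ hζ
  obtain ⟨C, hC⟩ := hf.norm_form_ray_le hθ (half_pos hε) (by rwa [mul_div_cancel₀ _ two_ne_zero])
  refine Integrable.mono' ((integrable_inv_one_add_sq.const_mul C).integrableOn)
    ((hf.continuousOn_form_ray hθ hζ).aestronglyMeasurable measurableSet_Ioi) ?_
  filter_upwards [ae_restrict_mem measurableSet_Ioi] with t ht
  exact hC ζ (Metric.mem_ball_self (half_pos hε)) t ht

/-! ### Period integrals as differences of cusp values -/

/-- The limit at `0` is stated through `s⁻¹` with `s → ∞`, the form in which cusp limits arise. The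
value of `H` at `0` is arbitrary and is replaced by that limit. -/
lemma integral_Ioi_eq_sub_of_tendsto {H h : ℝ → ℂ} {a b : ℂ}
    (hd : ∀ t ∈ Ioi (0 : ℝ), HasDerivAt H (h t) t) (hi : IntegrableOn h (Ioi 0))
    (ha : Tendsto H atTop (𝓝 a)) (hb : Tendsto (fun s => H s⁻¹) atTop (𝓝 b)) :
    ∫ t in Ioi 0, h t = a - b := by
  have hb' : Tendsto H (𝓝[>] 0) (𝓝 b) := by
    have := hb.comp tendsto_inv_nhdsGT_zero
    simpa [Function.comp_def] using this
  have hev : ∀ t ∈ Ioi (0 : ℝ), H =ᶠ[𝓝 t] Function.update H 0 b := by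
    intro t ht
    filter_upwards [isOpen_Ioi.mem_nhds ht] with s hs
    rw [Function.update_of_ne (ne_of_gt hs)]
  have := integral_Ioi_of_hasDerivAt_of_tendsto (f := Function.update H 0 b) (f' := h) (a := 0)
    (m := a) ?_ (fun t ht => (hd t ht).congr_of_eventuallyEq (hev t ht).symm) hi ?_
  · simpa using this
  · rw [continuousWithinAt_update_same]
    convert hb' using 2
    ext t
    simp [lt_iff_le_and_ne, eq_comm]
  · refine ha.congr' ?_
    filter_upwards [eventually_gt_atTop 0] with t ht
    rw [Function.update_of_ne ht.ne']

lemma hasDerivAt_ray (θ t : ℝ) : HasDerivAt (ray θ) (exp (θ * I)) t := by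
  exact ((ofRealCLM.hasDerivAt (x := t)).mul_const (exp (θ * I))).congr_deriv (by simp)

/-- The inversion turns the end of the ray at `0` into a ray going to `i∞`, so the two end points
are the cusps `∞` and `0 = S(∞)`. The value does not depend on `θ`. -/
lemma rayInt_eq_cuspLim {β : ℂ} {f : ℂ → ℂ} (hf : IsRapid β f) {x : ℝ} (hx : 0 < x) {F : ℂ → ℂ}
    (hF : IsPrimitive β f x F) {θ : ℝ} (hθ : 0 < Real.sin θ) :
    rayInt θ β f x = cuspLim F 1 - cuspLim F matS := by
  have hw : 0 < (exp (θ * I)).im := by rwa [exp_ofReal_mul_I_im]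
  have hw' : 0 < (exp ((Real.pi - θ : ℝ) * I)).im := by
    rwa [exp_ofReal_mul_I_im, Real.sin_pi_sub]
  refine integral_Ioi_eq_sub_of_tendsto (H := fun t => F (ray θ t)) (fun t ht => ?_)
    (hf.integrableOn_form_ray hθ (ofReal_mem_sector hθ hx)) ?_ ?_
  · exact (hF _ (ray_im_pos hθ ht)).comp_hasDerivAt t (hasDerivAt_ray θ t)
  · have := hF.tendsto_cuspLim hf (g := 1) (by simp) (by simp) 0 hw
    simpa [ray] using this
  · have := hF.tendsto_cuspLim hf (g := matS) (by simp [det_matS])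
      (by simpa [matS] using hx.ne') 0 hw'
    refine this.congr fun s => ?_
    have e : ((0 : ℝ) : ℂ) + s * exp ((Real.pi - θ : ℝ) * I) = ray (Real.pi - θ) s := by simp [ray]
    rw [e, mob_matS_ray, sub_sub_cancel]

lemma mob_mul_adjugate {h : Matrix (Fin 2) (Fin 2) ℤ} (hh : 0 < h.det) {z : ℂ} (hz : 0 < z.im) :
    mob h (mob h.adjugate z) = z := by
  have hadj : 0 < h.adjugate.det := by rw [Matrix.det_adjugate]; simpa using hh
  have : (h.det : ℂ) ≠ 0 := by exact_mod_cast hh.ne'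
  rw [mob_mob_of_pos hadj hz, Matrix.mul_adjugate]
  simp [mob]
  field_simp

lemma slash_factor (β : ℂ) {D r : ℝ} (hD : 0 < D) (hr : 0 < r) :
    ((D / r ^ 2 : ℝ) : ℂ) ^ β = (D : ℂ) ^ β * (r : ℂ) ^ (-2 * β) := by
  have hr0 : (r : ℂ) ≠ 0 := by exact_mod_cast hr.ne'
  rw [ofReal_div, div_cpow_ofReal_nonneg hD.le (by positivity), sq, ofReal_mul,
    mul_cpow_ofReal_nonneg hr.le hr.le, ← cpow_add _ _ hr0, div_eq_mul_inv, ← cpow_neg]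
  congr 2
  ring

/-- A nonnegative matrix of positive determinant. -/
def IsNonneg (h : Matrix (Fin 2) (Fin 2) ℤ) : Prop := 0 < h.det ∧ ∀ i j, 0 ≤ h i j

lemma IsNonneg.add_pos {h : Matrix (Fin 2) (Fin 2) ℤ} (hh : IsNonneg h) {x : ℝ} (hx : 0 < x)
    (i : Fin 2) : 0 < (h i 0 : ℝ) * x + h i 1 := by
  have h0 : (0 : ℝ) ≤ h i 0 := by exact_mod_cast hh.2 i 0
  have h1 : (0 : ℝ) ≤ h i 1 := by exact_mod_cast hh.2 i 1
  rcases h0.eq_or_lt with e | h0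
  · rcases h1.eq_or_lt with e' | h1
    · exfalso
      have e0 : h i 0 = 0 := by exact_mod_cast e.symm
      have e1 : h i 1 = 0 := by exact_mod_cast e'.symm
      refine hh.1.ne' (Matrix.det_eq_zero_of_row_eq_zero i fun j => ?_)
      fin_cases j <;> assumption
    · positivity
  · positivity

/-- The slash action of a nonnegative matrix moves the end points of the period integral. -/
lemma slash_rayInt_eq_cuspLim {β : ℂ} {f V : ℂ → ℂ} (hf : IsRapid β f)
    {h : Matrix (Fin 2) (Fin 2) ℤ} (hh : IsNonneg h) (hV : EqOn (f ∘ mob h) V Hs) {x : ℝ}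
    (hx : 0 < x) {F : ℂ → ℂ} (hF : IsPrimitive β V x F) :
    slash β h (rayInt (Real.pi / 2) β f) x =
      cuspLim F h.adjugate - cuspLim F (h.adjugate * matS) := by
  have hθ : 0 < Real.sin (Real.pi / 2) := by simp
  have hVr : IsRapid β V := (hf.comp_mob hh.1).congr hV
  have hadj : 0 < h.adjugate.det := by rw [Matrix.det_adjugate]; simpa using hh.1
  have hadjS : 0 < (h.adjugate * matS).det := by rw [Matrix.det_mul, det_matS, mul_one]; exact hadj
  have hr := hh.add_pos hx 1
  have ha := hh.add_pos hx 0
  have hD : (0 : ℝ) < h.det := by exact_mod_cast hh.1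
  -- The adjugate plays the role of `h⁻¹`, since the two define the same Möbius map. The cusps
  -- `h⁻¹∞` and `h⁻¹0` are nonpositive or infinite because `h` is nonnegative, so neither is `x >
  -- 0`.
  have hx1 : (h.adjugate 0 0 : ℝ) - h.adjugate 1 0 * x ≠ 0 := by
    rw [Matrix.adjugate_fin_two]
    simp
    linarith
  have hx2 : ((h.adjugate * matS) 0 0 : ℝ) - (h.adjugate * matS) 1 0 * x ≠ 0 := by
    rw [Matrix.adjugate_fin_two]
    simp [matS]
    linarith
  set y : ℝ := ((h 0 0 : ℝ) * x + h 0 1) / ((h 1 0 : ℝ) * x + h 1 1) with hy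
  have hy0 : 0 < y := div_pos ha hr
  have hs : slash β h (rayInt (Real.pi / 2) β f) x =
      (((h.det : ℝ) / ((h 1 0 : ℝ) * x + h 1 1) ^ 2 : ℝ) : ℂ) ^ β *
        rayInt (Real.pi / 2) β f y := by
    rw [slash_factor β hD hr, slash, abs_of_pos hh.1, hy]
    simp only [ofReal_div, ofReal_add, ofReal_mul, ofReal_intCast]
  rw [hs, rayInt, ← integral_const_mul]
  refine integral_Ioi_eq_sub_of_tendsto (H := fun t => F (mob h.adjugate (ray (Real.pi / 2) t)))
    (fun t ht => ?_) ?_ ?_ ?_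
  · have hz := ray_im_pos hθ ht
    have h1 := (hF.hasFDerivAt_comp_mob hVr hadj hx1 hz).comp_hasDerivAt t
      (hasDerivAt_ray (Real.pi / 2) t)
    refine h1.congr_deriv ?_
    have e1 : (h.adjugate.det : ℝ) / ((h.adjugate 0 0 : ℝ) - h.adjugate 1 0 * x) ^ 2 =
        (h.det : ℝ) / ((h 1 0 : ℝ) * x + h 1 1) ^ 2 := by
      rw [Matrix.det_adjugate, Matrix.adjugate_fin_two]
      simp
      ring
    have e2 : ((h.adjugate 1 1 : ℝ) * x - h.adjugate 0 1) /
        ((h.adjugate 0 0 : ℝ) - h.adjugate 1 0 * x) = y := by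
      rw [Matrix.adjugate_fin_two, hy]
      simp
      congr 1
      ring
    have e3 : V ∘ mob h.adjugate =ᶠ[𝓝 (ray (Real.pi / 2) t)] f := by
      filter_upwards [isOpen_Hs.mem_nhds hz] with w hw
      rw [Function.comp, ← hV (mob_mem_Hs hadj hw), Function.comp, mob_mul_adjugate hh.1 hw]
    rw [e1, e2, form_congr e3 EventuallyEq.rfl]
    rfl
  · exact (hf.integrableOn_form_ray hθ (ofReal_mem_sector hθ hy0)).const_mul _
  · have := hF.tendsto_cuspLim hVr hadj hx1 0 (w := exp ((Real.pi / 2 : ℝ) * I))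
      (by rw [exp_ofReal_mul_I_im]; exact hθ)
    simpa [ray] using this
  · have := hF.tendsto_cuspLim hVr hadjS hx2 0 (w := exp ((Real.pi / 2 : ℝ) * I))
      (by rw [exp_ofReal_mul_I_im]; exact hθ)
    refine this.congr' ?_
    filter_upwards [eventually_gt_atTop 0] with s hs
    have hz := ray_im_pos hθ hs
    have e : ((0 : ℝ) : ℂ) + s * exp ((Real.pi / 2 : ℝ) * I) = ray (Real.pi / 2) s := by simp [ray]
    rw [e, ← mob_mob_of_pos (by simp [det_matS]) hz, mob_matS_ray]
    congr 3
    ring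

/-- The telescoping sum along a chain of nonnegative matrices. -/
lemma sum_slash_rayInt {β : ℂ} {f : ℕ → ℂ → ℂ} {V : ℂ → ℂ} (hf : ∀ s, IsRapid β (f s))
    {h : ℕ → Matrix (Fin 2) (Fin 2) ℤ} {K : ℕ} (hh : ∀ s ≤ K, IsNonneg (h s))
    (hV : ∀ s ≤ K, EqOn (f s ∘ mob (h s)) V Hs) (h0 : h 0 1 0 = 0) (hK : h K 0 1 = 0)
    (hstep : ∀ s < K, ∃ k : ℤ, h (s + 1) = !![k, -1; 1, 0] * h s) {x : ℝ} (hx : 0 < x) :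
    ∑ s ∈ Finset.range (K + 1), slash β (h s) (rayInt (Real.pi / 2) β (f s)) x =
      rayInt (Real.pi / 2) β V x := by
  have hVr : IsRapid β V := ((hf 0).comp_mob (hh 0 K.zero_le).1).congr (hV 0 K.zero_le)
  obtain ⟨F, hF⟩ := hVr.exists_isPrimitive x
  have hadj : ∀ s ≤ K, 0 < (h s).adjugate.det := fun s hs => by
    rw [Matrix.det_adjugate]; simpa using (hh s hs).1
  have hadjS : ∀ s ≤ K, 0 < ((h s).adjugate * matS).det := fun s hs => by
    rw [Matrix.det_mul, det_matS, mul_one]; exact hadj s hs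
  have key : ∀ k ≤ K, ∑ s ∈ Finset.range (k + 1), slash β (h s) (rayInt (Real.pi / 2) β (f s)) x =
      cuspLim F 1 - cuspLim F ((h k).adjugate * matS) := by
    intro k
    induction k with
    | zero =>
      intro hk
      rw [Finset.sum_range_one, slash_rayInt_eq_cuspLim (hf 0) (hh 0 hk) (hV 0 hk) hx hF]
      congr 1
      have := hF.cuspLim_mul_upper hVr (g := 1) (B := (h 0).adjugate) (by simp) (by simp)
        (hadj 0 hk) (by rw [Matrix.adjugate_fin_two]; simp [h0])
      rwa [one_mul] at this
    | succ k ih =>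
      intro hk
      rw [Finset.sum_range_succ, ih (by omega),
        slash_rayInt_eq_cuspLim (hf _) (hh _ hk) (hV _ hk) hx hF]
      obtain ⟨c, hc⟩ := hstep k (by omega)
      -- The last factor is upper triangular, so the cusp `h_{k+1}⁻¹∞` is `h_k⁻¹0`: consecutive
      -- terms cancel.
      have e : (h (k + 1)).adjugate = ((h k).adjugate * matS) * !![-1, c; 0, -1] := by
        rw [hc, Matrix.adjugate_mul_distrib, mul_assoc]
        congr 1
        rw [Matrix.adjugate_fin_two]
        ext i j
        fin_cases i <;> fin_cases j <;> simp [matS, Matrix.mul_apply, Fin.sum_univ_two]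
      have hx2 : (((h k).adjugate * matS) 0 0 : ℝ) - ((h k).adjugate * matS) 1 0 * x ≠ 0 := by
        have := (hh k (by omega)).add_pos hx 0
        rw [Matrix.adjugate_fin_two]
        simp [matS]
        linarith
      have := hF.cuspLim_mul_upper hVr (B := !![-1, c; 0, -1]) (hadjS k (by omega)) hx2
        (by simp [Matrix.det_fin_two]) (by simp)
      rw [← e] at this
      rw [this]
      ring
  rw [key K le_rfl, rayInt_eq_cuspLim hVr hx hF (by simp)]
  congr 1
  -- The last matrix is lower triangular and fixes `0`; moving `S` to the left shows that the final
  -- cusp is `S(∞) = 0`.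
  have e : (h K).adjugate * matS = matS * !![h K 0 0, h K 1 0; 0, h K 1 1] := by
    rw [Matrix.adjugate_fin_two]
    ext i j
    fin_cases i <;> fin_cases j <;> simp [matS, Matrix.mul_apply, Fin.sum_univ_two, hK]
  rw [e]
  refine hF.cuspLim_mul_upper hVr (by simp [det_matS]) (by simpa [matS] using hx.ne') ?_ (by simp)
  have := (hh K le_rfl).1
  rw [Matrix.det_fin_two, hK] at this
  simpa [Matrix.det_fin_two] using this

/-! ### Holomorphy of period integrals -/

/-- A bound on the holomorphic integrand suffices: Cauchy's estimate on discs of radius `ε / 4`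
bounds its derivative. Measurability of the derivative comes from writing it as a limit of
difference quotients. -/
lemma differentiableAt_integral_of_bounded {F : ℂ → ℝ → ℂ} {ζ₀ : ℂ} {ε : ℝ} (hε : 0 < ε)
    {bound : ℝ → ℝ} (hb : IntegrableOn bound (Ioi 0))
    (hm : ∀ ζ ∈ Metric.ball ζ₀ ε, AEStronglyMeasurable (F ζ) (volume.restrict (Ioi 0)))
    (hd : ∀ t, 0 < t → DifferentiableOn ℂ (fun ζ => F ζ t) (Metric.ball ζ₀ ε))
    (hF : ∀ ζ ∈ Metric.ball ζ₀ ε, ∀ t, 0 < t → ‖F ζ t‖ ≤ bound t) :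
    DifferentiableAt ℂ (fun ζ => ∫ t in Ioi 0, F ζ t) ζ₀ := by
  have hζ₀ : ζ₀ ∈ Metric.ball ζ₀ ε := Metric.mem_ball_self hε
  have hda : ∀ t, 0 < t → ∀ ζ ∈ Metric.ball ζ₀ ε, DifferentiableAt ℂ (fun ζ => F ζ t) ζ :=
    fun t ht ζ hζ => (hd t ht).differentiableAt (Metric.isOpen_ball.mem_nhds hζ)
  refine (hasDerivAt_integral_of_dominated_loc_of_deriv_le (μ := volume.restrict (Ioi (0 : ℝ)))
    (F := F) (F' := fun ζ t => deriv (fun ζ => F ζ t) ζ) (bound := fun t => bound t / (ε / 4))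
    (Metric.ball_mem_nhds ζ₀ (half_pos hε)) ?_ ?_ ?_ ?_ ?_ ?_).2.differentiableAt
  · filter_upwards [Metric.ball_mem_nhds ζ₀ hε] with ζ hζ using hm ζ hζ
  · refine hb.mono' (hm _ hζ₀) ?_
    filter_upwards [ae_restrict_mem measurableSet_Ioi] with t ht using hF _ hζ₀ t ht
  · have hseq : Tendsto (fun n : ℕ => (((ε / 2) / (n + 1) : ℝ) : ℂ)) atTop (𝓝[≠] 0) := by
      rw [tendsto_nhdsWithin_iff]
      refine ⟨?_, Eventually.of_forall fun n => ?_⟩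
      · have := (tendsto_const_div_atTop_nhds_zero_nat (ε / 2)).comp (tendsto_add_atTop_nat 1)
        have h2 := (continuous_ofReal.tendsto 0).comp this
        simpa [Function.comp_def] using h2
      · rw [mem_compl_singleton_iff, Ne, ofReal_eq_zero]
        positivity
    refine aestronglyMeasurable_of_tendsto_ae (u := (atTop : Filter ℕ)) (f := fun n t =>
      (((ε / 2) / (n + 1) : ℝ) : ℂ)⁻¹ • (F (ζ₀ + (((ε / 2) / (n + 1) : ℝ) : ℂ)) t - F ζ₀ t))
      (fun n => ?_) ?_
    · refine ((hm _ ?_).sub (hm _ hζ₀)).const_smul (_ : ℂ)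
      rw [Metric.mem_ball, dist_eq, add_sub_cancel_left, norm_real,
        Real.norm_of_nonneg (by positivity)]
      have : (ε / 2) / (n + 1) ≤ ε / 2 := div_le_self (by positivity) (by
        linarith [(Nat.cast_nonneg n : (0 : ℝ) ≤ n)])
      linarith
    · filter_upwards [ae_restrict_mem measurableSet_Ioi] with t ht
      exact (hda t ht ζ₀ hζ₀).hasDerivAt.tendsto_slope_zero.comp hseq
  · filter_upwards [ae_restrict_mem measurableSet_Ioi] with t ht ζ hζ
    have hsub : Metric.closedBall ζ (ε / 4) ⊆ Metric.ball ζ₀ ε := by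
      refine Metric.closedBall_subset_ball' ?_
      rw [Metric.mem_ball] at hζ
      linarith
    refine norm_deriv_le_of_forall_mem_sphere_norm_le (by positivity) ?_ fun w hw =>
      hF w (hsub (Metric.sphere_subset_closedBall hw)) t ht
    exact ((hd t ht).mono hsub).diffContOnCl_ball subset_rfl
  · exact hb.div_const _
  · filter_upwards [ae_restrict_mem measurableSet_Ioi] with t ht ζ hζ
    exact (hda t ht ζ (Metric.ball_subset_ball (by linarith) hζ)).hasDerivAt

lemma differentiableAt_form_poissonPow {β z ζ : ℂ} {f : ℂ → ℂ} {U : Set ℂ} (hU : U ∈ 𝓝 ζ)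
    (h : ∀ ζ ∈ U, PoissonAdm ζ z) (w : ℂ) :
    DifferentiableAt ℂ (fun ζ => form f (poissonPow β ζ) z w) ζ := by
  have hζ := h ζ (mem_of_mem_nhds hU)
  have e : (fun ζ => form f (poissonPow β ζ) z w) =ᶠ[𝓝 ζ] fun ζ =>
      poissonPow β ζ z * fderiv ℝ f z (I * w) -
        f z * (poissonPow β ζ z * β * poissonLogDeriv ζ z (I * w)) := by
    filter_upwards [hU] with ξ hξ
    rw [form_apply, (hasFDerivAt_poissonPow (h ξ hξ)).fderiv]
    simp
  refine DifferentiableAt.congr_of_eventuallyEq ?_ e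
  have n1 : ζ - z ≠ 0 := slitPlane_ne_zero hζ.2.1
  have n2 : ζ - (starRingEnd ℂ) z ≠ 0 := slitPlane_ne_zero hζ.2.2
  have d1 : DifferentiableAt ℂ (fun ζ => ζ - z) ζ := differentiableAt_id.sub_const z
  have d2 : DifferentiableAt ℂ (fun ζ => ζ - (starRingEnd ℂ) z) ζ := differentiableAt_id.sub_const _
  have dp : DifferentiableAt ℂ (fun ζ => poissonPow β ζ z) ζ := by
    unfold poissonPow
    exact ((differentiableAt_const _).mul (d1.cpow_const hζ.2.1)).mul (d2.cpow_const hζ.2.2)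
  have dl : DifferentiableAt ℂ (fun ζ => poissonLogDeriv ζ z (I * w)) ζ := by
    simp only [poissonLogDeriv_apply]
    exact ((differentiableAt_const _).add ((differentiableAt_const _).div d1 n1)).add
      ((differentiableAt_const _).div d2 n2)
  exact (dp.mul_const _).sub (((dp.mul_const β).mul dl).const_mul _)

lemma IsRapid.differentiableOn_rayInt {β : ℂ} {f : ℂ → ℂ} (hf : IsRapid β f) {θ : ℝ}
    (hθ : 0 < Real.sin θ) : DifferentiableOn ℂ (rayInt θ β f) (sector θ) := by
  intro ζ₀ hζ₀
  obtain ⟨r, hr, hb⟩ := Metric.isOpen_iff.1 (isOpen_sector θ) ζ₀ hζ₀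
  have hb' : Metric.ball ζ₀ (2 * (r / 2)) ⊆ sector θ := by rwa [mul_div_cancel₀ _ two_ne_zero]
  obtain ⟨C, hC⟩ := hf.norm_form_ray_le hθ (half_pos hr) hb'
  have hsub : Metric.ball ζ₀ (r / 2) ⊆ sector θ :=
    (Metric.ball_subset_ball (by linarith)).trans hb
  refine (differentiableAt_integral_of_bounded (half_pos hr)
    ((integrable_inv_one_add_sq.const_mul C).integrableOn) (fun ζ hζ =>
      (hf.continuousOn_form_ray hθ (hsub hζ)).aestronglyMeasurable measurableSet_Ioi)
    (fun t ht ζ hζ => ?_) hC).differentiableWithinAt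
  exact (differentiableAt_form_poissonPow ((isOpen_sector θ).mem_nhds (hsub hζ))
    (fun ξ hξ => poissonAdm_ray hθ ht hξ) _).differentiableWithinAt

/-- Holomorphic functions on a domain that is star-shaped around `1` agree if they agree on the
positive reals. -/
lemma eqOn_of_eq_on_pos {f g : ℂ → ℂ} {U : Set ℂ} (hU : IsOpen U) (hs : StarConvex ℝ 1 U)
    (h1 : (1 : ℂ) ∈ U) (hf : DifferentiableOn ℂ f U) (hg : DifferentiableOn ℂ g U)
    (h : ∀ x : ℝ, 0 < x → f x = g x) : EqOn f g U := by
  refine (hf.analyticOnNhd hU).eqOn_of_preconnected_of_frequently_eq (hg.analyticOnNhd hU)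
    (hs.isPathConnected h1).isConnected.isPreconnected h1 ?_
  have ht : Tendsto (fun t : ℝ => (t : ℂ)) (𝓝[≠] 1) (𝓝[≠] 1) := by
    rw [tendsto_nhdsWithin_iff]
    refine ⟨?_, ?_⟩
    · have := (continuous_ofReal.tendsto (1 : ℝ)).mono_left (nhdsWithin_le_nhds (s := {1}ᶜ))
      simpa using this
    · filter_upwards [self_mem_nhdsWithin] with t ht
      simpa using ht
  refine ht.frequently (Eventually.frequently ?_)
  filter_upwards [nhdsWithin_le_nhds (isOpen_Ioi.mem_nhds (show (1 : ℝ) ∈ Ioi 0 by simp))] with t ht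
  exact h t ht

/-- At real `x > 0` both integrals equal the difference of cusp values at `∞` and `0`; the identity
theorem does the rest. -/
lemma IsRapid.rayInt_eqOn {β : ℂ} {f : ℂ → ℂ} (hf : IsRapid β f) {θ θ' : ℝ}
    (hθ : 0 < Real.sin θ) (hθ' : 0 < Real.sin θ') :
    EqOn (rayInt θ β f) (rayInt θ' β f) (sector θ ∩ sector θ') := by
  have h1 : ∀ {θ : ℝ}, 0 < Real.sin θ → (1 : ℂ) ∈ sector θ := fun h => by
    simpa using ofReal_mem_sector h one_pos
  refine eqOn_of_eq_on_pos ((isOpen_sector θ).inter (isOpen_sector θ'))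
    ((starConvex_sector hθ).inter (starConvex_sector hθ')) ⟨h1 hθ, h1 hθ'⟩
    ((hf.differentiableOn_rayInt hθ).mono inter_subset_left)
    ((hf.differentiableOn_rayInt hθ').mono inter_subset_right) fun x hx => ?_
  obtain ⟨F, hF⟩ := hf.exists_isPrimitive x
  rw [rayInt_eq_cuspLim hf hx hF hθ, rayInt_eq_cuspLim hf hx hF hθ']

lemma abs_arg_lt_pi_of_mem_slitPlane {ζ : ℂ} (hζ : ζ ∈ slitPlane) : |ζ.arg| < Real.pi :=
  abs_lt.2 ⟨neg_pi_lt_arg ζ, lt_of_le_of_ne (arg_le_pi ζ) (mem_slitPlane_iff_arg.1 hζ).1⟩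

lemma sin_rayAngle_pos {ζ : ℂ} (hζ : ζ ∈ slitPlane) : 0 < Real.sin (rayAngle ζ) := by
  have h1 := abs_arg_lt_pi_of_mem_slitPlane hζ
  rw [rayAngle]
  split_ifs
  · simp
  · exact Real.sin_pos_of_pos_of_lt_pi (by positivity) (by linarith)

/-- Outside the right half plane the ray bisects the angle between `|arg ζ|` and `π`, so its angle
exceeds `|arg ζ|`. -/
lemma mem_sector_rayAngle {ζ : ℂ} (hζ : ζ ∈ slitPlane) : ζ ∈ sector (rayAngle ζ) := by
  have h1 := abs_arg_lt_pi_of_mem_slitPlane hζ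
  rw [rayAngle]
  split_ifs with h
  · simpa [sector] using h
  · have hs : 0 < Real.sin ((Real.pi + |ζ.arg|) / 2 - |ζ.arg|) :=
      Real.sin_pos_of_pos_of_lt_pi (by linarith) (by linarith [abs_nonneg ζ.arg])
    have hn : 0 < ‖ζ‖ := norm_pos_iff.2 (slitPlane_ne_zero hζ)
    have hre : ζ.re = ‖ζ‖ * Real.cos |ζ.arg| := by rw [Real.cos_abs, norm_mul_cos_arg]
    have him : |ζ.im| = ‖ζ‖ * Real.sin |ζ.arg| := by
      rw [← norm_mul_sin_arg, abs_mul, abs_norm, Real.abs_sin_eq_sin_abs_of_abs_le_pi h1.le]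
    rw [Real.sin_sub] at hs
    simp only [sector, mem_ofPred_eq]
    rw [hre, him]
    nlinarith [mul_pos hn hs]

lemma periodInt_eqOn {β : ℂ} {u : ℍ → ℂ} {f : ℂ → ℂ} (hf : IsRapid β f)
    (hu : EqOn (ext u) f Hs) {θ : ℝ} (hθ : 0 < Real.sin θ) :
    EqOn (periodInt β u) (rayInt θ β f) (slitPlane ∩ sector θ) := by
  intro ζ hζ
  rw [periodInt_eq_rayInt hf hu (sin_rayAngle_pos hζ.1) (mem_sector_rayAngle hζ.1)]
  exact hf.rayInt_eqOn (sin_rayAngle_pos hζ.1) hθ ⟨mem_sector_rayAngle hζ.1, hζ.2⟩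

/-- The path in `periodInt` varies with `ζ`, but near a given point it may be frozen, since
admissible angles give equal integrals. -/
lemma differentiableOn_periodInt {β : ℂ} {u : ℍ → ℂ} (hu : IsRapid β (ext u)) :
    DifferentiableOn ℂ (periodInt β u) slitPlane := by
  intro ζ hζ
  have hs := mem_sector_rayAngle hζ
  have hp := sin_rayAngle_pos hζ
  have hd := (hu.differentiableOn_rayInt hp).differentiableAt ((isOpen_sector _).mem_nhds hs)
  refine (hd.congr_of_eventuallyEq ?_).differentiableWithinAt
  exact (periodInt_eqOn hu (fun _ _ => rfl) hp).eventuallyEq_of_mem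
    ((isOpen_slitPlane.inter (isOpen_sector _)).mem_nhds ⟨hζ, hs⟩)

lemma periodInt_ofReal {β : ℂ} {u : ℍ → ℂ} {f : ℂ → ℂ} (hf : IsRapid β f)
    (hu : EqOn (ext u) f Hs) {x : ℝ} (hx : 0 < x) :
    periodInt β u x = rayInt (Real.pi / 2) β f x :=
  periodInt_eqOn hf hu (by simp) ⟨by simpa using hx, ofReal_mem_sector (by simp) hx⟩

/-! ### The slash action on functions on the cut plane -/

lemma IsNonneg.den_mem_slitPlane {h : Matrix (Fin 2) (Fin 2) ℤ} (hh : IsNonneg h) {ζ : ℂ}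
    (hζ : ζ ∈ slitPlane) : (h 1 0 : ℂ) * ζ + (h 1 1 : ℂ) ∈ slitPlane := by
  by_cases him : ζ.im = 0
  · have hx : 0 < ζ.re := by simpa [mem_slitPlane_iff, him] using hζ
    rw [mem_slitPlane_iff]
    left
    simpa using hh.add_pos hx 1
  · by_cases hc : h 1 0 = 0
    · rw [hc, mem_slitPlane_iff]
      left
      simpa [hc] using hh.add_pos one_pos 1
    · rw [mem_slitPlane_iff]
      right
      simp [him, hc]

lemma IsNonneg.mob_ofReal {h : Matrix (Fin 2) (Fin 2) ℤ} (hh : IsNonneg h) {x : ℝ} (hx : 0 < x) :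
    ∃ y : ℝ, 0 < y ∧ mob h x = y :=
  ⟨((h 0 0 : ℝ) * x + h 0 1) / ((h 1 0 : ℝ) * x + h 1 1),
    div_pos (hh.add_pos hx 0) (hh.add_pos hx 1), by simp [mob]⟩

lemma IsNonneg.mob_mem_slitPlane {h : Matrix (Fin 2) (Fin 2) ℤ} (hh : IsNonneg h) {ζ : ℂ}
    (hζ : ζ ∈ slitPlane) : mob h ζ ∈ slitPlane := by
  have hd := slitPlane_ne_zero (hh.den_mem_slitPlane hζ)
  by_cases him : ζ.im = 0
  · have hx : 0 < ζ.re := by simpa [mem_slitPlane_iff, him] using hζ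
    have e : ζ = (ζ.re : ℂ) := by apply Complex.ext <;> simp [him]
    obtain ⟨y, hy, hy'⟩ := hh.mob_ofReal hx
    rw [e, hy']
    simpa using hy
  · rw [mem_slitPlane_iff]
    right
    rw [mob_im hd]
    have := (normSq_pos.2 hd).ne'
    have : (h.det : ℝ) ≠ 0 := by exact_mod_cast hh.1.ne'
    positivity

lemma slash_eq (β : ℂ) (h : Matrix (Fin 2) (Fin 2) ℤ) (f : ℂ → ℂ) (z : ℂ) :
    slash β h f z = ((|h.det| : ℤ) : ℂ) ^ β *
      ((h 1 0 : ℂ) * z + (h 1 1 : ℂ)) ^ (-2 * β) * f (mob h z) := rfl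

lemma slash_congr {β : ℂ} {h : Matrix (Fin 2) (Fin 2) ℤ} (hh : IsNonneg h) {f g : ℂ → ℂ}
    (hfg : EqOn f g slitPlane) : EqOn (slash β h f) (slash β h g) slitPlane := by
  intro ζ hζ
  rw [slash_eq, slash_eq, hfg (hh.mob_mem_slitPlane hζ)]

lemma differentiableOn_slash {β : ℂ} {h : Matrix (Fin 2) (Fin 2) ℤ} (hh : IsNonneg h) {f : ℂ → ℂ}
    (hf : DifferentiableOn ℂ f slitPlane) : DifferentiableOn ℂ (slash β h f) slitPlane := by
  intro ζ hζ
  have hd := hh.den_mem_slitPlane hζ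
  have d1 : DifferentiableAt ℂ (fun z : ℂ => (h 1 0 : ℂ) * z + (h 1 1 : ℂ)) ζ := by fun_prop
  have d2 : DifferentiableAt ℂ (f ∘ mob h) ζ :=
    (hf.differentiableAt (isOpen_slitPlane.mem_nhds (hh.mob_mem_slitPlane hζ))).comp ζ
      (hasDerivAt_mob (slitPlane_ne_zero hd)).differentiableAt
  exact (((d1.cpow_const hd).const_mul _).mul d2).differentiableWithinAt

/-- The period integral as a sum over a chain of nonnegative matrices. -/
lemma sum_slash_periodInt {β : ℂ} {u : ℕ → ℍ → ℂ} {w : ℍ → ℂ} (hu : ∀ s, IsRapid β (ext (u s)))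
    {h : ℕ → Matrix (Fin 2) (Fin 2) ℤ} {K : ℕ} (hh : ∀ s ≤ K, IsNonneg (h s))
    (hw : ∀ s ≤ K, EqOn (ext (u s) ∘ mob (h s)) (ext w) Hs) (h0 : h 0 1 0 = 0) (hK : h K 0 1 = 0)
    (hstep : ∀ s < K, ∃ k : ℤ, h (s + 1) = !![k, -1; 1, 0] * h s) {ζ : ℂ} (hζ : ζ ∈ slitPlane) :
    ∑ s ∈ Finset.range (K + 1), slash β (h s) (periodInt β (u s)) ζ = periodInt β w ζ := by
  have hwr : IsRapid β (ext w) := ((hu 0).comp_mob (hh 0 K.zero_le).1).congr (hw 0 K.zero_le)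
  -- A nonnegative matrix keeps the cut plane and its automorphy factor off the negative axis, so
  -- every term is holomorphic and the identity theorem applies from the positive reals.
  refine eqOn_of_eq_on_pos (f := fun ζ => ∑ s ∈ Finset.range (K + 1),
    slash β (h s) (periodInt β (u s)) ζ) isOpen_slitPlane starConvex_one_slitPlane one_mem_slitPlane
    (DifferentiableOn.fun_sum fun s hs => differentiableOn_slash (hh s (by
      rw [Finset.mem_range] at hs; omega)) (differentiableOn_periodInt (hu s)))
    (differentiableOn_periodInt hwr) (fun x hx => ?_) hζ
  rw [periodInt_ofReal hwr (fun _ _ => rfl) hx, ← sum_slash_rayInt hu hh hw h0 hK hstep hx]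
  refine Finset.sum_congr rfl fun s hs => ?_
  rw [Finset.mem_range] at hs
  obtain ⟨y, hy, hy'⟩ := (hh s (by omega)).mob_ofReal hx
  rw [slash_eq, slash_eq, hy', periodInt_ofReal (hu s) (fun _ _ => rfl) hy]

end

/-! ### Arithmetic of the index set -/

/-- Take for `k` the product of the primes dividing `c` but not `b`. A prime of `c` then divides
exactly one of `b` and `k e`. Reducing `k` modulo `c` changes nothing. -/
lemma exists_lt_gcd_add_mul_eq_one {c b e : ℕ} (hc : 0 < c) (h : Nat.gcd c (Nat.gcd b e) = 1) :
    ∃ k < c, Nat.gcd c (b + k * e) = 1 := by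
  set k₀ : ℕ := ∏ p ∈ c.primeFactors with ¬p ∣ b, p with hk₀
  have key : Nat.Coprime c (b + k₀ * e) := by
    refine Nat.coprime_of_dvd fun p hp hpc hpd => ?_
    have hmem : p ∈ c.primeFactors := Nat.mem_primeFactors.2 ⟨hp, hpc, hc.ne'⟩
    by_cases hb : p ∣ b
    · rcases hp.dvd_mul.1 ((Nat.dvd_add_right hb).1 hpd) with h1 | h1
      · obtain ⟨q, hq, hpq⟩ := (hp.prime.dvd_finsetProd_iff _).1 h1
        rw [Finset.mem_filter] at hq
        have := (Nat.prime_dvd_prime_iff_eq hp (Nat.prime_of_mem_primeFactors hq.1)).1 hpq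
        exact hq.2 (this ▸ hb)
      · exact hp.one_lt.ne' (Nat.dvd_one.1 (h ▸ Nat.dvd_gcd hpc (Nat.dvd_gcd hb h1)))
    · have h1 : p ∣ k₀ := Finset.dvd_prod_of_mem _ (Finset.mem_filter.2 ⟨hmem, hb⟩)
      exact hb ((Nat.dvd_add_left (h1.mul_right e)).1 hpd)
  refine ⟨k₀ % c, Nat.mod_lt _ hc, ?_⟩
  have e1 : b + k₀ * e = (b + k₀ % c * e) + c * (k₀ / c * e) := by
    conv_lhs => rw [← Nat.mod_add_div k₀ c]
    ring
  rw [e1] at key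
  exact (Nat.coprime_add_mul_left_right _ _ _).1 key

/-! ### Pairs and classes modulo `n` -/

lemma cls_eq_iff {n : ℕ} {x y x' y' : ℤ} : cls n x y = cls n x' y' ↔
    ∃ k : ℤ, IsCoprime k (n : ℤ) ∧ x' ≡ k * x [ZMOD n] ∧ y' ≡ k * y [ZMOD n] :=
  Quotient.eq (r := projSetoid n)

lemma dmin_spec {n : ℕ} {p : ℕ × ℕ} (hp : p ∈ pairs n) :
    ∃ k < p.1, Nat.gcd p.1 (p.2 + k * (n / p.1)) = 1 ∧ dmin n p = p.1 + p.2 + k * (n / p.1) := by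
  obtain ⟨k, hk, h⟩ := exists_lt_gcd_add_mul_eq_one hp.1 hp.2.2.2
  exact Nat.sInf_mem (s := {d | ∃ k < p.1, Nat.gcd p.1 (p.2 + k * (n / p.1)) = 1 ∧
    d = p.1 + p.2 + k * (n / p.1)}) ⟨_, k, hk, h, rfl⟩

lemma isCoprime_dmin {n : ℕ} {p : ℕ × ℕ} (hp : p ∈ pairs n) :
    IsCoprime (p.1 : ℤ) (dmin n p : ℤ) := by
  obtain ⟨k, _, h, hd⟩ := dmin_spec hp
  rw [hd, Nat.isCoprime_iff_coprime, add_assoc, Nat.coprime_self_add_right]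
  exact h

/-- After division by the gcd, `x` becomes a unit modulo the cofactor `N`; its inverse lifts to a
unit modulo `n` because reduction of unit groups is surjective. -/
lemma exists_isCoprime_mul_modEq_gcd {n : ℕ} (hn : n ≠ 0) (x : ℤ) :
    ∃ k : ℤ, IsCoprime k (n : ℤ) ∧ (Int.gcd x n : ℤ) ≡ k * x [ZMOD n] := by
  have hg : 0 < Int.gcd x n := Int.gcd_pos_of_ne_zero_right _ (by exact_mod_cast hn)
  obtain ⟨x', n', hcop, hx, hn'⟩ := Int.exists_gcd_one hg
  set g : ℤ := (Int.gcd x n : ℤ) with hgdef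
  have hg' : 0 < g := Int.natCast_pos.2 hg
  have hn'0 : 0 < n' := by
    have : (0 : ℤ) < n := by positivity
    rw [hn'] at this
    exact pos_of_mul_pos_left this hg'.le
  lift n' to ℕ using hn'0.le with N hN
  have hN0 : N ≠ 0 := by rintro rfl; simp at hn'0
  have : NeZero N := ⟨hN0⟩
  have : NeZero n := ⟨hn⟩
  have hdvd : N ∣ n := Int.natCast_dvd_natCast.1 ⟨g, hn'⟩
  have hu : IsUnit ((x' : ℤ) : ZMod N) :=
    (ZMod.coe_int_isUnit_iff_isCoprime x' N).2 ((Int.isCoprime_iff_gcd_eq_one.2 hcop).symm)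
  obtain ⟨w, hw⟩ := ZMod.unitsMap_surjective hdvd hu.unit⁻¹
  refine ⟨((w : ZMod n).val : ℤ), ?_, ?_⟩
  · have h1 : IsUnit ((((w : ZMod n).val : ℤ)) : ZMod n) := by
      rw [Int.cast_natCast, ZMod.natCast_zmod_val]; exact w.isUnit
    exact ((ZMod.coe_int_isUnit_iff_isCoprime _ n).1 h1).symm
  · have h2 : ((((w : ZMod n).val : ℤ) * x' : ℤ) : ZMod N) = ((1 : ℤ) : ZMod N) := by
      have h3 : ((((w : ZMod n).val : ℤ)) : ZMod N) = ((hu.unit⁻¹ : (ZMod N)ˣ) : ZMod N) := by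
        rw [← hw, ZMod.unitsMap_val]
        rw [Int.cast_natCast, ZMod.natCast_val]
      rw [Int.cast_mul, Int.cast_one, h3]
      exact hu.val_inv_mul
    rw [ZMod.intCast_eq_intCast_iff, Int.modEq_iff_dvd] at h2
    obtain ⟨t, ht⟩ := h2
    rw [Int.modEq_iff_dvd]
    refine ⟨-t, ?_⟩
    rw [hn']
    nth_rewrite 1 [hx]
    linear_combination (-g) * ht

/-- Rescale the class so that its first entry is `c = gcd(x, n)`. The remaining freedom, multipliers
`≡ 1` modulo `e = n / c`, changes the second entry by multiples of `e`, so only its residue matters.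
-/
lemma exists_mem_pairs {n : ℕ} [NeZero n] (i : Idx n) :
    ∃ p, p ∈ pairs n ∧ cls n p.1 (dmin n p) = i.1 := by
  have hn : n ≠ 0 := NeZero.ne n
  obtain ⟨q, g, hq⟩ := i
  subst hq
  set x := (g : Matrix (Fin 2) (Fin 2) ℤ) 1 0 with hxdef
  set y := (g : Matrix (Fin 2) (Fin 2) ℤ) 1 1 with hydef
  have hxy : IsCoprime x y := by
    have hu : IsUnit (g : Matrix (Fin 2) (Fin 2) ℤ).det := by
      rw [← Matrix.isUnit_iff_isUnit_det]; exact g.isUnit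
    obtain ⟨w, hw⟩ := hu
    rw [Matrix.det_fin_two] at hw
    refine ⟨-((w⁻¹ : ℤˣ) : ℤ) * (g : Matrix (Fin 2) (Fin 2) ℤ) 0 1,
      ((w⁻¹ : ℤˣ) : ℤ) * (g : Matrix (Fin 2) (Fin 2) ℤ) 0 0, ?_⟩
    have := w.inv_mul
    rw [hw] at this
    linear_combination this
  obtain ⟨k, hk, hkx⟩ := exists_isCoprime_mul_modEq_gcd hn x
  set c := Int.gcd x n with hc
  have hc0 : 0 < c := Int.gcd_pos_of_ne_zero_right _ (by exact_mod_cast hn)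
  have hcn : c ∣ n := by
    have := Int.gcd_dvd_right x (n : ℤ)
    exact_mod_cast this
  obtain ⟨e, he⟩ := hcn
  have hcx : (c : ℤ) ∣ x := Int.gcd_dvd_left x n
  have hdiv : n / c = e := by rw [he]; exact Nat.mul_div_cancel_left e hc0
  have he0 : 0 < e := Nat.pos_of_ne_zero fun h => hn (by rw [he, h, mul_zero])
  have heZ : (0 : ℤ) < e := by exact_mod_cast he0
  have hnZ : (n : ℤ) = c * e := by exact_mod_cast he
  set y' := k * y with hy'
  have hcy : IsCoprime (c : ℤ) y' := by
    refine IsCoprime.mul_right ?_ (hxy.of_isCoprime_of_dvd_left hcx)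
    exact (hk.of_isCoprime_of_dvd_right ⟨e, hnZ⟩).symm
  set b := ((y' - c) % e).toNat with hb
  have hbZ : (b : ℤ) = (y' - c) % e := Int.toNat_of_nonneg (Int.emod_nonneg _ heZ.ne')
  have hbe : b < e := by
    have := Int.emod_lt_of_pos (y' - c) heZ
    rw [← hbZ] at this
    exact_mod_cast this
  have hbq : y' = c + b + e * ((y' - c) / e) := by
    have := Int.emod_add_mul_ediv (y' - c) e
    rw [← hbZ] at this
    linarith
  have hp : (c, b) ∈ pairs n := by
    refine ⟨hc0, ⟨e, he⟩, by rw [hdiv]; exact hbe, ?_⟩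
    simp only [hdiv]
    have h1 : ((Nat.gcd c (Nat.gcd b e) : ℕ) : ℤ) ∣ y' := by
      rw [hbq]
      refine dvd_add (dvd_add ?_ ?_) (Dvd.dvd.mul_right ?_ _)
      · exact_mod_cast Nat.gcd_dvd_left _ _
      · exact_mod_cast (Nat.gcd_dvd_right c _).trans (Nat.gcd_dvd_left _ _)
      · exact_mod_cast (Nat.gcd_dvd_right c _).trans (Nat.gcd_dvd_right _ _)
    have h2 : ((Nat.gcd c (Nat.gcd b e) : ℕ) : ℤ) ∣ c := by exact_mod_cast Nat.gcd_dvd_left _ _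
    have h3 := hcy.isUnit_of_dvd' h2 h1
    simpa using Int.isUnit_iff_natAbs_eq.1 h3
  refine ⟨(c, b), hp, ?_⟩
  obtain ⟨k₀, -, -, hd⟩ := dmin_spec hp
  have hcd := isCoprime_dmin hp
  simp only [hdiv] at hd
  set d : ℤ := (dmin n (c, b) : ℤ) with hddef
  have hd' : d = c + b + k₀ * e := by rw [hddef, hd]; push_cast; ring
  obtain ⟨s₁, s₂, hs⟩ := hcy
  -- `t e` is the shift from `y'` to `d`. With `s₁ c + s₂ y' = 1`, the multiplier `1 + s₂ t e`
  -- achieves it modulo `n = c e` and fixes `c` modulo `n`.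
  set t : ℤ := k₀ - (y' - c) / e with ht
  have hdt : d = y' + t * e := by rw [hd', ht]; linear_combination -hbq
  have hmod : d = (1 + s₂ * t * e) * y' + n * (s₁ * t) := by
    rw [hnZ]; linear_combination hdt - t * e * hs
  symm
  refine Eq.trans (b := cls n c y') ?_ ?_
  · exact cls_eq_iff.2 ⟨k, hk, hkx, Int.ModEq.refl _⟩
  · refine cls_eq_iff.2 ⟨1 + s₂ * t * e, ?_, ?_, ?_⟩
    · rw [hnZ]
      refine IsCoprime.mul_right ?_ ⟨1, -(s₂ * t), by ring⟩
      have h1 : IsCoprime ((1 + s₂ * t * e) * y') (c : ℤ) := by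
        have : (1 + s₂ * t * e) * y' = d + c * (-(e * (s₁ * t))) := by
          rw [hmod, hnZ]; ring
        rw [this]
        exact IsCoprime.add_mul_left_left hcd.symm _
      exact h1.of_mul_left_left
    · rw [Int.modEq_iff_dvd]
      exact ⟨s₂ * t, by rw [hnZ]; ring⟩
    · rw [Int.modEq_iff_dvd]
      exact ⟨-(s₁ * t), by linear_combination -hmod⟩

/-- Divisibility in both directions recovers `c`. The multiplier is then `1` modulo `e`, and the
second entry determines `b` modulo `e`. -/
lemma pairs_injOn {n : ℕ} {p q : ℕ × ℕ} (hp : p ∈ pairs n) (hq : q ∈ pairs n)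
    (h : cls n p.1 (dmin n p) = cls n q.1 (dmin n q)) : p = q := by
  obtain ⟨k, hk, h1, h2⟩ := cls_eq_iff.1 h
  obtain ⟨c, b⟩ := p
  obtain ⟨c', b'⟩ := q
  obtain ⟨hc0, hcn, hb, -⟩ := id hp
  obtain ⟨hc0', hcn', hb', -⟩ := id hq
  obtain ⟨s, -, -, hd⟩ := dmin_spec hp
  obtain ⟨s', -, -, hd'⟩ := dmin_spec hq
  dsimp only at *
  have hcnZ : (c : ℤ) ∣ n := by exact_mod_cast hcn
  have hcnZ' : (c' : ℤ) ∣ n := by exact_mod_cast hcn'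
  have e1 : (c : ℤ) ∣ c' := by
    have := (Int.modEq_iff_dvd.1 (h1.of_dvd hcnZ))
    exact (dvd_sub_right (Dvd.intro_left k rfl)).1 this
  have e2 : (c' : ℤ) ∣ c := by
    have := (Int.modEq_iff_dvd.1 (h1.of_dvd hcnZ'))
    have h3 : (c' : ℤ) ∣ k * c := (dvd_sub_left dvd_rfl).1 this
    exact (hk.of_isCoprime_of_dvd_right hcnZ').symm.dvd_of_dvd_mul_left h3
  have hcc : c = c' := Nat.dvd_antisymm (by exact_mod_cast e1) (by exact_mod_cast e2)
  subst hcc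
  obtain ⟨e, he⟩ := hcn
  have hdiv : n / c = e := by rw [he]; exact Nat.mul_div_cancel_left e hc0
  rw [hdiv] at hb hb' hd hd'
  have hnZ : (n : ℤ) = c * e := by exact_mod_cast he
  have hc0Z : (c : ℤ) ≠ 0 := by positivity
  have h4 : (e : ℤ) ∣ k - 1 := by
    obtain ⟨t, ht⟩ := Int.modEq_iff_dvd.1 h1
    refine ⟨t, mul_left_cancel₀ hc0Z ?_⟩
    rw [hnZ] at ht
    linear_combination ht
  have h5 : (b' : ℤ) ≡ b [ZMOD e] := by
    have h6 := h2.of_dvd (⟨c, by rw [hnZ]; ring⟩ : (e : ℤ) ∣ n)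
    rw [hd, hd'] at h6
    rw [Int.modEq_iff_dvd] at h6 ⊢
    obtain ⟨t, ht⟩ := h6
    obtain ⟨r, hr⟩ := h4
    push_cast at ht
    refine ⟨t - r * (c + b + s * e) + s' - s, ?_⟩
    linear_combination ht - (c + b + s * e) * hr
  have h6 : b' ≡ b [MOD e] := (Int.natCast_modEq_iff).1 h5
  rw [Nat.ModEq, Nat.mod_eq_of_lt hb, Nat.mod_eq_of_lt hb'] at h6
  rw [h6]

lemma pairOf_spec {n : ℕ} [NeZero n] (i : Idx n) :
    pairOf n i ∈ pairs n ∧ cls n (pairOf n i).1 (dmin n (pairOf n i)) = i.1 :=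
  Classical.epsilon_spec (exists_mem_pairs i)

lemma pairOf_injective {n : ℕ} [NeZero n] : Function.Injective (pairOf n) := by
  intro i j h
  have h1 := (pairOf_spec i).2
  rw [h, (pairOf_spec j).2] at h1
  exact Subtype.ext h1.symm

lemma exists_pairOf_eq {n : ℕ} [NeZero n] {p : ℕ × ℕ} (hp : p ∈ pairs n) :
    ∃ i : Idx n, pairOf n i = p := by
  obtain ⟨g, h1, h2⟩ := (isCoprime_dmin hp).exists_SL2_row 1
  refine ⟨⟨cls n p.1 (dmin n p), (g : GL (Fin 2) ℤ), by rw [← h1, ← h2]; rfl⟩, ?_⟩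
  have := pairOf_spec (⟨cls n p.1 (dmin n p), (g : GL (Fin 2) ℤ), by rw [← h1, ← h2]; rfl⟩ : Idx n)
  exact pairs_injOn this.1 hp this.2

/-! ### Primitive matrices modulo left multiplication by `SL(2, ℤ)` -/

/-- A matrix whose entries have no common divisor. -/
def IsPrim (X : Matrix (Fin 2) (Fin 2) ℤ) : Prop := ∀ k : ℤ, (∀ i j, k ∣ X i j) → IsUnit k

lemma IsPrim.of_mul {X Y : Matrix (Fin 2) (Fin 2) ℤ} (h : IsPrim (X * Y)) : IsPrim Y := by
  refine fun k hk => h k fun i j => ?_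
  rw [Matrix.mul_apply]
  exact Finset.dvd_sum fun l _ => (hk l j).mul_left _

lemma IsPrim.of_mul_left {X Y : Matrix (Fin 2) (Fin 2) ℤ} (h : IsPrim (X * Y)) : IsPrim X := by
  refine fun k hk => h k fun i j => ?_
  rw [Matrix.mul_apply]
  exact Finset.dvd_sum fun l _ => (hk i l).mul_right _

lemma matA_spec {n : ℕ} [NeZero n] (i : Idx n) : ∃ c b e d k : ℤ, matA n i = !![c, b; 0, e] ∧
    0 < c ∧ 0 ≤ b ∧ b < e ∧ c * e = n ∧ i.1 = cls n c d ∧ d = c + b + k * e := by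
  obtain ⟨h1, h2⟩ := pairOf_spec i
  obtain ⟨k, -, -, hd⟩ := dmin_spec h1
  refine ⟨(pairOf n i).1, (pairOf n i).2, (n / (pairOf n i).1 : ℕ), dmin n (pairOf n i), k, rfl,
    by exact_mod_cast h1.1, by positivity, by exact_mod_cast h1.2.2.1, ?_, h2.symm, ?_⟩
  · exact_mod_cast Nat.mul_div_cancel' h1.2.1
  · rw [hd]; push_cast; ring

lemma isPrim_matA {n : ℕ} [NeZero n] (i : Idx n) : IsPrim (matA n i) := by
  intro k hk
  have h := (pairOf_spec i).1.2.2.2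
  have h1 : k ∣ ((pairOf n i).1 : ℤ) := by simpa [matA] using hk 0 0
  have h2 : k ∣ ((pairOf n i).2 : ℤ) := by simpa [matA] using hk 0 1
  have h3 : k ∣ ((n / (pairOf n i).1 : ℕ) : ℤ) := by simpa [matA] using hk 1 1
  rw [Int.isUnit_iff_natAbs_eq, ← Nat.dvd_one, ← h]
  exact Nat.dvd_gcd (Int.natAbs_dvd_natAbs.2 h1)
    (Nat.dvd_gcd (Int.natAbs_dvd_natAbs.2 h2) (Int.natAbs_dvd_natAbs.2 h3))

lemma det_matA {n : ℕ} [NeZero n] (i : Idx n) : (matA n i).det = n := by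
  obtain ⟨c, b, e, d, k, h, -, -, -, hn, -⟩ := matA_spec i
  rw [h, Matrix.det_fin_two_of, ← hn]
  ring

lemma SLEquiv.refl (X : Matrix (Fin 2) (Fin 2) ℤ) : SLEquiv X X := ⟨1, by simp⟩

lemma SLEquiv.symm {X Y : Matrix (Fin 2) (Fin 2) ℤ} (h : SLEquiv X Y) : SLEquiv Y X := by
  obtain ⟨γ, rfl⟩ := h
  refine ⟨γ⁻¹, ?_⟩
  rw [← mul_assoc, ← Matrix.SpecialLinearGroup.coe_mul]
  simp

lemma SLEquiv.trans {X Y Z : Matrix (Fin 2) (Fin 2) ℤ} (h : SLEquiv X Y) (h' : SLEquiv Y Z) :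
    SLEquiv X Z := by
  obtain ⟨γ, rfl⟩ := h
  obtain ⟨δ, rfl⟩ := h'
  exact ⟨γ * δ, by rw [Matrix.SpecialLinearGroup.coe_mul, mul_assoc]⟩

lemma SLEquiv.mul_right {X Y : Matrix (Fin 2) (Fin 2) ℤ} (h : SLEquiv X Y)
    (M : Matrix (Fin 2) (Fin 2) ℤ) : SLEquiv (X * M) (Y * M) := by
  obtain ⟨γ, rfl⟩ := h
  exact ⟨γ, by rw [mul_assoc]⟩

/-- Hermite normal form: make the matrix upper triangular, then reduce the upper right entry modulo
the lower right one. Primitivity is the gcd condition in `pairs`. -/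
lemma exists_slEquiv_matA {n : ℕ} [NeZero n] {X : Matrix (Fin 2) (Fin 2) ℤ} (hX : IsPrim X)
    (hdet : X.det = n) : ∃ i, SLEquiv X (matA n i) := by
  have hn : 0 < n := NeZero.pos n
  obtain ⟨γ, B, hB, b10, b00, b11⟩ := exists_SL_mul_upper (g := X) (by rw [hdet]; exact_mod_cast hn)
  have hdetB : B 0 0 * B 1 1 = n := by
    have : B.det = n := by rw [← hdet, hB, Matrix.det_mul, γ.2, one_mul]
    rwa [Matrix.det_fin_two, b10, mul_zero, sub_zero] at this
  have hBp : IsPrim B := by rw [hB] at hX; exact hX.of_mul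
  set a := (B 0 0).toNat with ha
  set b := (B 0 1 % B 1 1).toNat with hb
  have haZ : (a : ℤ) = B 0 0 := Int.toNat_of_nonneg b00.le
  have hbZ : (b : ℤ) = B 0 1 % B 1 1 := Int.toNat_of_nonneg (Int.emod_nonneg _ b11.ne')
  set d := (B 1 1).toNat with hd
  have hdZ : (d : ℤ) = B 1 1 := Int.toNat_of_nonneg b11.le
  have had : a * d = n := by
    have : (a : ℤ) * d = n := by rw [haZ, hdZ, hdetB]
    exact_mod_cast this
  have ha0 : 0 < a := by rw [ha]; omega
  have hdiv : n / a = d := by rw [← had]; exact Nat.mul_div_cancel_left d ha0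
  have hp : (a, b) ∈ pairs n := by
    refine ⟨ha0, ⟨d, had.symm⟩, ?_, ?_⟩
    · rw [hdiv]
      have := Int.emod_lt_of_pos (B 0 1) b11
      rw [← hbZ, ← hdZ] at this
      exact_mod_cast this
    · simp only [hdiv]
      have h1 : ((Nat.gcd a (Nat.gcd b d) : ℕ) : ℤ) ∣ B 0 0 := by
        rw [← haZ]; exact_mod_cast Nat.gcd_dvd_left _ _
      have h2 : ((Nat.gcd a (Nat.gcd b d) : ℕ) : ℤ) ∣ B 1 1 := by
        rw [← hdZ]; exact_mod_cast (Nat.gcd_dvd_right a _).trans (Nat.gcd_dvd_right _ _)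
      have h3 : ((Nat.gcd a (Nat.gcd b d) : ℕ) : ℤ) ∣ B 0 1 := by
        rw [← Int.emod_add_mul_ediv (B 0 1) (B 1 1), ← hbZ]
        refine dvd_add ?_ (h2.mul_right _)
        exact_mod_cast (Nat.gcd_dvd_right a _).trans (Nat.gcd_dvd_left _ _)
      have h4 := hBp _ (fun i j => by
        fin_cases i <;> fin_cases j
        · exact h1
        · exact h3
        · simp [b10]
        · exact h2)
      simpa using Int.isUnit_iff_natAbs_eq.1 h4
  obtain ⟨i, hi⟩ := exists_pairOf_eq hp
  refine ⟨i, SLEquiv.trans (Y := B) ⟨γ, hB⟩ ⟨⟨!![1, B 0 1 / B 1 1; 0, 1], by simp⟩, ?_⟩⟩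
  have e : matA n i = !![B 0 0, B 0 1 % B 1 1; 0, B 1 1] := by
    rw [matA, hi]
    simp only [hdiv]
    rw [haZ, hbZ, hdZ]
  rw [e]
  ext i j
  have := Int.emod_add_mul_ediv (B 0 1) (B 1 1)
  fin_cases i <;> fin_cases j <;> simp [Matrix.mul_apply, Fin.sum_univ_two, b10]
  linarith

/-- The connecting matrix must be upper triangular with positive diagonal, hence unipotent; the
range `0 ≤ b < e` forces it to be the identity. -/
lemma eq_of_slEquiv_matA {n : ℕ} [NeZero n] {i j : Idx n} (h : SLEquiv (matA n i) (matA n j)) :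
    i = j := by
  obtain ⟨c, b, e, -, -, hi, hc, hb, hbe, hn, -⟩ := matA_spec i
  obtain ⟨c', b', e', -, -, hj, hc', hb', hbe', hn', -⟩ := matA_spec j
  obtain ⟨γ, hγ⟩ := h
  have hdet : γ 0 0 * γ 1 1 - γ 0 1 * γ 1 0 = 1 := by
    have := γ.2; rwa [Matrix.det_fin_two] at this
  have hγ' := hγ
  rw [hi, hj] at hγ
  have e00 : c = γ 0 0 * c' := by
    simpa [Matrix.mul_apply, Fin.sum_univ_two] using congrFun (congrFun hγ 0) 0
  have e01 : b = γ 0 0 * b' + γ 0 1 * e' := by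
    simpa [Matrix.mul_apply, Fin.sum_univ_two] using congrFun (congrFun hγ 0) 1
  have e10 : γ 1 0 = 0 := by
    have : 0 = γ 1 0 * c' := by
      simpa [Matrix.mul_apply, Fin.sum_univ_two] using congrFun (congrFun hγ 1) 0
    exact (mul_eq_zero.1 this.symm).resolve_right hc'.ne'
  have e11 : e = γ 1 0 * b' + γ 1 1 * e' := by
    simpa [Matrix.mul_apply, Fin.sum_univ_two] using congrFun (congrFun hγ 1) 1
  rw [e10, mul_zero, sub_zero] at hdet
  have g00 : γ 0 0 = 1 := by
    rcases Int.eq_one_or_neg_one_of_mul_eq_one hdet with h | h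
    · exact h
    · rw [h] at e00; linarith
  have g11 : γ 1 1 = 1 := by rw [g00, one_mul] at hdet; exact hdet
  rw [g00, one_mul] at e00 e01
  rw [e10, g11, zero_mul, zero_add, one_mul] at e11
  have g01 : γ 0 1 = 0 := by
    subst e11
    by_contra hne
    rcases lt_or_gt_of_ne hne with h | h
    · have : γ 0 1 ≤ -1 := by omega
      nlinarith
    · have : 1 ≤ γ 0 1 := by omega
      nlinarith
  have hb'' : b = b' := by rw [e01, g01]; ring
  have hA : matA n i = matA n j := by rw [hi, hj, e00, hb'', e11]
  refine pairOf_injective (Prod.ext ?_ ?_)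
  · have := congrFun (congrFun hA 0) 0
    simpa [matA] using this
  · have := congrFun (congrFun hA 0) 1
    simpa [matA] using this

open Set

/-! ### The chain `K^s A` -/

/-- This is a step of the division algorithm with ceilings. The new upper right entry is `q b - d`
with `0 ≤ q b - d < b`, so iteration stops. Since `d > b`, `q ≥ 2`, which preserves `a > c`. -/
lemma mapK_spec {m : ℕ} {A : Matrix (Fin 2) (Fin 2) ℤ} (hA : A ∈ setS m) (hb : A 0 1 ≠ 0) :
    mapK A ∈ setS m ∧ mapK A 0 1 < A 0 1 ∧ ∃ k : ℤ, mapK A = !![k, -1; 1, 0] * A := by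
  obtain ⟨hdet, hc, hca, hb0, hbd⟩ := hA
  have hb0' : 0 < A 0 1 := lt_of_le_of_ne hb0 (Ne.symm hb)
  have hbQ : (0 : ℚ) < A 0 1 := by exact_mod_cast hb0'
  set q := ⌈(A 1 1 : ℚ) / (A 0 1 : ℚ)⌉ with hq
  have h1 : A 1 1 ≤ q * A 0 1 := by
    have := Int.le_ceil ((A 1 1 : ℚ) / (A 0 1 : ℚ))
    rw [div_le_iff₀ hbQ, ← hq] at this
    exact_mod_cast this
  have h2 : (q - 1) * A 0 1 < A 1 1 := by
    have := Int.ceil_lt_add_one ((A 1 1 : ℚ) / (A 0 1 : ℚ))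
    rw [← hq, ← sub_lt_iff_lt_add, lt_div_iff₀ hbQ] at this
    exact_mod_cast this
  have h3 : 2 ≤ q := by
    by_contra! h
    have : q ≤ 1 := by omega
    nlinarith
  have e00 : mapK A 0 0 = -(A 1 0) + q * A 0 0 := rfl
  have e01 : mapK A 0 1 = -(A 1 1) + q * A 0 1 := rfl
  have e10 : mapK A 1 0 = A 0 0 := rfl
  have e11 : mapK A 1 1 = A 0 1 := rfl
  refine ⟨⟨?_, ?_, ?_, ?_, ?_⟩, ?_, q, ?_⟩
  · rw [Matrix.det_fin_two] at hdet ⊢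
    rw [e00, e01, e10, e11, ← hdet]
    ring
  · rw [e10]; omega
  · rw [e00, e10]; nlinarith
  · rw [e01]; linarith
  · rw [e01, e11]; linarith
  · rw [e01]; linarith
  · ext i j
    fin_cases i <;> fin_cases j <;> simp [mapK, Matrix.mul_apply, Fin.sum_univ_two, ← hq] <;> ring

lemma exists_iterate_mapK_mem_setY {m : ℕ} {A : Matrix (Fin 2) (Fin 2) ℤ} (hA : A ∈ setS m) :
    ∃ k, mapK^[k] A ∈ setY m := by
  induction hb : (A 0 1).toNat using Nat.strong_induction_on generalizing A with
  | _ b ih =>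
    by_cases h : A 0 1 = 0
    · exact ⟨0, hA, h⟩
    · obtain ⟨h1, h2, -⟩ := mapK_spec hA h
      have h3 := hA.2.2.2.1
      obtain ⟨k, hk⟩ := ih _ (by omega) h1 rfl
      exact ⟨k + 1, hk⟩

lemma iterate_mapK_steps_mem {m : ℕ} {A : Matrix (Fin 2) (Fin 2) ℤ} (hA : A ∈ setS m) :
    mapK^[steps m A] A ∈ setY m :=
  Nat.sInf_mem (s := {k | mapK^[k] A ∈ setY m}) (exists_iterate_mapK_mem_setY hA)

/-- Before the first entry into `setY` the upper right entry is nonzero, so `mapK` is never applied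
where its division by zero would matter. -/
lemma iterate_mapK_mem_setS {m : ℕ} {A : Matrix (Fin 2) (Fin 2) ℤ} (hA : A ∈ setS m) {s : ℕ}
    (hs : s ≤ steps m A) : mapK^[s] A ∈ setS m := by
  induction s with
  | zero => exact hA
  | succ s ih =>
    have h := ih (by omega)
    rw [Function.iterate_succ_apply']
    exact (mapK_spec h fun h0 => Nat.notMem_of_lt_sInf (s := {k | mapK^[k] A ∈ setY m}) hs
      ⟨h, h0⟩).1

lemma exists_iterate_mapK_succ {m : ℕ} {A : Matrix (Fin 2) (Fin 2) ℤ} (hA : A ∈ setS m) {s : ℕ}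
    (hs : s < steps m A) : ∃ k : ℤ, mapK^[s + 1] A = !![k, -1; 1, 0] * mapK^[s] A := by
  have h := iterate_mapK_mem_setS hA hs.le
  rw [Function.iterate_succ_apply']
  exact (mapK_spec h fun h0 => Nat.notMem_of_lt_sInf (s := {k | mapK^[k] A ∈ setY m}) hs
    ⟨h, h0⟩).2.2

lemma slEquiv_iterate_mapK {m : ℕ} {A : Matrix (Fin 2) (Fin 2) ℤ} (hA : A ∈ setS m) {s : ℕ}
    (hs : s ≤ steps m A) : SLEquiv (mapK^[s] A) A := by
  induction s with
  | zero => exact .refl A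
  | succ s ih =>
    obtain ⟨k, hk⟩ := exists_iterate_mapK_succ hA hs
    rw [hk]
    exact SLEquiv.trans ⟨⟨!![k, -1; 1, 0], by simp⟩, rfl⟩ (ih (by omega))

lemma isNonneg_of_mem_setS {m : ℕ} [NeZero m] {A : Matrix (Fin 2) (Fin 2) ℤ} (hA : A ∈ setS m) :
    IsNonneg A := by
  obtain ⟨hdet, hc, hca, hb, hbd⟩ := hA
  refine ⟨by rw [hdet]; exact_mod_cast NeZero.pos m, fun i j => ?_⟩
  fin_cases i <;> fin_cases j
  · exact (hc.trans_lt hca).le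
  · exact hb
  · exact hc
  · exact (hb.trans_lt hbd).le

lemma matA_mem_setS {m : ℕ} [NeZero m] (i : Idx m) : matA m i ∈ setS m := by
  obtain ⟨c, b, e, d, k, h, hc, hb, hbe, -⟩ := matA_spec i
  refine ⟨det_matA i, ?_⟩
  rw [h]
  exact ⟨le_rfl, hc, hb, hbe⟩

/-! ### Existence of the indices `l_{j,s}` -/

/-- The quotient of `A_j` by `A_{σ(j)}` is an integral upper triangular matrix of determinant `n`.
It is primitive because `A_j` is, so it is represented by some `A_l`. -/
lemma exists_matA_mul_slEquiv {n m : ℕ} [NeZero n] [NeZero m] (j : Idx (n * m)) (hm : m ∣ n * m) :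
    ∃ l, SLEquiv (matA n l * matA m (proj hm j)) (matA (n * m) j) := by
  obtain ⟨c, b, e, d, k, hA, hc, hb, hbe, hce, hj, hd⟩ := matA_spec j
  obtain ⟨c', b', m', d', k', hA', hc', hb', hbe', hce', hj', hd'⟩ := matA_spec (proj hm j)
  have hj'' : (proj hm j).1 = cls m c d := by
    simp only [proj, hj]
    rfl
  obtain ⟨κ, hκ, h1, h2⟩ := cls_eq_iff.1 (hj'.symm.trans hj'')
  have hm'0 : 0 < m' := hb'.trans_lt hbe'
  have hcm : c' ∣ m := ⟨m', hce'.symm⟩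
  have hmm : m' ∣ m := ⟨c', by rw [← hce']; ring⟩
  obtain ⟨x, hx⟩ : c' ∣ c := by
    have := Int.modEq_iff_dvd.1 (h1.of_dvd hcm)
    exact (dvd_sub_right (Dvd.intro_left κ rfl)).1 this
  obtain ⟨t, ht⟩ := Int.modEq_iff_dvd.1 h1
  have hxκ : κ = x + m' * t := by
    refine mul_left_cancel₀ hc'.ne' ?_
    rw [hx, ← hce'] at ht
    linear_combination ht
  have hx0 : 0 < x := by
    rw [hx] at hc
    exact pos_of_mul_pos_right hc hc'.le
  have hxe : x * e = n * m' := by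
    refine mul_left_cancel₀ hc'.ne' ?_
    push_cast at hce
    rw [hx, ← hce'] at hce
    linear_combination hce
  have hxm : IsCoprime x m' := by
    have := hκ.of_isCoprime_of_dvd_right hmm
    rw [hxκ] at this
    exact (IsCoprime.add_mul_left_left_iff).1 this
  obtain ⟨n', hn'⟩ : x ∣ n := hxm.dvd_of_dvd_mul_right ⟨e, hxe.symm⟩
  have he : e = n' * m' := by
    refine mul_left_cancel₀ hx0.ne' ?_
    rw [hxe, hn']
    ring
  obtain ⟨r, hr⟩ := Int.modEq_iff_dvd.1 (h2.of_dvd hmm)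
  -- Compatibility of second entries under the projection. The summand `c` in `d_n(c, b)` drops out,
  -- as `c = x c'` and `κ ≡ x` modulo `m'`; this leaves `b ≡ x b'` modulo `m'`.
  have hy : b = x * b' + m' * (-r + κ * k' + t * c' + t * b' - k * n') := by
    rw [hd, hd', hx, he, hxκ] at hr
    rw [hxκ]
    linear_combination -hr
  set y := -r + κ * k' + t * c' + t * b' - k * n'
  have hZ : !![x, y; 0, n'] * matA m (proj hm j) = matA (n * m) j := by
    rw [hA, hA']
    ext i j
    fin_cases i <;> fin_cases j <;> simp [Matrix.mul_apply, Fin.sum_univ_two, hx, he, hy] <;> ring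
  have hp := isPrim_matA j
  rw [← hZ] at hp
  obtain ⟨l, hl⟩ := exists_slEquiv_matA (n := n) hp.of_mul_left (by simp [Matrix.det_fin_two, hn'])
  refine ⟨l, ?_⟩
  rw [← hZ]
  exact hl.symm.mul_right _

/-- If `B = M A`, the product `A_l M⁻¹` is still primitive of determinant `n`; its representative
absorbs `M`. -/
lemma SLEquiv.exists_matA_mul {n : ℕ} [NeZero n] {l : Idx n} {A B C : Matrix (Fin 2) (Fin 2) ℤ}
    (hl : SLEquiv (matA n l * A) C) (hB : SLEquiv B A) : ∃ l', SLEquiv (matA n l' * B) C := by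
  obtain ⟨M, rfl⟩ := hB
  have e : matA n l * ((M⁻¹ : SL(2, ℤ)) : Matrix (Fin 2) (Fin 2) ℤ) *
      (M : Matrix (Fin 2) (Fin 2) ℤ) = matA n l := by
    rw [mul_assoc, ← Matrix.SpecialLinearGroup.coe_mul]
    simp
  obtain ⟨l', hl'⟩ := exists_slEquiv_matA (n := n)
    (X := matA n l * ((M⁻¹ : SL(2, ℤ)) : Matrix (Fin 2) (Fin 2) ℤ))
    (by have := isPrim_matA l; rw [← e] at this; exact this.of_mul_left)
    (by rw [Matrix.det_mul, det_matA, Matrix.SpecialLinearGroup.det_coe, mul_one])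
  refine ⟨l', (hl'.symm.mul_right _).trans ?_⟩
  rw [← mul_assoc, e]
  exact hl

lemma idxL_spec {n m : ℕ} [NeZero n] [NeZero m] (j : Idx (n * m)) {s : ℕ}
    (hs : s ≤ steps m (matA m (proj (Dvd.intro_left n rfl) j))) :
    SLEquiv (matA n (idxL n m j s) * mapK^[s] (matA m (proj (Dvd.intro_left n rfl) j)))
      (matA (n * m) j) := by
  obtain ⟨l, hl⟩ := exists_matA_mul_slEquiv j (Dvd.intro_left n rfl)
  exact Classical.epsilon_spec (hl.exists_matA_mul (slEquiv_iterate_mapK (matA_mem_setS _) hs))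

/-! ### The map `hₙ` -/

/-- The matrix `(0, 1; -n, 0)`. -/
def fricke (n : ℕ) : Matrix (Fin 2) (Fin 2) ℤ := !![0, 1; -(n : ℤ), 0]

lemma fricke_mul_matB (n m : ℕ) : fricke n * matB m = fricke (n * m) := by
  ext i j
  fin_cases i <;> fin_cases j <;> simp [fricke, matB, Matrix.mul_apply, Fin.sum_univ_two]

lemma mapH_spec {n : ℕ} [NeZero n] (R : Idx n → SL(2, ℤ)) (i : Idx n) :
    SLEquiv (fricke n * (R i : Matrix (Fin 2) (Fin 2) ℤ)) (matA n (mapH R i)) := by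
  refine Classical.epsilon_spec (exists_slEquiv_matA (n := n)
    (X := fricke n * (R i : Matrix (Fin 2) (Fin 2) ℤ)) ?_ ?_)
  · refine IsPrim.of_mul_left (Y := ((R i)⁻¹ : SL(2, ℤ))) ?_
    rw [mul_assoc, ← Matrix.SpecialLinearGroup.coe_mul, mul_inv_cancel,
      Matrix.SpecialLinearGroup.coe_one, mul_one]
    exact fun k hk => isUnit_of_dvd_one (hk 0 1)
  · rw [Matrix.det_mul, Matrix.SpecialLinearGroup.det_coe]
    simp [fricke]

/-- Conjugating an element of `SL(2, ℤ)` by `(0, 1; -n, 0)` multiplies one off-diagonal entry by `n`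
and divides the other. Integrality of `X` makes the divided entry integral, so the conjugate lies in
`Γ₀(n)`. -/
lemma exists_gamma0_of_slEquiv_fricke {n m : ℕ} [NeZero n] {X : Matrix (Fin 2) (Fin 2) ℤ}
    (h : SLEquiv (fricke n * X) (fricke n * matB m)) :
    ∃ γ ∈ CongruenceSubgroup.Gamma0 n, X = (γ : Matrix (Fin 2) (Fin 2) ℤ) * matB m := by
  obtain ⟨γ, hγ⟩ := h
  have hn : (n : ℤ) ≠ 0 := by exact_mod_cast NeZero.ne n
  have hdet : γ 0 0 * γ 1 1 - γ 0 1 * γ 1 0 = 1 := by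
    have := γ.2; rwa [Matrix.det_fin_two] at this
  have e00 : X 1 0 = -(γ 0 1 * (n * m)) := by
    simpa [fricke, matB, Matrix.mul_apply, Fin.sum_univ_two] using congrFun (congrFun hγ 0) 0
  have e01 : X 1 1 = γ 0 0 := by
    simpa [fricke, matB, Matrix.mul_apply, Fin.sum_univ_two] using congrFun (congrFun hγ 0) 1
  have e10 : n * X 0 0 = γ 1 1 * (n * m) := by
    simpa [fricke, matB, Matrix.mul_apply, Fin.sum_univ_two] using congrFun (congrFun hγ 1) 0
  have e11 : -(n * X 0 1) = γ 1 0 := by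
    simpa [fricke, matB, Matrix.mul_apply, Fin.sum_univ_two] using congrFun (congrFun hγ 1) 1
  have e10' : X 0 0 = γ 1 1 * m := mul_left_cancel₀ hn (by rw [e10]; ring)
  refine ⟨⟨!![γ 1 1, X 0 1; -(n * γ 0 1), γ 0 0], ?_⟩, ?_, ?_⟩
  · rw [Matrix.det_fin_two_of]
    linear_combination hdet - γ 0 1 * e11
  · refine CongruenceSubgroup.Gamma0_mem.2 ?_
    simp
  · ext i j
    fin_cases i <;> fin_cases j <;>
      simp [matB, Matrix.mul_apply, Fin.sum_univ_two, e00, e01, e10']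
    ring

lemma exists_gamma0_mul_eq {n m : ℕ} [NeZero n] {h : Matrix (Fin 2) (Fin 2) ℤ} {g g' : SL(2, ℤ)}
    (H : SLEquiv (fricke n * ((g : Matrix (Fin 2) (Fin 2) ℤ) * h))
      (fricke (n * m) * (g' : Matrix (Fin 2) (Fin 2) ℤ))) :
    ∃ γ ∈ CongruenceSubgroup.Gamma0 n, (g : Matrix (Fin 2) (Fin 2) ℤ) * h =
      (γ : Matrix (Fin 2) (Fin 2) ℤ) * (matB m * (g' : Matrix (Fin 2) (Fin 2) ℤ)) := by
  have e : (g' : Matrix (Fin 2) (Fin 2) ℤ) * ((g'⁻¹ : SL(2, ℤ)) : Matrix (Fin 2) (Fin 2) ℤ) =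
      1 := by
    rw [← Matrix.SpecialLinearGroup.coe_mul]; simp
  have e' : ((g'⁻¹ : SL(2, ℤ)) : Matrix (Fin 2) (Fin 2) ℤ) * (g' : Matrix (Fin 2) (Fin 2) ℤ) =
      1 := by
    rw [← Matrix.SpecialLinearGroup.coe_mul]; simp
  have H' := H.mul_right ((g'⁻¹ : SL(2, ℤ)) : Matrix (Fin 2) (Fin 2) ℤ)
  rw [mul_assoc, mul_assoc, mul_assoc (fricke (n * m)), e, mul_one, ← fricke_mul_matB] at H'
  obtain ⟨γ, hγ, h1⟩ := exists_gamma0_of_slEquiv_fricke H'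
  refine ⟨γ, hγ, ?_⟩
  rw [← mul_assoc, ← h1, mul_assoc, mul_assoc, e', mul_one]

/-- Equal images put two representatives in the same coset of `Γ₀(n)`, by the preceding lemma with
`m = 1`. -/
lemma mapH_bijective {n : ℕ} [NeZero n] {R : Idx n → SL(2, ℤ)} (hR : IsRepSystem n R) :
    Function.Bijective (mapH R) := by
  refine Finite.injective_iff_bijective.1 fun i j hij => ?_
  have h := mapH_spec R i
  rw [hij] at h
  have h1 := h.trans (mapH_spec R j).symm
  obtain ⟨γ, hγ, h2⟩ := exists_gamma0_mul_eq (m := 1) (h := 1) (g := R i) (g' := R j)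
    (by rwa [mul_one, mul_one])
  have h3 : R i = γ * R j := by
    apply Subtype.ext
    have : matB 1 = 1 := by
      ext i j
      fin_cases i <;> fin_cases j <;> simp [matB]
    rw [mul_one, this, one_mul] at h2
    exact h2
  exact (hR (R i)).unique ⟨1, one_mem _, (one_mul _).symm⟩ ⟨γ, hγ, h3⟩

lemma actH_mapH {n : ℕ} [NeZero n] {R : Idx n → SL(2, ℤ)} (hR : IsRepSystem n R)
    (ψ : Idx n → ℂ → ℂ) (j : Idx n) (ζ : ℂ) : actH R ψ (mapH R j) ζ = ψ j ζ := by
  rw [actH, Matrix.mulVec, dotProduct, Finset.sum_eq_single j]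
  · simp [matH]
  · intro k _ hk
    simp [matH, (mapH_bijective hR).1.ne hk]
  · simp

/-- Each row of the permutation matrix has a single nonzero entry. Its position is described through
`g` rather than `g⁻¹`, matching the relation that defines a chain. -/
lemma exists_rhoTilde_mulVec {n : ℕ} [NeZero n] (g : SL(2, ℤ)) (i : Idx n) :
    ∃ a, SLEquiv (matA n a * (g : Matrix (Fin 2) (Fin 2) ℤ)) (matA n i) ∧
      ∀ ψ, (rhoTilde n g⁻¹).mulVec ψ i = ψ a := by
  have e : ((g⁻¹ : SL(2, ℤ)) : Matrix (Fin 2) (Fin 2) ℤ) * (g : Matrix (Fin 2) (Fin 2) ℤ) = 1 := by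
    rw [← Matrix.SpecialLinearGroup.coe_mul]; simp
  obtain ⟨a, ha⟩ := exists_slEquiv_matA (n := n)
    (X := matA n i * ((g⁻¹ : SL(2, ℤ)) : Matrix (Fin 2) (Fin 2) ℤ))
    (IsPrim.of_mul_left (Y := g) (by rw [mul_assoc, e, mul_one]; exact isPrim_matA i))
    (by rw [Matrix.det_mul, det_matA, Matrix.SpecialLinearGroup.det_coe, mul_one])
  refine ⟨a, ?_, fun ψ => ?_⟩
  · have := ha.symm.mul_right (g : Matrix (Fin 2) (Fin 2) ℤ)
    rwa [mul_assoc, e, mul_one] at this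
  · have h : ∀ j, SLEquiv (matA n i * ((g⁻¹ : SL(2, ℤ)) : Matrix (Fin 2) (Fin 2) ℤ)) (matA n j) ↔
        a = j := fun j =>
      ⟨fun hj => eq_of_slEquiv_matA (ha.symm.trans hj), fun hj => hj ▸ ha⟩
    rw [Matrix.mulVec, dotProduct, Finset.sum_eq_single a]
    · rw [rhoTilde, if_pos ha, one_mul]
    · intro k _ hk
      rw [rhoTilde, if_neg fun hk' => hk ((h k).1 hk').symm, zero_mul]
    · simp

/-! ### Period functions -/

lemma IsMaassCuspForm.isRapid_vecForm {n : ℕ} {β : ℂ} {u : ℍ → ℂ} (hu : IsMaassCuspForm n β u)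
    (R : Idx n → SL(2, ℤ)) (j : Idx n) : IsRapid β (ext (vecForm R u j)) :=
  (hu.isRapid.comp_mob (by rw [Matrix.SpecialLinearGroup.det_coe]; exact one_pos)).congr
    (ext_slashZero u _).symm

lemma IsMaassCuspForm.ext_mob_gamma0 {n : ℕ} {β : ℂ} {u : ℍ → ℂ} (hu : IsMaassCuspForm n β u)
    {γ : SL(2, ℤ)} (hγ : γ ∈ CongruenceSubgroup.Gamma0 n) {z : ℂ} (hz : z ∈ Hs) :
    ext u (mob (γ : Matrix (Fin 2) (Fin 2) ℤ) z) = ext u z := by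
  have h := ext_mob u γ ⟨z, hz⟩
  rw [hu.invariant γ hγ] at h
  refine h.trans ?_
  rw [ext, UpperHalfPlane.ofComplex_apply_of_im_pos hz]

/-- The relation between the classes becomes `R_j h = γ B_m R'_k` with `γ ∈ Γ₀(n)`, and invariance
of `u` removes `γ`. The separate variable `N` lets the case `m = 1` be used at level `n` itself. -/
lemma IsMaassCuspForm.ext_vecForm_comp_mob {n m N : ℕ} [NeZero n] [NeZero m] [NeZero N] {β : ℂ}
    {u v : ℍ → ℂ} (hu : IsMaassCuspForm n β u) (hN : N = n * m)
    (hv : EqOn (ext v) (ext u ∘ mob (matB m)) Hs) {R : Idx n → SL(2, ℤ)} {R' : Idx N → SL(2, ℤ)}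
    {j : Idx n} {k : Idx N} {h : Matrix (Fin 2) (Fin 2) ℤ} (hh : 0 < h.det)
    (H : SLEquiv (matA n (mapH R j) * h) (matA N (mapH R' k))) :
    EqOn (ext (vecForm R u j) ∘ mob h) (ext (vecForm R' v k)) Hs := by
  have H' := (((mapH_spec R j).mul_right h).trans H).trans (mapH_spec R' k).symm
  rw [hN, mul_assoc] at H'
  obtain ⟨γ, hγ, e⟩ := exists_gamma0_mul_eq H'
  have hB : 0 < (matB m).det := by
    have := NeZero.pos m
    simp only [matB, Matrix.det_fin_two_of]
    omega
  have hg : 0 < (R' k : Matrix (Fin 2) (Fin 2) ℤ).det := by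
    rw [Matrix.SpecialLinearGroup.det_coe]; exact one_pos
  have hBg : 0 < (matB m * (R' k : Matrix (Fin 2) (Fin 2) ℤ)).det := by
    rw [Matrix.det_mul]; exact mul_pos hB hg
  intro z hz
  change ext (slashZero u _) (mob h z) = ext (slashZero v _) z
  rw [ext_slashZero u _ (mob_mem_Hs hh hz), ext_slashZero v _ hz, Function.comp, Function.comp,
    mob_mob_of_pos hh hz, e, ← mob_mob_of_pos hBg hz, hu.ext_mob_gamma0 hγ (mob_mem_Hs hBg hz),
    ← mob_mob_of_pos hg hz, hv (mob_mem_Hs hg hz)]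
  rfl

/-- The chain is `T`, `T' = (1, -1; 1, 0) T`. Since `φ` is prescribed only on the cut plane, the
result also applies to the lift once that is known to be a period vector. -/
theorem IsMaassCuspForm.isLewisSolution {n : ℕ} [NeZero n] {β : ℂ} {u : ℍ → ℂ}
    (hu : IsMaassCuspForm n β u) {R : Idx n → SL(2, ℤ)} (hR : IsRepSystem n R)
    {φ : Idx n → ℂ → ℂ}
    (hφ : ∀ i, EqOn (φ i) (actH R (vecPeriod β (vecForm R u)) i) Complex.slitPlane) :
    IsLewisSolution n β φ := by
  have hφ' : ∀ j, EqOn (φ (mapH R j)) (periodInt β (vecForm R u j)) Complex.slitPlane := by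
    intro j ζ hζ
    rw [hφ _ hζ, actH_mapH hR]
    rfl
  intro z hz
  ext i
  obtain ⟨a, ha, ha'⟩ := exists_rhoTilde_mulVec ModularGroup.T i
  obtain ⟨b, hb, hb'⟩ := exists_rhoTilde_mulVec T' i
  simp only [Pi.sub_apply, Pi.smul_apply, Pi.zero_apply, ha', hb', smul_eq_mul]
  obtain ⟨ji, rfl⟩ := (mapH_bijective hR).2 i
  obtain ⟨ja, rfl⟩ := (mapH_bijective hR).2 a
  obtain ⟨jb, rfl⟩ := (mapH_bijective hR).2 b
  have hTn : IsNonneg (ModularGroup.T : Matrix (Fin 2) (Fin 2) ℤ) := by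
    refine ⟨by rw [Matrix.SpecialLinearGroup.det_coe]; exact one_pos, fun i j => ?_⟩
    rw [ModularGroup.coe_T]
    fin_cases i <;> fin_cases j <;> simp
  have hTn' : IsNonneg (T' : Matrix (Fin 2) (Fin 2) ℤ) := by
    refine ⟨by rw [Matrix.SpecialLinearGroup.det_coe]; exact one_pos, fun i j => ?_⟩
    fin_cases i <;> fin_cases j <;> simp [T']
  have hv : EqOn (ext u) (ext u ∘ mob (matB 1)) Hs := fun z _ => by
    simp [mob, matB]
  have key := sum_slash_periodInt (β := β) (K := 1) (w := vecForm R u ji)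
    (u := fun s => if s = 0 then vecForm R u ja else vecForm R u jb)
    (h := fun s => if s = 0 then (ModularGroup.T : Matrix (Fin 2) (Fin 2) ℤ) else T')
    (fun s => by split_ifs <;> exact hu.isRapid_vecForm R _)
    (fun s _ => by split_ifs <;> assumption)
    (fun s _ => by
      split_ifs
      · exact hu.ext_vecForm_comp_mob (m := 1) (mul_one n).symm hv hTn.1 ha
      · exact hu.ext_vecForm_comp_mob (m := 1) (mul_one n).symm hv hTn'.1 hb)
    (by simp [ModularGroup.coe_T]) (by simp [T'])
    (fun s hs => by
      obtain rfl : s = 0 := by omega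
      refine ⟨1, ?_⟩
      ext i j
      fin_cases i <;> fin_cases j <;>
        simp [T', ModularGroup.coe_T, Matrix.mul_apply, Fin.sum_univ_two]) hz
  have hz1 : z + 1 ∈ Complex.slitPlane := by
    simpa [mob, ModularGroup.coe_T] using hTn.mob_mem_slitPlane hz
  have hz2 : z / (z + 1) ∈ Complex.slitPlane := by
    simpa [mob, T'] using hTn'.mob_mem_slitPlane hz
  rw [hφ' _ hz, hφ' _ hz1, hφ' _ hz2, ← key, Finset.sum_range_succ, Finset.sum_range_one]
  simp [slash, T', ModularGroup.coe_T]

/-- The chain is `K^s(A_{σ(j)})`. The defining property of `l_{j,s}` makes every component of `u`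
along it pull back to one and the same component of `v`. -/
theorem IsMaassCuspForm.lift_eqOn {n m : ℕ} [NeZero n] [NeZero m] {β : ℂ} {u : ℍ → ℂ}
    (hu : IsMaassCuspForm n β u) {R : Idx n → SL(2, ℤ)} (hR : IsRepSystem n R)
    {R' : Idx (n * m) → SL(2, ℤ)} (hR' : IsRepSystem (n * m) R') {φ : Idx n → ℂ → ℂ}
    (hφ : ∀ i, EqOn (φ i) (actH R (vecPeriod β (vecForm R u)) i) Complex.slitPlane)
    (j : Idx (n * m)) :
    EqOn (lift n m β φ j) (actH R' (vecPeriod β (vecForm R' (slashZero u (matB m)))) j)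
      Complex.slitPlane := by
  intro ζ hζ
  obtain ⟨k, rfl⟩ := (mapH_bijective hR').2 j
  rw [actH_mapH hR', vecPeriod, lift]
  set A := matA m (proj (Dvd.intro_left n rfl) (mapH R' k)) with hAdef
  have hA : A ∈ setS m := matA_mem_setS _
  choose f hf using (mapH_bijective hR).2
  have hn : ∀ s ≤ steps m A, IsNonneg (mapK^[s] A) := fun s hs =>
    isNonneg_of_mem_setS (iterate_mapK_mem_setS hA hs)
  rw [← sum_slash_periodInt (β := β) (w := vecForm R' (slashZero u (matB m)) k)
    (u := fun s => vecForm R u (f (idxL n m (mapH R' k) s))) (h := fun s => mapK^[s] A)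
    (fun s => hu.isRapid_vecForm R _) hn
    (fun s hs => hu.ext_vecForm_comp_mob rfl (ext_slashZero u (matB m)) (hn s hs).1
      (by rw [hf]; exact idxL_spec _ hs)) rfl (iterate_mapK_steps_mem hA).2
    (fun s hs => exists_iterate_mapK_succ hA hs) hζ]
  refine Finset.sum_congr rfl fun s hs => slash_congr (hn s (by
    rw [Finset.mem_range] at hs; omega)) (fun ζ hζ => ?_) hζ
  rw [hφ _ hζ]
  conv_lhs => rw [← hf (idxL n m (mapH R' k) s)]
  rw [actH_mapH hR]
  rfl

end MaassPeriod

end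

theorem mainTheorem4 (n m : ℕ) [NeZero n] [NeZero m] (β : ℂ)
    (R : MaassPeriod.Idx n → Matrix.SpecialLinearGroup (Fin 2) ℤ)
    (hR : MaassPeriod.IsRepSystem n R)
    (R' : MaassPeriod.Idx (n * m) → Matrix.SpecialLinearGroup (Fin 2) ℤ)
    (hR' : MaassPeriod.IsRepSystem (n * m) R')
    (u v : UpperHalfPlane → ℂ) (hu : MaassPeriod.IsMaassCuspForm n β u)
    (hv : v = MaassPeriod.slashZero u (MaassPeriod.matB m))
    (φ : MaassPeriod.Idx n → ℂ → ℂ)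
    (hφ : ∀ i, Set.EqOn (φ i)
      (MaassPeriod.actH R (MaassPeriod.vecPeriod β (MaassPeriod.vecForm R u)) i)
      Complex.slitPlane) :
    MaassPeriod.IsMaassCuspForm (n * m) β v ∧
    MaassPeriod.IsLewisSolution n β φ ∧
    MaassPeriod.IsLewisSolution (n * m) β (MaassPeriod.lift n m β φ) ∧
    ∀ j, Set.EqOn (MaassPeriod.lift n m β φ j)
      (MaassPeriod.actH R' (MaassPeriod.vecPeriod β (MaassPeriod.vecForm R' v)) j)
      Complex.slitPlane := by
  subst hv
  have hlift := hu.lift_eqOn hR hR' hφ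
  -- The Lewis equation of the lift needs no computation with `K`: the lift is the period vector of
  -- the cusp form `v` of level `n m`.
  exact ⟨hu.slashZero_matB, hu.isLewisSolution hR hφ,
    hu.slashZero_matB.isLewisSolution hR' hlift, hlift⟩
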